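/- Let $-\infty\le x_0<y_0\le\infty$ and let $a,b,V:(x_0,y_0)\to\mathbb R$ be Lebesgue measurable functions with $a,b,V\in L^\infty_{loc}(x_0,y_0;dx)$, $V\ge 0$ a.e., $a>0$ a.e., and $\frac1a,\frac ba\in L^1_{loc}(x_0,y_0;dx)$ (where "loc" means on every compact sub-interval of $(x_0,y_0)$). Fix $c\in(x_0,y_0)$ and $\lambda>0$, and set $$\alpha(x)=\exp\Big(\int_c^x\frac{b(t)}{a(t)}\,dt\Big),\qquad \rho(x)=\frac{1}{a(x)}\exp\Big(\int_c^x\frac{b(t)}{a(t)}\,dt\Big).$$ Let $E=L^\infty(x_0,y_0;\rho\,dx)$ (real scalars) carry the topology $\mathcal C(L^\infty,L^1)$ of uniform convergence on the compact subsets of the Banach space $L^1(x_0,y_0;\rho\,dx)$, under the pairing $\langle f,g\rangle=\int fg\,\rho\,dx$. A $C_0$-semigroup on $E$ is a family $(T(t))_{t\ge0}$ of continuous linear operators on $E$ with $T(0)=I$, $T(t+s)=T(t)T(s)$, $T(t)f\to f$ as $t\downarrow0$ for every $f\in E$, and such that $(e^{-\omega_0t}T(t))_{t\ge0}$ is equicontinuous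 for some $\omega_0\in\mathbb R$; its generator is $\mathcal Lf=\lim_{t\downarrow0}(T(t)f-f)/t$, with domain the set of $f$ for which the limit exists in $E$. A linear operator with dense domain in $E$ is a pre-generator if the generator of some $C_0$-semigroup on $E$ extends it; a pre-generator is called $L^\infty(x_0,y_0;\rho\,dx)$-unique if exactly one $C_0$-semigroup on $E$ has a generator extending it. Consider $\mathcal A_1^Vf=af''+bf'-Vf$ with domain $C_0^\infty(x_0,y_0)$, as an operator in $E$. Then $\mathcal A_1^V$ is a pre-generator, and it is $L^\infty(x_0,y_0;\rho\,dx)$-unique if and only if both $$\int_c^{y_0}\rho(y)\sum_{n=0}^\infty\phi_n(y)\,dy=+\infty\qquad\text{and}\qquad \int_{x_0}^c\rho(x)\sum_{n=0}^\infty\psi_n(x)\,dx=+\infty,$$ where $\phi_0=\psi_0=1$ and, for $n\ge1$, $$\phi_n(y)=\int_c^y\frac{1}{\alpha(r)}\int_c^r\rho(t)[\lambda+V(t)]\phi_{n-1}(t)\,dt\,dr\quad(c<y<y_0),$$ $$\psi_n(x)=\int_x^c\frac{1}{\alpha(r)}\int_r^c\rho(t)[\lambda+V(t)]\psi_{n-1}(t)\,dt\,dr\quad(x_0<x<c).$$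 In particular, if $V=0$ a.e., then $\mathcal A_1^V$ is $L^\infty(x_0,y_0;\rho\,dx)$-unique if and only if neither endpoint is an entrance boundary in Feller's sense, i.e. both $$\int_c^{y_0}\rho(y)\int_c^y\frac1{\alpha(r)}\int_c^r\rho(t)\,dt\,dr\,dy=+\infty\qquad\text{and}\qquad\int_{x_0}^c\rho(x)\int_x^c\frac1{\alpha(r)}\int_r^c\rho(t)\,dt\,dr\,dx=+\infty.$$ -/

import Mathlib

open MeasureTheory Filter Topology Set TopologicalSpace
open scoped NNReal ENNReal ContDiff Distributions CompactConvergenceCLM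

noncomputable section

/-! ### `C₀`-semigroups on topological vector spaces, pre-generators and their uniqueness -/

/-- A `C₀`-semigroup of continuous linear operators on a (real, locally convex) topological vector
space `E`: `T(0) = I`, `T(t + s) = T(t) T(s)`, `T(t) x → x` as `t ↓ 0`, and for some real `ω₀` the
family `(e^{-ω₀ t} T(t))_{t ≥ 0}` is equicontinuous. -/
structure C0Semigroup (E : Type*) [AddCommGroup E] [Module ℝ E] [UniformSpace E] where
  toFun : ℝ≥0 → E →L[ℝ] E
  map_zero' : toFun 0 = ContinuousLinearMap.id ℝ E
  map_add' : ∀ t s : ℝ≥0, toFun (t + s) = (toFun t).comp (toFun s)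
  tendsto_zero' : ∀ x : E, Tendsto (fun t : ℝ≥0 => toFun t x) (𝓝[>] 0) (𝓝 x)
  equicontinuous' : ∃ ω₀ : ℝ,
    Equicontinuous (fun (t : ℝ≥0) (x : E) => Real.exp (-ω₀ * (t : ℝ)) • toFun t x)

namespace C0Semigroup

variable {E : Type*} [AddCommGroup E] [Module ℝ E] [UniformSpace E]

/-- `S.HasGenerator x y`: the vector `x` lies in the domain of the infinitesimal generator `L` of
`S`, and `L x = y`. -/
def HasGenerator (S : C0Semigroup E) (x y : E) : Prop :=
  Tendsto (fun t : ℝ≥0 => (t : ℝ)⁻¹ • (S.toFun t x - x)) (𝓝[>] 0) (𝓝 y)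

/-- The generator of `S` extends the linear operator `A` whose domain is the space `D` of vectors,
included into `E` through `j`. -/
def GeneratorExtends {D : Type*} [AddCommGroup D] [Module ℝ D] (S : C0Semigroup E)
    (j A : D →ₗ[ℝ] E) : Prop :=
  ∀ f : D, S.HasGenerator (j f) (A f)

end C0Semigroup

/-- The operator `A`, with domain `D` included into `E` through `j`, is a pre-generator: its domain
is dense and it is extended by the generator of some `C₀`-semigroup on `E`. -/
def IsPreGenerator {E : Type*} [AddCommGroup E] [Module ℝ E] [UniformSpace E]
    {D : Type*} [AddCommGroup D] [Module ℝ D] (j A : D →ₗ[ℝ] E) : Prop :=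
  DenseRange j ∧ ∃ S : C0Semigroup E, S.GeneratorExtends j A

/-- The operator `A`, with domain `D` included into `E` through `j`, is `E`-unique: it is a
pre-generator and there is exactly one `C₀`-semigroup on `E` whose generator extends it. -/
def IsUniquePreGenerator {E : Type*} [AddCommGroup E] [Module ℝ E] [UniformSpace E]
    {D : Type*} [AddCommGroup D] [Module ℝ D] (j A : D →ₗ[ℝ] E) : Prop :=
  IsPreGenerator j A ∧ ∃! S : C0Semigroup E, S.GeneratorExtends j A

/-! ### The space `L^∞(m)` with the topology of uniform convergence on compact subsets of `L¹(m)` -/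

/-- The vector space `L^∞(m)`; it carries the topology `𝒞(L^∞(m), L¹(m))` below, not the norm
topology. -/
def LInftyC (m : Measure ℝ) : Type := Lp ℝ ∞ m

namespace LInftyC

variable (m : Measure ℝ)

instance : AddCommGroup (LInftyC m) := inferInstanceAs (AddCommGroup (Lp ℝ ∞ m))

instance : Module ℝ (LInftyC m) := inferInstanceAs (Module ℝ (Lp ℝ ∞ m))

/-- The canonical map `f ↦ (g ↦ ∫ f g dm)` from `L^∞(m)` to the space of continuous linear
functionals on `L¹(m)` with the topology of uniform convergence on compact sets. -/
def toDual : LInftyC m →ₗ[ℝ] (Lp ℝ 1 m →L_c[ℝ] ℝ) where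
  toFun f := (ContinuousLinearMap.mul ℝ ℝ).lpPairing m ∞ 1 (f : Lp ℝ ∞ m)
  map_add' f g := ((ContinuousLinearMap.mul ℝ ℝ).lpPairing m ∞ 1).map_add f g
  map_smul' r f := ((ContinuousLinearMap.mul ℝ ℝ).lpPairing m ∞ 1).map_smul r f

theorem toDual_apply (f : LInftyC m) (g : Lp ℝ 1 m) :
    toDual m f g = ∫ x, (show Lp ℝ ∞ m from f) x * g x ∂m :=
  (ContinuousLinearMap.mul ℝ ℝ).lpPairing_eq_integral (show Lp ℝ ∞ m from f) g

/-- The topology (uniformity) `𝒞(L^∞(m), L¹(m))` of uniform convergence on compact subsets of the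
Banach space `L¹(m)`. -/
instance : UniformSpace (LInftyC m) := UniformSpace.comap (toDual m) inferInstance

instance : IsUniformAddGroup (LInftyC m) := IsUniformAddGroup.comap (toDual m)

instance : ContinuousSMul ℝ (LInftyC m) := continuousSMul_induced (toDual m)

end LInftyC

/-! ### The one-dimensional operator -/

/-- The open interval `(x₀, y₀)`, where `-∞ ≤ x₀ < y₀ ≤ ∞`. -/
def openInterval (x₀ y₀ : EReal) : Opens ℝ :=
  ⟨{x : ℝ | x₀ < (x : EReal) ∧ (x : EReal) < y₀},
    (isOpen_Ioo (a := x₀) (b := y₀)).preimage continuous_coe_real_ereal⟩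

/-- `f ∈ L^p_loc(x₀, y₀; dx)`: `f` is in `L^p` of every compact sub-interval of `(x₀, y₀)`. -/
def LocLp (p : ℝ≥0∞) (x₀ y₀ : EReal) (f : ℝ → ℝ) : Prop :=
  ∀ r s : ℝ, Icc r s ⊆ (openInterval x₀ y₀ : Set ℝ) → MemLp f p (volume.restrict (Icc r s))

/-- The assumptions on the coefficients `a`, `b`, `V` of the operator
`f ↦ a f'' + b f' - V f` on `(x₀, y₀)`. -/
structure Admissible (x₀ y₀ : EReal) (a b V : ℝ → ℝ) : Prop where
  a_loc : LocLp ∞ x₀ y₀ a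
  b_loc : LocLp ∞ x₀ y₀ b
  V_loc : LocLp ∞ x₀ y₀ V
  V_nonneg : ∀ᵐ x ∂(volume.restrict (openInterval x₀ y₀ : Set ℝ)), 0 ≤ V x
  a_pos : ∀ᵐ x ∂(volume.restrict (openInterval x₀ y₀ : Set ℝ)), 0 < a x
  inv_a_loc : LocLp 1 x₀ y₀ (fun x => 1 / a x)
  b_div_a_loc : LocLp 1 x₀ y₀ (fun x => b x / a x)

/-- Feller's scale function `α(x) = exp (∫_c^x b(t)/a(t) dt)`. -/
def fellerScale (a b : ℝ → ℝ) (c x : ℝ) : ℝ := Real.exp (∫ t in c..x, b t / a t)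

/-- The density `ρ(x) = (1/a(x)) exp (∫_c^x b(t)/a(t) dt)` of Feller's speed measure. -/
def fellerSpeed (a b : ℝ → ℝ) (c x : ℝ) : ℝ := 1 / a x * Real.exp (∫ t in c..x, b t / a t)

/-- The measure `ρ dx` on `(x₀, y₀)` (extended by zero to the real line). -/
def speedMeasure (x₀ y₀ : EReal) (a b : ℝ → ℝ) (c : ℝ) : Measure ℝ :=
  (volume.restrict (openInterval x₀ y₀ : Set ℝ)).withDensity
    (fun x => ENNReal.ofReal (fellerSpeed a b c x))

theorem speedMeasure_absolutelyContinuous (x₀ y₀ : EReal) (a b : ℝ → ℝ) (c : ℝ) :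
    speedMeasure x₀ y₀ a b c ≪ volume :=
  (withDensity_absolutelyContinuous _ _).trans Measure.absolutelyContinuous_restrict

theorem exists_Icc_of_compact {x₀ y₀ : EReal} {K : Set ℝ} (hK : IsCompact K)
    (hKI : K ⊆ (openInterval x₀ y₀ : Set ℝ)) :
    ∃ r s : ℝ, K ⊆ Icc r s ∧ Icc r s ⊆ (openInterval x₀ y₀ : Set ℝ) := by
  rcases K.eq_empty_or_nonempty with rfl | hne
  · exact ⟨1, 0, by simp, by simp⟩
  · refine ⟨sInf K, sSup K, fun x hx =>
      ⟨csInf_le hK.bddBelow hx, le_csSup hK.bddAbove hx⟩, fun x hx => ⟨?_, ?_⟩⟩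
    · exact (hKI (hK.sInf_mem hne)).1.trans_le (EReal.coe_le_coe_iff.2 hx.1)
    · exact (EReal.coe_le_coe_iff.2 hx.2).trans_lt (hKI (hK.sSup_mem hne)).2

theorem LocLp.memLp_mul {x₀ y₀ : EReal} {f g : ℝ → ℝ} (hf : LocLp ∞ x₀ y₀ f)
    (hg : Continuous g) (hc : HasCompactSupport g)
    (hs : tsupport g ⊆ (openInterval x₀ y₀ : Set ℝ)) {m : Measure ℝ} (hm : m ≪ volume) :
    MemLp (fun x => f x * g x) ∞ m := by
  obtain ⟨r, s, hK, hI⟩ := exists_Icc_of_compact hc hs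
  have h1 : MemLp ((Icc r s).indicator f) ∞ volume :=
    (memLp_indicator_iff_restrict measurableSet_Icc).2 (hf r s hI)
  have h2 : MemLp g ∞ volume := hg.memLp_top_of_hasCompactSupport hc volume
  have h3 : MemLp (fun x => (Icc r s).indicator f x * g x) ∞ volume := h2.mul' h1
  have h4 : (fun x => (Icc r s).indicator f x * g x) = fun x => f x * g x := by
    funext x
    by_cases hx : x ∈ Icc r s
    · simp [hx]
    · have : g x = 0 := by
        by_contra h
        exact hx (hK (subset_tsupport g h))
      simp [this]
  rw [h4] at h3
  refine ⟨h3.1.mono_ac hm, ?_⟩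
  rw [eLpNorm_exponent_top]
  have h5 := h3.2
  rw [eLpNorm_exponent_top] at h5
  exact (eLpNormEssSup_mono_measure _ hm).trans_lt h5

section Operator

variable {x₀ y₀ : EReal} {a b V : ℝ → ℝ}

theorem memLp_testFunction (φ : 𝓓(openInterval x₀ y₀, ℝ)) {m : Measure ℝ} :
    MemLp (φ : ℝ → ℝ) ∞ m :=
  φ.continuous.memLp_top_of_hasCompactSupport φ.hasCompactSupport m

theorem Admissible.memLp_operator (h : Admissible x₀ y₀ a b V) (φ : 𝓓(openInterval x₀ y₀, ℝ))
    {m : Measure ℝ} (hm : m ≪ volume) :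
    MemLp (fun x => a x * deriv (deriv φ) x + b x * deriv φ x - V x * φ x) ∞ m := by
  have c2 : ContDiff ℝ ∞ (φ : ℝ → ℝ) := φ.contDiff
  have c1 : ContDiff ℝ ∞ (deriv φ) := (contDiff_infty_iff_deriv.1 c2).2
  have c0 : ContDiff ℝ ∞ (deriv (deriv φ)) := (contDiff_infty_iff_deriv.1 c1).2
  have s1 : tsupport (deriv φ) ⊆ tsupport φ := closure_minimal support_deriv_subset isClosed_closure
  have s2 : tsupport (deriv (deriv φ)) ⊆ tsupport (deriv φ) :=
    closure_minimal support_deriv_subset isClosed_closure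
  have k1 : HasCompactSupport (deriv φ) := φ.hasCompactSupport.deriv
  have t := φ.tsupport_subset
  exact ((h.a_loc.memLp_mul c0.continuous k1.deriv ((s2.trans s1).trans t) hm).add
    (h.b_loc.memLp_mul c1.continuous k1 (s1.trans t) hm)).sub
    (h.V_loc.memLp_mul c2.continuous φ.hasCompactSupport t hm)

/-- The inclusion of `C₀^∞(x₀, y₀)` into `L^∞(m)`. -/
def testInclusion (x₀ y₀ : EReal) (m : Measure ℝ) : 𝓓(openInterval x₀ y₀, ℝ) →ₗ[ℝ] LInftyC m where
  toFun φ := (memLp_testFunction φ).toLp φ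
  map_add' _ _ := rfl
  map_smul' _ _ := rfl

/-- The operator `f ↦ a f'' + b f' - V f` from `C₀^∞(x₀, y₀)` to `L^∞(ρ dx)`. -/
def schrodingerOperator (h : Admissible x₀ y₀ a b V) (c : ℝ) :
    𝓓(openInterval x₀ y₀, ℝ) →ₗ[ℝ] LInftyC (speedMeasure x₀ y₀ a b c) where
  toFun φ := (h.memLp_operator φ (speedMeasure_absolutelyContinuous x₀ y₀ a b c)).toLp
    (fun x => a x * deriv (deriv φ) x + b x * deriv φ x - V x * φ x)
  map_add' φ ψ := by
    have hd : ∀ φ : 𝓓(openInterval x₀ y₀, ℝ), Differentiable ℝ φ := fun φ =>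
      φ.contDiff.differentiable (by simp)
    have hd' : ∀ φ : 𝓓(openInterval x₀ y₀, ℝ), Differentiable ℝ (deriv φ) := fun φ =>
      (contDiff_infty_iff_deriv.1 (φ.contDiff : ContDiff ℝ ∞ φ)).2.differentiable (by simp)
    have e1 : deriv (⇑(φ + ψ)) = deriv φ + deriv ψ := by
      funext x
      exact deriv_add (hd φ x) (hd ψ x)
    refine (MemLp.toLp_congr _ ((h.memLp_operator φ
      (speedMeasure_absolutelyContinuous x₀ y₀ a b c)).add (h.memLp_operator ψ
      (speedMeasure_absolutelyContinuous x₀ y₀ a b c))) (ae_of_all _ fun x => ?_)).trans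
      (MemLp.toLp_add _ _)
    have e2 : deriv (deriv φ + deriv ψ) x = deriv (deriv φ) x + deriv (deriv ψ) x :=
      deriv_add (hd' φ x) (hd' ψ x)
    have e3 : (φ + ψ) x = φ x + ψ x := rfl
    simp only [e1, e2, e3, Pi.add_apply]
    ring
  map_smul' r φ := by
    have e1 : deriv (⇑(r • φ)) = r • deriv φ := by
      funext x
      exact deriv_const_smul_field r φ
    refine (MemLp.toLp_congr _ ((h.memLp_operator φ
      (speedMeasure_absolutelyContinuous x₀ y₀ a b c)).const_smul r)
      (ae_of_all _ fun x => ?_)).trans (MemLp.toLp_const_smul _ _)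
    have e2 : deriv (r • deriv φ) x = r * deriv (deriv φ) x := deriv_const_smul_field r _
    have e3 : (r • φ) x = r * φ x := rfl
    simp only [e1, e2, e3, Pi.smul_apply, smul_eq_mul]
    ring

end Operator

/-! ### The iterated integrals -/

/-- `φ₀ = 1`, `φ_{n+1}(y) = ∫_c^y (1/α(r)) ∫_c^r ρ(t) (lam + V(t)) φ_n(t) dt dr`. -/
def phiIter (a b V : ℝ → ℝ) (lam c : ℝ) : ℕ → ℝ → ℝ≥0∞
  | 0, _ => 1
  | n + 1, y => ∫⁻ r in Ioc c y, ENNReal.ofReal (1 / fellerScale a b c r) *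
      ∫⁻ t in Ioc c r, ENNReal.ofReal (fellerSpeed a b c t * (lam + V t)) *
        phiIter a b V lam c n t

/-- `ψ₀ = 1`, `ψ_{n+1}(x) = ∫_x^c (1/α(r)) ∫_r^c ρ(t) (lam + V(t)) ψ_n(t) dt dr`. -/
def psiIter (a b V : ℝ → ℝ) (lam c : ℝ) : ℕ → ℝ → ℝ≥0∞
  | 0, _ => 1
  | n + 1, x => ∫⁻ r in Ioc x c, ENNReal.ofReal (1 / fellerScale a b c r) *
      ∫⁻ t in Ioc r c, ENNReal.ofReal (fellerSpeed a b c t * (lam + V t)) *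
        psiIter a b V lam c n t

end

/-! The continuous dual of `L^∞(ρ dx)` for the topology `𝒞(L^∞, L¹)` is `L¹(ρ dx)`, so the problem
is moved to `L¹`. With p = 1/α and q = ρ(λ + V) one has (αφ')' = ρ(aφ'' + bφ'), hence (λ - A)u = g
is the first-order system u' = p v, v' = q u - ρ g, which makes sense for locally absolutely
continuous u and v although the coefficients are only measurable.

Homogeneous equation. The sum u of the iterates φₙ, respectively ψₙ, is the Picard series of the
solution with u(c) = 1, v(c) = 0 (`IsSturmLiouville.exists_solution`); `sturmIter` treats both sides
of c together. Reduction of order with F = ∫ p/u², which is bounded, gives positive solutions h₁ =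
u(sup F - F), decreasing, and h₂ = u(F - inf F), increasing
(`IsSturmLiouville.exists_decayingPair`). Since λρh ≤ qh = v' for a positive solution h, h₁ is
always ρ-integrable at the right end and h₂ at the left end. On the other side each is comparable
with u. Hence a nonzero solution in `L¹` exists exactly when one of the two integrals of the
criterion is finite.

Generation. On `L¹`, take the solutions of the inhomogeneous system which are multiples of h₁ near
the right end and of h₂ near the left end. Testing against arctan(n u), a smooth substitute for the
sign of u, shows dissipativity; the Green function built from h₁ and h₂ solves the equation for
every test function on the right. The closure G is thus m-dissipative
(`IsWeightedSturmLiouville.isMDissipative`). By Hille–Yosida it yields a contraction semigroup on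
`L¹`. The transposed semigroup is C₀ for `𝒞(L^∞, L¹)`, because rescaled orbits of a compact set stay
in a compact set (`ExpBoundedSemigroup.exists_compact`), and Green's identity shows that its
generator extends A.

Uniqueness. If two C₀-semigroups extend A, the difference of their Laplace transforms, composed with
a functional, annihilates the range of μ - A for all large μ. If no nonzero element of `L¹` does so,
the Laplace transforms agree and so do the semigroups (`C0Semigroup.eq_of_generatorExtends`). An
annihilator is a weak solution of the homogeneous equation with μ in place of λ, hence a genuine one
(`exists_sturmSolution_of_weak`). The iterates increase with λ, so divergence of both integrals at λ
excludes annihilators for every μ ≥ λ.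

Non-uniqueness. If h ≠ 0 in `L¹` annihilates the range of λ - A, then f ↦ G*f + ⟨λf - G*f, h⟩u
agrees with A on test functions but differs from G* when u ≠ 0. For suitable u = R*w, with R the
resolvent of G at λ, it is similar to the bounded perturbation G* + ⟨·, h⟩w, so it also generates a
semigroup (`IsMDissipative.exists_two_c0Semigroups`).

For V = 0 the first iterate decides: when its integral is finite, the tail of the integral equation
for the sum can be absorbed (`IsSturmLiouville.lintegral_mul_sturmSum_ne_top`). -/

noncomputable section

/-! ### Dissipative operators on Banach spaces -/

section Dissipative

variable {X : Type*} [NormedAddCommGroup X] [NormedSpace ℝ X]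

/-- A densely defined `m`-dissipative operator on a Banach space, given by its graph. -/
structure IsMDissipative (G : Submodule ℝ (X × X)) : Prop where
  dissipative : ∀ x y, (x, y) ∈ G → ∀ μ : ℝ, 0 < μ → μ * ‖x‖ ≤ ‖μ • x - y‖
  range : ∃ μ : ℝ, 0 < μ ∧ ∀ z, ∃ x y, (x, y) ∈ G ∧ μ • x - y = z
  dense : Dense {x | ∃ y, (x, y) ∈ G}

/-- `R` is the resolvent at `μ` of the operator with graph `G`. -/
structure IsResolvent (G : Submodule ℝ (X × X)) (μ : ℝ) (R : X →L[ℝ] X) : Prop where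
  mem : ∀ z, (R z, μ • R z - z) ∈ G
  eq_of_mem : ∀ x y, (x, y) ∈ G → R (μ • x - y) = x
  norm_le : ‖R‖ ≤ 1 / μ

/-- Dissipativity makes the solution x of μx - y = z unique and bounded by ‖z‖/μ. Any choice of
solutions is therefore automatically linear and continuous. -/
theorem exists_isResolvent_of_range {G : Submodule ℝ (X × X)}
    (hG : ∀ x y, (x, y) ∈ G → ∀ μ : ℝ, 0 < μ → μ * ‖x‖ ≤ ‖μ • x - y‖)
    {μ : ℝ} (hμ : 0 < μ) (hr : ∀ z, ∃ x y, (x, y) ∈ G ∧ μ • x - y = z) :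
    ∃ R : X →L[ℝ] X, IsResolvent G μ R := by
  choose R y hR hz using hr
  have huniq : ∀ x y z, (x, y) ∈ G → μ • x - y = z → x = R z := by
    intro x y' z hx hxz
    have h1 : (x - R z, y' - y z) ∈ G := G.sub_mem hx (hR z)
    have h2 := hG _ _ h1 μ hμ
    have h3 : μ • (x - R z) - (y' - y z) = 0 := by
      rw [smul_sub]
      have := hz z
      rw [← hxz] at this ⊢
      rw [sub_sub_sub_comm, this, sub_self]
    rw [h3, norm_zero] at h2
    have h4 : ‖x - R z‖ ≤ 0 := by
      by_contra hcon
      push Not at hcon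
      nlinarith [mul_pos hμ hcon]
    exact sub_eq_zero.1 (norm_le_zero_iff.1 h4)
  have hadd : ∀ z w, R (z + w) = R z + R w := fun z w =>
    (huniq _ _ (z + w) (G.add_mem (hR z) (hR w)) (by
      change μ • (R z + R w) - (y z + y w) = z + w
      rw [smul_add, add_sub_add_comm, hz, hz])).symm
  have hsmul : ∀ (r : ℝ) z, R (r • z) = r • R z := fun r z =>
    (huniq _ _ (r • z) (G.smul_mem r (hR z)) (by
      change μ • (r • R z) - r • y z = r • z
      rw [smul_comm, ← smul_sub, hz])).symm
  let R' : X →L[ℝ] X := LinearMap.mkContinuous ⟨⟨R, hadd⟩, hsmul⟩ (1 / μ) (fun z => by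
    have := hG _ _ (hR z) μ hμ
    rw [hz] at this
    change ‖R z‖ ≤ _
    rw [div_mul_eq_mul_div, le_div_iff₀ hμ]
    linarith)
  refine ⟨R', ⟨fun z => ?_, fun x y h => (huniq x y _ h rfl).symm, ?_⟩⟩
  · have : μ • R z - z = y z := by
      nth_rw 2 [← hz z]; abel
    change (R z, μ • R z - z) ∈ G
    rw [this]; exact hR z
  · exact LinearMap.mkContinuous_norm_le _ (by positivity) _

/-- The equation amounts to x = R(z + Bx), and ‖RB‖ < 1, so 1 - RB is inverted by a Neumann series.
-/
theorem IsResolvent.exists_of_norm_lt [CompleteSpace X] {G : Submodule ℝ (X × X)} {μ : ℝ}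
    {R : X →L[ℝ] X} (hμ : 0 < μ) (hR : IsResolvent G μ R) (B : X →L[ℝ] X) (hB : ‖B‖ < μ) (z : X) :
    ∃ x y, (x, y) ∈ G ∧ μ • x - y = z + B x := by
  have h1 : ‖R * B‖ < 1 := by
    refine (norm_mul_le _ _).trans_lt ?_
    calc ‖R‖ * ‖B‖ ≤ 1 / μ * ‖B‖ := by gcongr; exact hR.norm_le
      _ < 1 := by rw [div_mul_eq_mul_div, div_lt_one hμ]; linarith
  obtain ⟨U, hU⟩ := isUnit_one_sub_of_norm_lt_one h1
  set x := (↑U⁻¹ : X →L[ℝ] X) (R z) with hx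
  have h2 : x - R (B x) = R z := by
    have : (U : X →L[ℝ] X) x = R z := by
      rw [hx, ← mul_apply_eq_comp, U.mul_inv]; rfl
    rw [hU] at this
    exact this
  have h3 : x = R (z + B x) := by
    rw [map_add, ← h2]; abel
  refine ⟨x, μ • x - (z + B x), ?_, by abel⟩
  nth_rw 1 [h3]
  nth_rw 2 [h3]
  exact hR.mem _

/-- Passing from ν to ν' is a perturbation by (ν - ν')·1, allowed when 0 < ν' < 2ν. Every smaller
parameter is thus reached in one step, and arbitrarily large ones by iterating a factor below 2,
here 3/2. -/
theorem IsMDissipative.exists_isResolvent [CompleteSpace X] {G : Submodule ℝ (X × X)}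
    (hG : IsMDissipative G) {μ : ℝ} (hμ : 0 < μ) : ∃ R : X →L[ℝ] X, IsResolvent G μ R := by
  obtain ⟨μ₀, hμ₀, hr⟩ := hG.range
  have step : ∀ ν : ℝ, 0 < ν → (∃ R : X →L[ℝ] X, IsResolvent G ν R) → ∀ ν', 0 < ν' → ν' < 2 * ν →
      ∃ R : X →L[ℝ] X, IsResolvent G ν' R := by
    rintro ν hν ⟨R, hR⟩ ν' hν' hlt
    refine exists_isResolvent_of_range hG.dissipative hν' fun z => ?_
    obtain ⟨x, y, hxy, h⟩ := hR.exists_of_norm_lt hν ((ν - ν') • (1 : X →L[ℝ] X)) (by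
      refine (norm_smul_le (ν - ν') (1 : X →L[ℝ] X)).trans_lt ?_
      have h1 : ‖(1 : X →L[ℝ] X)‖ ≤ 1 := ContinuousLinearMap.norm_id_le
      have h2 : ‖ν - ν'‖ < ν := by rw [Real.norm_eq_abs, abs_lt]; constructor <;> linarith
      nlinarith [norm_nonneg (ν - ν')]) z
    refine ⟨x, y, hxy, ?_⟩
    have h3 : ((ν - ν') • (1 : X →L[ℝ] X)) x = (ν - ν') • x := rfl
    rw [h3, sub_smul] at h
    have : ν' • x - y = (ν • x - y) - (ν • x - ν' • x) := by abel
    rw [this, h]; abel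
  have pow : ∀ n : ℕ, ∃ R : X →L[ℝ] X, IsResolvent G (μ₀ * (3 / 2) ^ n) R := by
    intro n
    induction n with
    | zero => simpa using exists_isResolvent_of_range hG.dissipative hμ₀ hr
    | succ n ih =>
      have : 0 < μ₀ * (3 / 2) ^ n := by positivity
      exact step _ this ih _ (by positivity) (by rw [pow_succ]; linarith)
  obtain ⟨n, hn⟩ := pow_unbounded_of_one_lt (μ / μ₀) (by norm_num : (1 : ℝ) < 3 / 2)
  rw [div_lt_iff₀ hμ₀] at hn
  exact step _ (by positivity) (pow n) μ hμ (by linarith)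

/-- The graph of `G + B - ‖B‖`. -/
def perturbedGraph (G : Submodule ℝ (X × X)) (B : X →L[ℝ] X) : Submodule ℝ (X × X) :=
  G.comap ((LinearMap.fst ℝ X X).prod
    (LinearMap.snd ℝ X X - (B : X →ₗ[ℝ] X) ∘ₗ LinearMap.fst ℝ X X +
      ‖B‖ • LinearMap.fst ℝ X X))

theorem mem_perturbedGraph {G : Submodule ℝ (X × X)} {B : X →L[ℝ] X} {x y : X} :
    (x, y) ∈ perturbedGraph G B ↔ (x, y - B x + ‖B‖ • x) ∈ G := Iff.rfl

/-- The shift by -‖B‖ pays for the perturbation: the dissipativity inequality of G at μ + ‖B‖ loses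
at most ‖B‖‖x‖. Solvability at 1 is solvability for G + B at 1 + ‖B‖ > ‖B‖. -/
theorem IsMDissipative.perturbedGraph [CompleteSpace X] {G : Submodule ℝ (X × X)}
    (hG : IsMDissipative G) (B : X →L[ℝ] X) : IsMDissipative (perturbedGraph G B) where
  dissipative x y h μ hμ := by
    have h1 := hG.dissipative _ _ (mem_perturbedGraph.1 h) (μ + ‖B‖) (by positivity)
    have h2 : (μ + ‖B‖) • x - (y - B x + ‖B‖ • x) = (μ • x - y) + B x := by
      rw [add_smul]; abel
    rw [h2] at h1
    have h3 := norm_add_le (μ • x - y) (B x)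
    have h4 := B.le_opNorm x
    linarith
  range := by
    obtain ⟨R, hR⟩ := hG.exists_isResolvent (μ := 1 + ‖B‖) (by positivity)
    refine ⟨1, one_pos, fun z => ?_⟩
    obtain ⟨x, y, hxy, h⟩ := hR.exists_of_norm_lt (by positivity) B (by linarith) z
    refine ⟨x, y + B x - ‖B‖ • x, mem_perturbedGraph.2 ?_, ?_⟩
    · convert hxy using 2; abel
    · rw [add_smul] at h
      have : (1 : ℝ) • x - (y + B x - ‖B‖ • x) = ((1 : ℝ) • x + ‖B‖ • x - y) - B x := by abel
      rw [this, h]; abel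
  dense := by
    convert hG.dense using 1
    ext x
    constructor
    · rintro ⟨y, hy⟩; exact ⟨_, mem_perturbedGraph.1 hy⟩
    · rintro ⟨y, hy⟩
      refine ⟨y + B x - ‖B‖ • x, mem_perturbedGraph.2 ?_⟩
      convert hy using 2; abel

/-! ### The Hille–Yosida theorem -/

namespace IsResolvent

variable {G : Submodule ℝ (X × X)} {μ ν : ℝ} {R S : X →L[ℝ] X}

theorem apply_mem (hR : IsResolvent G μ R) {x y : X} (h : (x, y) ∈ G) :
    R (μ • x - y) = x := hR.eq_of_mem x y h

/-- The resolvent identity R - S = (ν - μ)SR and its mirror image give (ν - μ)(RS - SR) = 0. Equal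
parameters are treated apart, since then the two resolvents coincide. -/
theorem commute (hR : IsResolvent G μ R) (hS : IsResolvent G ν S) :
    Commute R S := by
  by_cases hμν : μ = ν
  · have : R = S := by
      ext z
      have := hS.eq_of_mem _ _ (hR.mem z)
      rw [hμν] at this
      rw [← this]; congr 1; abel
    rw [this]
  have key : ∀ (μ ν : ℝ) (R S : X →L[ℝ] X), IsResolvent G μ R → IsResolvent G ν S → ∀ z,
      R z - S z = (ν - μ) • S (R z) := by
    intro μ ν R S hR hS z
    have := hS.eq_of_mem _ _ (hR.mem z)
    have h2 : ν • R z - (μ • R z - z) = (ν - μ) • R z + z := by rw [sub_smul]; abel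
    rw [h2, map_add, map_smul] at this
    nth_rw 1 [← this]; abel
  ext z
  have h1 := key μ ν R S hR hS z
  have h2 := key ν μ S R hS hR z
  have h3 : (ν - μ) • (R (S z) - S (R z)) = 0 := by
    rw [smul_sub, ← h1, ← neg_sub μ ν, neg_smul, ← h2]; abel
  have := (smul_eq_zero.1 h3).resolve_left (sub_ne_zero.2 (Ne.symm hμν))
  exact sub_eq_zero.1 this

end IsResolvent

end Dissipative

section HilleYosida

variable {X : Type*} [NormedAddCommGroup X] [NormedSpace ℝ X]

theorem tendsto_zero_of_dense {ι : Type*} {l : Filter ι} {U : ι → X →L[ℝ] X} {C : ℝ}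
    (hU : ∀ᶠ i in l, ‖U i‖ ≤ C) {D : Set X} (hD : Dense D)
    (h : ∀ x ∈ D, Tendsto (fun i => U i x) l (𝓝 0)) (x : X) :
    Tendsto (fun i => U i x) l (𝓝 0) := by
  rw [Metric.tendsto_nhds]
  intro ε hε
  obtain ⟨y, hy, hxy⟩ := Metric.dense_iff.1 hD x (ε / 2 / (|C| + 1)) (by positivity)
  filter_upwards [hU, Metric.tendsto_nhds.1 (h y hxy) (ε / 2) (by positivity)] with i h1 h2
  rw [dist_zero_right] at h2 ⊢
  rw [Metric.mem_ball, dist_eq_norm, lt_div_iff₀ (by positivity)] at hy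
  have h3 : U i x = U i y - U i (y - x) := by rw [map_sub]; abel
  have h4 := (U i).le_opNorm (y - x)
  have h5 : ‖U i‖ * ‖y - x‖ ≤ (|C| + 1) * ‖y - x‖ := by
    gcongr; linarith [le_abs_self C]
  rw [h3]
  have := norm_sub_le (U i y) (U i (y - x))
  linarith

theorem tendsto_apply_of_tendsto {ι : Type*} {l : Filter ι} {T : ι → X →L[ℝ] X} {S : X → X}
    {C : ℝ} (hT : ∀ᶠ i in l, ‖T i‖ ≤ C) (h : ∀ x, Tendsto (fun i => T i x) l (𝓝 (S x)))
    {y : ι → X} {z : X} (hy : Tendsto y l (𝓝 z)) :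
    Tendsto (fun i => T i (y i)) l (𝓝 (S z)) := by
  have h1 : Tendsto (fun i => T i (y i - z)) l (𝓝 0) := by
    refine squeeze_zero_norm' (a := fun i => C * ‖y i - z‖) ?_ (by
      simpa using (tendsto_iff_norm_sub_tendsto_zero.1 hy).const_mul C)
    filter_upwards [hT] with i hi
    exact (T i).le_of_opNorm_le hi _
  have := h1.add (h z)
  simp only [map_sub, sub_add_cancel, zero_add] at this
  exact this

/-- A strongly continuous semigroup of contractions on a Banach space. -/
structure ContractionSemigroup (X : Type*) [NormedAddCommGroup X] [NormedSpace ℝ X] where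
  toFun : ℝ≥0 → X →L[ℝ] X
  map_zero : toFun 0 = 1
  map_add : ∀ s t, toFun (s + t) = toFun s * toFun t
  norm_le_one : ∀ t, ‖toFun t‖ ≤ 1
  continuous : ∀ x, Continuous fun t => toFun t x

theorem ContractionSemigroup.norm_apply_le (P : ContractionSemigroup X) (t : ℝ≥0) (x : X) :
    ‖P.toFun t x‖ ≤ ‖x‖ := by
  simpa using (P.toFun t).le_of_opNorm_le (P.norm_le_one t) x

theorem continuous_of_tendsto_zero {P : ℝ≥0 → X →L[ℝ] X}
    (hadd : ∀ s t, P (s + t) = P s * P t) (hle : ∀ t, ‖P t‖ ≤ 1)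
    (h : ∀ x, Tendsto (fun t => P t x) (𝓝 0) (𝓝 x)) (x : X) : Continuous fun t => P t x := by
  have key : ∀ s t, s ≤ t → ‖P t x - P s x‖ ≤ ‖P (t - s) x - x‖ := by
    intro s t hst
    have h1 : P t x - P s x = P s (P (t - s) x - x) := by
      rw [map_sub]
      congr 1
      rw [← mul_apply_eq_comp, ← hadd, add_tsub_cancel_of_le hst]
    rw [h1]
    simpa using (P s).le_of_opNorm_le (hle s) (P (t - s) x - x)
  -- Subtraction in `ℝ≥0` is truncated, so (t - s) + (s - t) is |t - s|.
  have key2 : ∀ s t, ‖P t x - P s x‖ ≤ ‖P ((t - s) + (s - t)) x - x‖ := by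
    intro s t
    rcases le_total s t with hst | hst
    · rw [tsub_eq_zero_of_le hst, add_zero]; exact key s t hst
    · rw [tsub_eq_zero_of_le hst, zero_add, norm_sub_rev]; exact key t s hst
  rw [continuous_iff_continuousAt]
  intro s
  rw [ContinuousAt, tendsto_iff_norm_sub_tendsto_zero]
  refine squeeze_zero (fun t => norm_nonneg _) (fun t => key2 s t) ?_
  have h1 : Tendsto (fun t : ℝ≥0 => (t - s) + (s - t)) (𝓝 s) (𝓝 0) := by
    have : Continuous fun t : ℝ≥0 => (t - s) + (s - t) := by fun_prop
    simpa using this.tendsto s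
  exact tendsto_iff_norm_sub_tendsto_zero.1 ((h x).comp h1)

theorem norm_one_clm_le : ‖(1 : X →L[ℝ] X)‖ ≤ 1 := ContinuousLinearMap.norm_id_le

variable [CompleteSpace X]

theorem exp_add_of_commute_clm {A B : X →L[ℝ] X} (h : Commute A B) :
    NormedSpace.exp (A + B) = NormedSpace.exp A * NormedSpace.exp B := by
  let : NormedAlgebra ℚ (X →L[ℝ] X) := NormedAlgebra.restrictScalars ℚ ℝ _
  exact NormedSpace.exp_add_of_commute h

theorem norm_exp_le_exp_norm (A : X →L[ℝ] X) : ‖NormedSpace.exp A‖ ≤ Real.exp ‖A‖ := by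
  rw [← (NormedSpace.exp_series_hasSum_exp' (𝕂 := ℝ) A).tsum_eq, Real.exp_eq_exp_ℝ,
    ← (NormedSpace.exp_series_hasSum_exp' (𝕂 := ℝ) ‖A‖).tsum_eq]
  have hs : Summable fun n : ℕ => ((n.factorial : ℝ)⁻¹) • ‖A‖ ^ n :=
    (NormedSpace.exp_series_hasSum_exp' (𝕂 := ℝ) ‖A‖).summable
  refine tsum_of_norm_bounded hs.hasSum fun n => ?_
  rw [norm_smul, Real.norm_of_nonneg (by positivity), smul_eq_mul]
  gcongr
  rcases n with _ | n
  · simpa using norm_one_clm_le (X := X)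
  · exact norm_pow_le' A n.succ_pos

/-- The Yosida approximation `μ² R - μ`. -/
def yosida (μ : ℝ) (R : X →L[ℝ] X) : X →L[ℝ] X := μ ^ 2 • R - μ • 1

/-- The scalar part splits off as the factor e^{-tμ}, while ‖tμ²R‖ ≤ tμ bounds the remaining
exponential by e^{tμ}. -/
theorem norm_exp_yosida_le {μ : ℝ} {R : X →L[ℝ] X} (hμ : 0 < μ) (hR : ‖R‖ ≤ 1 / μ) {t : ℝ}
    (ht : 0 ≤ t) : ‖NormedSpace.exp (t • yosida μ R)‖ ≤ 1 := by
  have h1 : t • yosida μ R = (t * μ ^ 2) • R + algebraMap ℝ (X →L[ℝ] X) (-(t * μ)) := by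
    rw [yosida, Algebra.algebraMap_eq_smul_one, smul_sub, smul_smul, smul_smul, neg_smul]
    abel
  rw [h1, exp_add_of_commute_clm (Algebra.commute_algebraMap_right _ _),
    ← NormedSpace.algebraMap_exp_comm, Algebra.algebraMap_eq_smul_one, mul_smul_comm, mul_one,
    norm_smul, ← Real.exp_eq_exp_ℝ, Real.norm_of_nonneg (Real.exp_nonneg _)]
  have h2 : ‖(t * μ ^ 2) • R‖ ≤ t * μ := by
    rw [norm_smul, Real.norm_of_nonneg (by positivity)]
    calc t * μ ^ 2 * ‖R‖ ≤ t * μ ^ 2 * (1 / μ) := by gcongr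
      _ = t * μ := by field_simp
  calc Real.exp (-(t * μ)) * ‖NormedSpace.exp ((t * μ ^ 2) • R)‖
      ≤ Real.exp (-(t * μ)) * Real.exp (t * μ) := by
        gcongr
        exact (norm_exp_le_exp_norm _).trans (Real.exp_le_exp.2 h2)
    _ = 1 := by rw [← Real.exp_add]; simp

/-- The path s ↦ e^{sA}e^{(t-s)B}x joins the two vectors, and by commutativity its derivative is
e^{sA}e^{(t-s)B}(A - B)x. This bounds the difference of the semigroups by that of the generators,
whatever the norms of A and B. -/
theorem norm_exp_sub_exp_apply_le {A B : X →L[ℝ] X} (hAB : Commute A B)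
    (hA : ∀ s : ℝ, 0 ≤ s → ‖NormedSpace.exp (s • A)‖ ≤ 1)
    (hB : ∀ s : ℝ, 0 ≤ s → ‖NormedSpace.exp (s • B)‖ ≤ 1) {t : ℝ} (ht : 0 ≤ t) (x : X) :
    ‖NormedSpace.exp (t • A) x - NormedSpace.exp (t • B) x‖ ≤ t * ‖A x - B x‖ := by
  let F : ℝ → X := fun s => NormedSpace.exp (s • A) (NormedSpace.exp ((t - s) • B) x)
  have hF : ∀ s, HasDerivAt F
      (NormedSpace.exp (s • A) (NormedSpace.exp ((t - s) • B) (A x - B x))) s := by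
    intro s
    have h1 := hasDerivAt_exp_smul_const (𝕂 := ℝ) A s
    have h2 : HasDerivAt (fun u : ℝ => NormedSpace.exp ((t - u) • B))
        (-(NormedSpace.exp ((t - s) • B) * B)) s := by
      have := (hasDerivAt_exp_smul_const (𝕂 := ℝ) B (t - s)).scomp s
        ((hasDerivAt_id s).const_sub t)
      convert! this using 1
      simp
    have h3 := h1.clm_apply (h2.clm_apply (hasDerivAt_const s x))
    convert! h3 using 1
    have hc : Commute A (NormedSpace.exp ((t - s) • B)) := (hAB.smul_right _).exp_right
    have hc' : A (NormedSpace.exp ((t - s) • B) x) = NormedSpace.exp ((t - s) • B) (A x) :=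
      congrArg (fun T : X →L[ℝ] X => T x) hc.eq
    simp [hc']
    abel
  have hbound : ∀ s ∈ Ico (0 : ℝ) t, ‖NormedSpace.exp (s • A)
      (NormedSpace.exp ((t - s) • B) (A x - B x))‖ ≤ ‖A x - B x‖ := by
    intro s hs
    have h1 := (NormedSpace.exp (s • A)).le_of_opNorm_le (hA s hs.1)
      (NormedSpace.exp ((t - s) • B) (A x - B x))
    have h2 := (NormedSpace.exp ((t - s) • B)).le_of_opNorm_le (hB (t - s) (by linarith [hs.2]))
      (A x - B x)
    rw [one_mul] at h1 h2
    exact h1.trans h2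
  have := norm_image_sub_le_of_norm_deriv_right_le_segment (f := F)
    (fun s _ => (hF s).continuousAt.continuousWithinAt) (fun s _ => (hF s).hasDerivWithinAt)
    hbound t (right_mem_Icc.2 ht)
  simpa [F, mul_comm] using this

/-- The **Hille–Yosida theorem**; the generator of the semigroup is described weakly. -/
theorem IsMDissipative.exists_contractionSemigroup {G : Submodule ℝ (X × X)}
    (hG : IsMDissipative G) : ∃ P : ContractionSemigroup X,
      ∀ f k : X →L[ℝ] ℝ, (∀ x y, (x, y) ∈ G → f y = k x) → ∀ (t : ℝ≥0) (x : X),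
        f (P.toFun t x - x) = ∫ s in (0 : ℝ)..t, k (P.toFun s.toNNReal x) := by
  have hpos : ∀ n : ℕ, (0 : ℝ) < (n : ℝ) + 1 := fun n => by positivity
  choose R hR using fun n : ℕ => hG.exists_isResolvent (hpos n)
  let A : ℕ → X →L[ℝ] X := fun n => yosida ((n : ℝ) + 1) (R n)
  let T : ℕ → ℝ → X →L[ℝ] X := fun n t => NormedSpace.exp (t • A n)
  have hT1 : ∀ n t, 0 ≤ t → ‖T n t‖ ≤ 1 := fun n t ht =>
    norm_exp_yosida_le (hpos n) (hR n).norm_le ht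
  have hμR : ∀ n : ℕ, ‖((n : ℝ) + 1) • R n‖ ≤ 1 := by
    intro n
    rw [norm_smul, Real.norm_of_nonneg (hpos n).le]
    calc ((n : ℝ) + 1) * ‖R n‖ ≤ ((n : ℝ) + 1) * (1 / ((n : ℝ) + 1)) := by
          gcongr; exact (hR n).norm_le
      _ = 1 := by field_simp
  have hRone : ∀ x, Tendsto (fun n : ℕ => (((n : ℝ) + 1) • R n) x) atTop (𝓝 x) := by
    have : ∀ x, Tendsto (fun n : ℕ => (((n : ℝ) + 1) • R n - 1) x) atTop (𝓝 0) := by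
      refine tendsto_zero_of_dense (C := 2) (Eventually.of_forall fun n => ?_) hG.dense ?_
      · refine (norm_sub_le _ _).trans ?_
        have h1 : ‖(1 : X →L[ℝ] X)‖ ≤ 1 := ContinuousLinearMap.norm_id_le
        linarith [hμR n]
      · rintro x ⟨y, hxy⟩
        have h1 : ∀ n : ℕ, (((n : ℝ) + 1) • R n - 1) x = R n y := by
          intro n
          have h2 := (hR n).apply_mem hxy
          rw [map_sub, map_smul] at h2
          change ((n : ℝ) + 1) • R n x - x = R n y
          nth_rw 2 [← h2]; abel
        simp only [h1]
        refine squeeze_zero_norm (a := fun n : ℕ => 1 / ((n : ℝ) + 1) * ‖y‖) (fun n => ?_) ?_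
        · exact (R n).le_of_opNorm_le (hR n).norm_le y
        · simpa using tendsto_one_div_add_atTop_nhds_zero_nat.mul_const ‖y‖
    intro x
    have := (this x).add_const x
    simpa using this
  -- On the domain the Yosida approximations converge to the operator, because μR tends strongly to
  -- the identity.
  have hA : ∀ x y, (x, y) ∈ G → ∀ n, A n x = (((n : ℝ) + 1) • R n) y := by
    intro x y hxy n
    have h2 := (hR n).apply_mem hxy
    change ((n : ℝ) + 1) ^ 2 • R n x - ((n : ℝ) + 1) • x = ((n : ℝ) + 1) • R n y
    nth_rw 2 [← h2]
    rw [map_sub, map_smul, smul_sub, smul_smul, ← pow_two]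
    abel
  have hcomm : ∀ n m, Commute (A n) (A m) := by
    intro n m
    have h := (hR n).commute (hR m)
    exact Commute.sub_left (Commute.sub_right ((h.smul_left _).smul_right _)
      ((Commute.one_right _).smul_right _)) ((Commute.one_left _).smul_left _)
  have hcauchy : ∀ t, 0 ≤ t → ∀ x, CauchySeq fun n => T n t x := by
    intro t ht x
    rw [cauchySeq_iff_tendsto_dist_atTop_0]
    have h1 := tendsto_zero_of_dense (l := (atTop : Filter (ℕ × ℕ))) (C := 2)
      (U := fun p => T p.1 t - T p.2 t)
      (Eventually.of_forall fun p => (norm_sub_le _ _).trans (by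
        linarith [hT1 p.1 t ht, hT1 p.2 t ht])) hG.dense (by
      rintro x ⟨y, hxy⟩
      have h2 : CauchySeq fun n => A n x := by
        simp only [hA x y hxy]
        exact (hRone y).cauchySeq
      rw [cauchySeq_iff_tendsto_dist_atTop_0] at h2
      refine squeeze_zero_norm (fun p => ?_) (by simpa using h2.const_mul t)
      rw [dist_eq_norm]
      exact norm_exp_sub_exp_apply_le (hcomm _ _) (fun s hs => hT1 _ s hs)
        (fun s hs => hT1 _ s hs) ht x) x
    simpa [dist_eq_norm] using h1.norm
  have hlim : ∀ t : ℝ≥0, ∀ x, ∃ y, Tendsto (fun n => T n t x) atTop (𝓝 y) := fun t x =>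
    cauchySeq_tendsto_of_complete (hcauchy t t.2 x)
  choose S hS using hlim
  let P : ℝ≥0 → X →L[ℝ] X := fun t => LinearMap.mkContinuous
    ⟨⟨S t, fun x y => tendsto_nhds_unique (hS t (x + y)) (by
      simpa using (hS t x).add (hS t y))⟩, fun r x => tendsto_nhds_unique (hS t (r • x)) (by
      simpa using (hS t x).const_smul r)⟩ 1 (fun x => by
      rw [one_mul]
      refine le_of_tendsto (hS t x).norm (Eventually.of_forall fun n => ?_)
      simpa using (T n t).le_of_opNorm_le (hT1 n t t.2) x)
  have hP : ∀ (t : ℝ≥0) x, Tendsto (fun n => T n (t : ℝ) x) atTop (𝓝 (P t x)) := hS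
  have hP1 : ∀ t, ‖P t‖ ≤ 1 := fun t => LinearMap.mkContinuous_norm_le _ zero_le_one _
  have hP0 : P 0 = 1 := by
    ext x
    refine tendsto_nhds_unique (hP 0 x) ?_
    simp [T]
  have hPadd : ∀ s t, P (s + t) = P s * P t := by
    intro s t
    ext x
    refine tendsto_nhds_unique (hP (s + t) x) ?_
    have h1 := tendsto_apply_of_tendsto (Eventually.of_forall fun n => hT1 n s s.2) (hP s) (hP t x)
    refine h1.congr fun n => ?_
    rw [← mul_apply_eq_comp]
    change (NormedSpace.exp ((s : ℝ) • A n) * NormedSpace.exp ((t : ℝ) • A n)) x =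
      NormedSpace.exp (((s + t : ℝ≥0) : ℝ) • A n) x
    rw [NNReal.coe_add, add_smul, exp_add_of_commute_clm]
    exact ((Commute.refl (A n)).smul_left _).smul_right _
  have hcont : ∀ x, Continuous fun t => P t x := by
    refine continuous_of_tendsto_zero hPadd hP1 fun x => ?_
    have h0 : ∀ x, Tendsto (fun t => (P t - 1) x) (𝓝 0) (𝓝 0) := by
      refine tendsto_zero_of_dense (C := 2) (Eventually.of_forall fun t => ?_) hG.dense ?_
      · refine (norm_sub_le _ _).trans ?_
        have h1 : ‖(1 : X →L[ℝ] X)‖ ≤ 1 := ContinuousLinearMap.norm_id_le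
        linarith [hP1 t]
      · rintro x ⟨y, hxy⟩
        have h1 : ∀ t : ℝ≥0, ‖(P t - 1) x‖ ≤ t * ‖y‖ := by
          intro t
          refine le_of_tendsto ((hP t x).sub_const x).norm (Eventually.of_forall fun n => ?_)
          have h2 := norm_exp_sub_exp_apply_le (A := A n) (B := 0) (Commute.zero_right _)
            (fun s hs => hT1 n s hs) (fun s _ => by
              simpa using norm_one_clm_le (X := X)) t.2 x
          simp only [smul_zero, NormedSpace.exp_zero] at h2
          refine h2.trans ?_
          have h3 : (0 : X →L[ℝ] X) x = 0 := rfl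
          rw [h3, sub_zero, hA x y hxy]
          refine mul_le_mul_of_nonneg_left ?_ t.2
          simpa using (((n : ℝ) + 1) • R n).le_of_opNorm_le (hμR n) y
        refine squeeze_zero_norm h1 ?_
        have : Continuous fun t : ℝ≥0 => (t : ℝ) * ‖y‖ := by fun_prop
        simpa using this.tendsto 0
    simpa using (h0 x).add_const x
  refine ⟨⟨P, hP0, hPadd, hP1, hcont⟩, fun f k hfk t x => ?_⟩
  have hTc : ∀ n, Continuous fun s : ℝ => T n s x := fun n => by
    refine continuous_iff_continuousAt.2 fun s => ?_
    exact ((hasDerivAt_exp_smul_const (𝕂 := ℝ) (A n) s).clm_apply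
      (hasDerivAt_const s x)).continuousAt
  -- The relation between f and k applies to the graph point (R z, μR z - z), so f ∘ Aₙ = k ∘ μRₙ on
  -- the whole space. The limit is then taken by dominated convergence.
  have hn : ∀ n : ℕ, f (T n t x - x) = ∫ s in (0 : ℝ)..t, k ((((n : ℝ) + 1) • R n) (T n s x)) := by
    intro n
    have hd : ∀ s, HasDerivAt (fun s : ℝ => f (T n s x)) (f (A n (T n s x))) s := by
      intro s
      have h1 := ((hasDerivAt_exp_smul_const' (𝕂 := ℝ) (A n) s).clm_apply (hasDerivAt_const s x))
      have h2 := f.hasFDerivAt.comp_hasDerivAt s h1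
      convert! h2 using 1
      simp [T]
    have hfA : ∀ z, f (A n z) = k ((((n : ℝ) + 1) • R n) z) := by
      intro z
      have h1 := hfk _ _ ((hR n).mem z)
      have h2 : A n z = ((n : ℝ) + 1) • (((n : ℝ) + 1) • R n z - z) := by
        change ((n : ℝ) + 1) ^ 2 • R n z - ((n : ℝ) + 1) • z = _
        rw [smul_sub, smul_smul, ← pow_two]
      rw [h2, map_smul, h1, ← map_smul]; rfl
    simp only [hfA] at hd
    rw [intervalIntegral.integral_eq_sub_of_hasDerivAt (fun s _ => hd s)
      (Continuous.intervalIntegrable (by have := hTc n; fun_prop) _ _)]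
    simp [T]
  have hl : Tendsto (fun n => f (T n t x - x)) atTop (𝓝 (f (P t x - x))) :=
    (f.continuous.tendsto _).comp ((hP t x).sub_const x)
  refine tendsto_nhds_unique hl ?_
  simp only [hn]
  refine intervalIntegral.tendsto_integral_filter_of_dominated_convergence (fun _ => ‖k‖ * ‖x‖)
    (Eventually.of_forall fun n => (Continuous.aestronglyMeasurable (by
      have := hTc n; fun_prop))) (Eventually.of_forall fun n => ae_of_all _ fun s hs => ?_)
    (by simp) (ae_of_all _ fun s hs => ?_)
  · rw [uIoc_of_le t.coe_nonneg] at hs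
    refine k.le_of_opNorm_le_of_le le_rfl ?_
    have h1 := (((n : ℝ) + 1) • R n).le_of_opNorm_le (hμR n) (T n s x)
    have h2 := (T n s).le_of_opNorm_le (hT1 n s hs.1.le) x
    rw [one_mul] at h1 h2
    exact h1.trans h2
  · rw [uIoc_of_le t.coe_nonneg] at hs
    refine (k.continuous.tendsto _).comp ?_
    have h1 := hP s.toNNReal x
    rw [Real.coe_toNNReal s hs.1.le] at h1
    exact tendsto_apply_of_tendsto (S := id) (Eventually.of_forall hμR) hRone h1

end HilleYosida

/-! ### Dual semigroups for the topology of compact convergence -/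

section Dual

variable {X : Type*} [NormedAddCommGroup X] [NormedSpace ℝ X]

/-- A uniform Lipschitz bound spreads pointwise convergence from a point to a small ball, and
finitely many balls cover a compact set. All limits in `𝒞(L^∞, L¹)` are reduced to weak-star limits
of bounded families in this way. -/
theorem tendsto_compactConvergence {ι : Type*} {l : Filter ι} {F : ι → X →L_c[ℝ] ℝ}
    {F₀ : X →L_c[ℝ] ℝ} {C : ℝ} (hF : ∀ᶠ i in l, ∀ x, |F i x| ≤ C * ‖x‖)
    (h : ∀ x, Tendsto (fun i => F i x) l (𝓝 (F₀ x))) : Tendsto F l (𝓝 F₀) := by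
  rw [UniformConvergenceCLM.tendsto_iff_tendstoUniformlyOn]
  intro K hK
  rw [Metric.tendstoUniformlyOn_iff]
  intro ε hε
  refine hK.induction_on (p := fun s => ∀ᶠ i in l, ∀ x ∈ s, dist (F₀ x) (F i x) < ε) (by simp)
    (fun s t hst ht => ?_) (fun s t hs ht => ?_) fun x _ => ?_
  · filter_upwards [ht] with i hi x hx using hi x (hst hx)
  · filter_upwards [hs, ht] with i h1 h2 x hx
    exact hx.elim (h1 x) (h2 x)
  · obtain ⟨δ, hδ, hball⟩ := Metric.continuousAt_iff.1
      ((F₀ : X →L[ℝ] ℝ).continuous.continuousAt (x := x)) (ε / 3) (by positivity)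
    refine ⟨Metric.ball x (min δ (ε / 3 / (|C| + 1))),
      mem_nhdsWithin_of_mem_nhds (Metric.ball_mem_nhds _ (by positivity)), ?_⟩
    filter_upwards [hF, Metric.tendsto_nhds.1 (h x) (ε / 3) (by positivity)] with i h1 h2 y hy
    rw [Metric.mem_ball, lt_min_iff] at hy
    have h3 : dist (F₀ y) (F₀ x) < ε / 3 := hball hy.1
    have h4 := h1 (y - x)
    have h5 : F i (y - x) = F i y - F i x := map_sub (F i) y x
    have hy2 := hy.2
    rw [dist_eq_norm, lt_div_iff₀ (by positivity)] at hy2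
    have h6 : C * ‖y - x‖ ≤ (|C| + 1) * ‖y - x‖ := by
      gcongr; linarith [le_abs_self C]
    rw [h5] at h4
    rw [Real.dist_eq] at *
    have h7 : F₀ y - F i y = (F₀ y - F₀ x) - (F i x - F₀ x) - (F i y - F i x) := by ring
    rw [h7]
    have h8 := abs_sub ((F₀ y - F₀ x) - (F i x - F₀ x)) (F i y - F i x)
    have h9 := abs_sub (F₀ y - F₀ x) (F i x - F₀ x)
    linarith

variable {E : Type*} [AddCommGroup E] [Module ℝ E] {J : E ≃ₗ[ℝ] (X →L_c[ℝ] ℝ)}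

theorem eq_of_forall_pairing {f g : E} (h : ∀ x, J f x = J g x) : f = g :=
  J.injective (DFunLike.ext _ _ h)

theorem exists_pairing_bound (f : E) : ∃ C, 0 ≤ C ∧ ∀ x, |J f x| ≤ C * ‖x‖ :=
  (fun g : X →L[ℝ] ℝ => ⟨‖g‖, norm_nonneg _, g.le_opNorm⟩ :
    ∀ g : X →L[ℝ] ℝ, ∃ C, 0 ≤ C ∧ ∀ x, |g x| ≤ C * ‖x‖) (J f)

variable [UniformSpace E] (J)

/-- The transpose of `T` on a space identified with the dual of `X`. -/
def dualMap (hJ : IsUniformInducing J) (T : X →L[ℝ] X) : E →L[ℝ] E where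
  toLinearMap := J.symm.toLinearMap ∘ₗ
    (T.precompCompactConvergenceCLM ℝ : (X →L_c[ℝ] ℝ) →L[ℝ] (X →L_c[ℝ] ℝ)).toLinearMap ∘ₗ
    J.toLinearMap
  cont := by
    rw [hJ.isInducing.continuous_iff]
    have : J ∘ (J.symm.toLinearMap ∘ₗ
      (T.precompCompactConvergenceCLM ℝ : (X →L_c[ℝ] ℝ) →L[ℝ] (X →L_c[ℝ] ℝ)).toLinearMap ∘ₗ
      J.toLinearMap) = (T.precompCompactConvergenceCLM ℝ :
        (X →L_c[ℝ] ℝ) →L[ℝ] (X →L_c[ℝ] ℝ)) ∘ J := by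
      ext f : 1
      exact J.apply_symm_apply _
    exact this ▸ (ContinuousLinearMap.continuous _).comp hJ.isInducing.continuous

variable {J}

theorem dualMap_apply (hJ : IsUniformInducing J) (T : X →L[ℝ] X) (f : E) (x : X) :
    J (dualMap J hJ T f) x = J f (T x) := by
  exact DFunLike.congr_fun (J.apply_symm_apply
    ((T.precompCompactConvergenceCLM ℝ : (X →L_c[ℝ] ℝ) →L[ℝ] (X →L_c[ℝ] ℝ)) (J f))) x

theorem t2Space_of_isUniformInducing (hJ : IsUniformInducing J) : T2Space E :=
  T2Space.of_injective_continuous J.injective hJ.isInducing.continuous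

theorem tendsto_of_pairing (hJ : IsUniformInducing J) {ι : Type*} {l : Filter ι} {F : ι → E}
    {F₀ : E} {C : ℝ} (hF : ∀ᶠ i in l, ∀ x, |J (F i) x| ≤ C * ‖x‖)
    (h : ∀ x, Tendsto (fun i => J (F i) x) l (𝓝 (J F₀ x))) : Tendsto F l (𝓝 F₀) :=
  hJ.isInducing.tendsto_nhds_iff.2 (tendsto_compactConvergence hF h)

theorem equicontinuous_of_nhds_zero [IsUniformAddGroup E] {ι : Type*} (F : ι → E →ₗ[ℝ] E)
    (h : ∀ N ∈ 𝓝 (0 : E), ∃ N' ∈ 𝓝 (0 : E), ∀ f ∈ N', ∀ i, F i f ∈ N) :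
    Equicontinuous fun i f => F i f := by
  refine equicontinuous_of_equicontinuousAt_zero F ?_
  intro U hU
  rw [uniformity_eq_comap_nhds_zero] at hU
  obtain ⟨N, hN, hNU⟩ := hU
  obtain ⟨N', hN', h'⟩ := h N hN
  filter_upwards [hN'] with f hf i
  refine hNU ?_
  simpa using h' f hf i

/-- A family of operators `W t` on a Banach space `X` that is a semigroup, strongly continuous
and exponentially bounded. -/
structure ExpBoundedSemigroup (X : Type*) [NormedAddCommGroup X] [NormedSpace ℝ X] where
  toFun : ℝ≥0 → X →L[ℝ] X
  map_zero : toFun 0 = 1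
  map_add : ∀ s t, toFun (s + t) = toFun s * toFun t
  continuous : ∀ x, Continuous fun t => toFun t x
  bound : ℝ
  growth : ℝ
  norm_le : ∀ t : ℝ≥0, ‖toFun t‖ ≤ bound * Real.exp (growth * t)

namespace ExpBoundedSemigroup

variable (W : ExpBoundedSemigroup X)

theorem bound_nonneg : 0 ≤ W.bound := by
  simpa using (norm_nonneg _).trans (W.norm_le 0)

theorem norm_smul_le (t : ℝ≥0) : ‖Real.exp (-(W.growth + 1) * t) • W.toFun t‖ ≤
    W.bound * Real.exp (-t) := by
  rw [norm_smul, Real.norm_of_nonneg (Real.exp_nonneg _)]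
  calc _ ≤ Real.exp (-(W.growth + 1) * t) * (W.bound * Real.exp (W.growth * t)) := by
        gcongr; exact W.norm_le t
    _ = W.bound * (Real.exp (-(W.growth + 1) * t) * Real.exp (W.growth * t)) := by ring
    _ = _ := by rw [← Real.exp_add]; ring_nf

/-- Subtracting one more than the growth rate makes the rescaled semigroup decay uniformly on K. Up
to a time t₁ the orbits form a continuous image of a compact set, and afterwards they lie within ε
of 0, so their union is totally bounded. Equicontinuity of the transposed family rests on this. -/
theorem exists_compact [CompleteSpace X] {K : Set X} (hK : IsCompact K) :
    ∃ K', IsCompact K' ∧ ∀ t : ℝ≥0, ∀ x ∈ K,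
      Real.exp (-(W.growth + 1) * t) • W.toFun t x ∈ K' := by
  let V : ℝ≥0 × X → X := fun p => Real.exp (-(W.growth + 1) * p.1) • W.toFun p.1 p.2
  have hV : Continuous V := by
    rw [continuous_iff_continuousAt]
    rintro ⟨t₀, x₀⟩
    have h1 : ∀ x, Tendsto (fun p : ℝ≥0 × X => (Real.exp (-(W.growth + 1) * p.1) • W.toFun p.1) x)
        (𝓝 (t₀, x₀)) (𝓝 ((Real.exp (-(W.growth + 1) * t₀) • W.toFun t₀) x)) := by
      intro x
      have : Continuous fun p : ℝ≥0 × X => Real.exp (-(W.growth + 1) * p.1) • W.toFun p.1 x :=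
        (by fun_prop : Continuous fun p : ℝ≥0 × X => Real.exp (-(W.growth + 1) * p.1)).smul
          ((W.continuous x).comp continuous_fst)
      exact this.tendsto (t₀, x₀)
    refine tendsto_apply_of_tendsto
      (T := fun p : ℝ≥0 × X => Real.exp (-(W.growth + 1) * p.1) • W.toFun p.1)
      (S := fun x => (Real.exp (-(W.growth + 1) * t₀) • W.toFun t₀) x) (C := W.bound)
      (Eventually.of_forall fun p => (W.norm_smul_le p.1).trans ?_) h1 (y := fun p => p.2)
      (z := x₀) (continuous_snd.tendsto (t₀, x₀))
    refine mul_le_of_le_one_right W.bound_nonneg (Real.exp_le_one_iff.2 ?_)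
    simp
  obtain ⟨M, hM⟩ := hK.isBounded.exists_norm_le
  have htb : TotallyBounded (V '' (univ ×ˢ K)) := by
    rw [Metric.totallyBounded_iff]
    intro ε hε
    have hlim : Tendsto (fun t : ℝ≥0 => W.bound * Real.exp (-t) * M) atTop (𝓝 0) := by
      have h1 : Tendsto (fun t : ℝ≥0 => Real.exp (-(t : ℝ))) atTop (𝓝 0) :=
        Real.tendsto_exp_neg_atTop_nhds_zero.comp (NNReal.tendsto_coe_atTop.2 tendsto_id)
      simpa using (h1.const_mul W.bound).mul_const M
    obtain ⟨t₁, ht₁⟩ := (hlim.eventually_lt_const hε).exists_forall_of_atTop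
    have hc : IsCompact (V '' (Icc 0 t₁ ×ˢ K)) := (isCompact_Icc.prod hK).image hV
    obtain ⟨t, ht, htc⟩ := Metric.totallyBounded_iff.1 hc.totallyBounded ε hε
    refine ⟨insert 0 t, ht.insert 0, ?_⟩
    rintro _ ⟨⟨s, x⟩, ⟨-, hx⟩, rfl⟩
    rcases le_total s t₁ with hs | hs
    · have := htc ⟨(s, x), ⟨⟨zero_le, hs⟩, hx⟩, rfl⟩
      exact biUnion_mono (subset_insert _ _) (fun _ _ => subset_rfl) this
    · refine mem_biUnion (mem_insert _ _) ?_
      rw [mem_ball_zero_iff]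
      refine lt_of_le_of_lt ?_ (ht₁ s hs)
      have h1 := (Real.exp (-(W.growth + 1) * s) • W.toFun s).le_of_opNorm_le (W.norm_smul_le s) x
      refine h1.trans ?_
      have := hM x hx
      have := W.bound_nonneg
      gcongr
  refine ⟨closure (V '' (univ ×ˢ K)), htb.closure.isCompact_of_isClosed isClosed_closure,
    fun t x hx => subset_closure ⟨(t, x), ⟨mem_univ _, hx⟩, rfl⟩⟩

theorem norm_apply_le_of_le_one {t : ℝ≥0} (ht : t ≤ 1) (x : X) :
    ‖W.toFun t x‖ ≤ W.bound * Real.exp |W.growth| * ‖x‖ := by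
  refine (W.toFun t).le_of_opNorm_le ((W.norm_le t).trans ?_) x
  have := W.bound_nonneg
  have h1 : W.growth * t ≤ |W.growth| := by
    have h2 : (t : ℝ) ≤ 1 := by exact_mod_cast ht
    calc W.growth * t ≤ |W.growth| * t := by gcongr; exact le_abs_self _
      _ ≤ |W.growth| := mul_le_of_le_one_right (abs_nonneg _) h2
  gcongr

theorem eventually_le_one : ∀ᶠ t : ℝ≥0 in 𝓝[>] 0, t ≤ 1 :=
  mem_nhdsWithin_of_mem_nhds (Iic_mem_nhds zero_lt_one)

/-- The dual `C₀`-semigroup. -/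
def dual [CompleteSpace X] [IsUniformAddGroup E] (hJ : IsUniformInducing J) :
    C0Semigroup E where
  toFun t := dualMap J hJ (W.toFun t)
  map_zero' := by
    ext f
    refine eq_of_forall_pairing (J := J) fun x => ?_
    rw [dualMap_apply, W.map_zero]; rfl
  map_add' t s := by
    ext f
    refine eq_of_forall_pairing (J := J) fun x => ?_
    change J (dualMap J hJ _ f) x = J (dualMap J hJ _ (dualMap J hJ _ f)) x
    -- Transposition reverses products; commutativity of addition restores the order.
    rw [dualMap_apply, dualMap_apply, dualMap_apply, add_comm, W.map_add]; rfl
  tendsto_zero' f := by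
    obtain ⟨C, hC0, hC⟩ := exists_pairing_bound (J := J) f
    refine tendsto_of_pairing hJ (C := C * (W.bound * Real.exp |W.growth|)) ?_ fun x => ?_
    · filter_upwards [eventually_le_one] with t ht x
      rw [dualMap_apply]
      refine (hC _).trans ?_
      rw [mul_assoc]
      gcongr
      exact W.norm_apply_le_of_le_one ht x
    · simp only [dualMap_apply]
      have h1 : Tendsto (fun t => W.toFun t x) (𝓝[>] 0) (𝓝 x) := by
        have := (W.continuous x).tendsto 0
        rw [W.map_zero] at this
        exact this.mono_left nhdsWithin_le_nhds
      exact ((J f : X →L[ℝ] ℝ).continuous.tendsto x).comp h1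
  equicontinuous' := by
    refine ⟨W.growth + 1, ?_⟩
    refine equicontinuous_of_nhds_zero
      (fun t : ℝ≥0 => (Real.exp (-(W.growth + 1) * (t : ℝ)) • (dualMap J hJ (W.toFun t)).toLinearMap))
      fun N hN => ?_
    rw [hJ.isInducing.nhds_eq_comap, _root_.map_zero] at hN ⊢
    obtain ⟨N₁, hN₁, hN₁N⟩ := hN
    obtain ⟨⟨K, U⟩, ⟨hK, hU⟩, hKU⟩ := CompactConvergenceCLM.hasBasis_nhds_zero.mem_iff.1 hN₁
    obtain ⟨K', hK', hKK'⟩ := W.exists_compact hK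
    refine ⟨_, preimage_mem_comap (CompactConvergenceCLM.hasBasis_nhds_zero.mem_of_mem
      (i := (K', U)) ⟨hK', hU⟩), fun f hf t => hN₁N (hKU fun x hx => ?_)⟩
    have h1 := hf _ (hKK' t x hx)
    have h2 : J ((Real.exp (-(W.growth + 1) * (t : ℝ)) • (dualMap J hJ (W.toFun t)).toLinearMap) f) x
        = J f (Real.exp (-(W.growth + 1) * t) • W.toFun t x) := by
      have h3 : J f (Real.exp (-(W.growth + 1) * t) • W.toFun t x) =
        Real.exp (-(W.growth + 1) * t) • J f (W.toFun t x) := map_smul (J f) _ _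
      rw [h3, ← dualMap_apply hJ, LinearMap.smul_apply, map_smul]; rfl
    rw [h2]
    exact h1

/-- The bound linear in t keeps the difference quotients bounded in the dual, which upgrades their
pointwise limit to a limit in the topology of compact convergence. -/
theorem dual_hasGenerator [CompleteSpace X] [IsUniformAddGroup E] (hJ : IsUniformInducing J)
    {f k : E} {C : ℝ} (hb : ∀ t : ℝ≥0, t ≤ 1 → ∀ x, |J f (W.toFun t x - x)| ≤ C * ‖x‖ * t)
    (hl : ∀ x, Tendsto (fun t : ℝ≥0 => (t : ℝ)⁻¹ * J f (W.toFun t x - x)) (𝓝[>] 0)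
      (𝓝 (J k x))) : (W.dual hJ).HasGenerator f k := by
  have hq : ∀ (t : ℝ≥0) x, J ((t : ℝ)⁻¹ • ((W.dual hJ).toFun t f - f)) x =
      (t : ℝ)⁻¹ * J f (W.toFun t x - x) := by
    intro t x
    have h1 : J f (W.toFun t x - x) = J f (W.toFun t x) - J f x := map_sub (J f) _ _
    rw [h1, ← dualMap_apply hJ, map_smul, map_sub]; rfl
  refine tendsto_of_pairing hJ (C := C) ?_ fun x => ?_
  · filter_upwards [eventually_le_one, self_mem_nhdsWithin] with t ht ht0 x
    have ht0' : (0 : ℝ) < t := ht0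
    rw [hq, abs_mul, abs_inv, NNReal.abs_eq, inv_mul_le_iff₀ ht0', mul_comm]
    exact hb t ht x
  · simp only [hq]
    exact hl x

end ExpBoundedSemigroup

end Dual

/-! ### Generators of transposed semigroups and their rank-one modifications -/

section Generation

variable {X : Type*} [NormedAddCommGroup X] [NormedSpace ℝ X]

/-- The semigroup `e^{βt} U⁻¹ P(t) U`. -/
def ContractionSemigroup.conj (P : ContractionSemigroup X) (β : ℝ) (U : X ≃L[ℝ] X) :
    ExpBoundedSemigroup X where
  toFun t := Real.exp (β * t) • ((U.symm : X →L[ℝ] X) * P.toFun t * (U : X →L[ℝ] X))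
  map_zero := by
    ext x; simp [P.map_zero]
  map_add s t := by
    ext x; simp [P.map_add, mul_add, Real.exp_add, smul_smul, mul_comm]
  continuous x := by
    have := P.continuous (U x)
    simp only [smul_apply, mul_apply_eq_comp]
    exact (by fun_prop : Continuous fun t : ℝ≥0 => Real.exp (β * t)).smul
      (U.symm.continuous.comp this)
  bound := ‖(U.symm : X →L[ℝ] X)‖ * ‖(U : X →L[ℝ] X)‖
  growth := β
  norm_le t := by
    rw [norm_smul, Real.norm_of_nonneg (Real.exp_nonneg _), mul_comm]
    gcongr
    calc _ ≤ ‖(U.symm : X →L[ℝ] X) * P.toFun t‖ * ‖(U : X →L[ℝ] X)‖ := norm_mul_le _ _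
      _ ≤ ‖(U.symm : X →L[ℝ] X)‖ * ‖P.toFun t‖ * ‖(U : X →L[ℝ] X)‖ := by
        gcongr; exact norm_mul_le _ _
      _ ≤ ‖(U.symm : X →L[ℝ] X)‖ * 1 * ‖(U : X →L[ℝ] X)‖ := by
        gcongr; exact P.norm_le_one t
      _ = _ := by ring

theorem ContractionSemigroup.conj_apply (P : ContractionSemigroup X) (β : ℝ) (U : X ≃L[ℝ] X)
    (t : ℝ≥0) (x : X) :
    (P.conj β U).toFun t x = Real.exp (β * t) • U.symm (P.toFun t (U x)) := rfl

theorem tendsto_inv_mul_integral {φ : ℝ → ℝ} (hφ : Continuous φ) :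
    Tendsto (fun t : ℝ≥0 => (t : ℝ)⁻¹ * ∫ s in (0 : ℝ)..t, φ s) (𝓝[>] 0) (𝓝 (φ 0)) := by
  have h1 := (hφ.integral_hasStrictDerivAt 0 0).hasDerivAt
  have h2 := hasDerivAt_iff_tendsto_slope.1 h1
  have h3 : Tendsto (fun t : ℝ≥0 => (t : ℝ)) (𝓝[>] 0) (𝓝[≠] 0) := by
    refine tendsto_nhdsWithin_iff.2 ⟨?_, ?_⟩
    · have : Continuous fun t : ℝ≥0 => (t : ℝ) := by fun_prop
      simpa using (this.tendsto 0).mono_left nhdsWithin_le_nhds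
    · filter_upwards [self_mem_nhdsWithin] with t ht
      exact (NNReal.coe_pos.2 ht).ne'
  refine (h2.comp h3).congr fun t => ?_
  simp [slope]

theorem abs_exp_sub_one_le {β t : ℝ} (h0 : 0 ≤ t) (h1 : t ≤ 1) :
    |Real.exp (β * t) - 1| ≤ |β| * Real.exp |β| * t := by
  have h2 : β * t ≤ |β| * t := by gcongr; exact le_abs_self _
  have h2' : -(|β| * t) ≤ β * t := by nlinarith [neg_abs_le β]
  have h3 : |β| * t ≤ |β| := mul_le_of_le_one_right (abs_nonneg _) h1
  have h6 : 0 ≤ |β| * t := by positivity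
  have h7 : (1 : ℝ) ≤ Real.exp |β| := Real.one_le_exp (abs_nonneg _)
  have h8 : |β| * t ≤ |β| * Real.exp |β| * t := by nlinarith
  rw [abs_le]
  constructor
  · linarith [Real.add_one_le_exp (β * t)]
  · have h4 := Real.add_one_le_exp (-(|β| * t))
    have h5 : Real.exp (|β| * t) * Real.exp (-(|β| * t)) = 1 := by rw [← Real.exp_add]; simp
    have h9 : Real.exp (β * t) ≤ Real.exp (|β| * t) := Real.exp_le_exp.2 h2
    have h10 : Real.exp (|β| * t) ≤ Real.exp |β| := Real.exp_le_exp.2 h3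
    have h11 : Real.exp (|β| * t) - 1 ≤ Real.exp (|β| * t) * (|β| * t) := by
      nlinarith [Real.exp_pos (|β| * t)]
    nlinarith

/-- The invertible operator `x ↦ x - u(x) h`, for `u(h) ≠ 1`. -/
def subRankOne (u : X →L[ℝ] ℝ) (h : X) (huh : u h ≠ 1) : X ≃L[ℝ] X :=
  ContinuousLinearEquiv.equivOfInverse (1 - u.smulRight h) (1 + (1 - u h)⁻¹ • u.smulRight h)
    (fun x => by
      have : 1 - u h ≠ 0 := sub_ne_zero.2 huh.symm
      simp only [add_apply, sub_apply, one_apply_eq_self, smul_apply,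
        ContinuousLinearMap.smulRight_apply, map_sub, map_smul]
      match_scalars <;> grind)
    (fun x => by
      have : 1 - u h ≠ 0 := sub_ne_zero.2 huh.symm
      simp only [add_apply, sub_apply, one_apply_eq_self, smul_apply,
        ContinuousLinearMap.smulRight_apply, map_add, map_smul]
      match_scalars <;> grind)

theorem subRankOne_symm_apply (u : X →L[ℝ] ℝ) (h : X) (huh : u h ≠ 1) (x : X) :
    (subRankOne u h huh).symm x = x + ((1 - u h)⁻¹ * u x) • h := by
  change x + (1 - u h)⁻¹ • u x • h = _
  rw [smul_smul]

variable [CompleteSpace X] {E : Type*} [AddCommGroup E] [Module ℝ E] [UniformSpace E]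
  {J : E ≃ₗ[ℝ] (X →L_c[ℝ] ℝ)}

/-- Existence of the dual semigroup generated by `K (G + B)^* K⁻¹`, where `U = K^*`. -/
theorem IsMDissipative.exists_c0Semigroup_conj [IsUniformAddGroup E] (hJ : IsUniformInducing J)
    {G : Submodule ℝ (X × X)} (hG : IsMDissipative G) (B : X →L[ℝ] X) (U : X ≃L[ℝ] X) :
    ∃ S : C0Semigroup E, ∀ f k : E,
      (∀ x y, (x, y) ∈ G → J f (U.symm (y + B x)) = J k (U.symm x)) → S.HasGenerator f k := by
  obtain ⟨P, hP⟩ := (hG.perturbedGraph B).exists_contractionSemigroup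
  -- P comes from G + B - ‖B‖; the factor e^{‖B‖t} removes the shift.
  refine ⟨(P.conj ‖B‖ U).dual hJ, fun f k hfk => ?_⟩
  set β := ‖B‖
  let f₀ : X →L[ℝ] ℝ := J f
  let k₀ : X →L[ℝ] ℝ := J k
  let f' : X →L[ℝ] ℝ := f₀ ∘L (U.symm : X →L[ℝ] X)
  let k' : X →L[ℝ] ℝ := k₀ ∘L (U.symm : X →L[ℝ] X) - β • f'
  have hpair : ∀ x y, (x, y) ∈ _root_.perturbedGraph G B → f' y = k' x := by
    intro x y hxy
    have h1 : f₀ (U.symm (y - B x + β • x + B x)) = k₀ (U.symm x) := hfk _ _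
      (mem_perturbedGraph.1 hxy)
    have h2 : y - B x + β • x + B x = y + β • x := by abel
    rw [h2, map_add, map_add, map_smul, map_smul] at h1
    change f₀ (U.symm y) = k₀ (U.symm x) - β * f₀ (U.symm x)
    rw [smul_eq_mul] at h1
    linarith
  have hint := hP f' k' hpair
  have hval : ∀ (t : ℝ≥0) x, J f ((P.conj β U).toFun t x - x) =
      Real.exp (β * t) * f' (P.toFun t (U x) - U x) + (Real.exp (β * t) - 1) * f' (U x) := by
    intro t x
    have h1 : J f ((P.conj β U).toFun t x - x) =
        f' (Real.exp (β * t) • P.toFun t (U x) - U x) := by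
      change f₀ _ = f₀ (U.symm _)
      rw [P.conj_apply, map_sub U.symm, map_smul U.symm, U.symm_apply_apply]
    rw [h1, map_sub, map_sub, map_smul, smul_eq_mul]
    ring
  have hcont : ∀ x, Continuous fun s : ℝ => k' (P.toFun s.toNNReal x) := fun x =>
    k'.continuous.comp ((P.continuous x).comp continuous_real_toNNReal)
  refine (P.conj β U).dual_hasGenerator hJ
    (C := Real.exp |β| * (‖k'‖ * ‖(U : X →L[ℝ] X)‖) +
      |β| * Real.exp |β| * (‖f'‖ * ‖(U : X →L[ℝ] X)‖))
    (fun t ht x => ?_) fun x => ?_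
  · have ht' : (t : ℝ) ≤ 1 := by exact_mod_cast ht
    rw [hval]
    have h1 : |f' (P.toFun t (U x) - U x)| ≤ ‖k'‖ * ‖(U : X →L[ℝ] X)‖ * ‖x‖ * t := by
      rw [hint]
      have := intervalIntegral.norm_integral_le_of_norm_le_const (a := 0) (b := (t : ℝ))
        (C := ‖k'‖ * ‖(U : X →L[ℝ] X)‖ * ‖x‖) (f := fun s => k' (P.toFun s.toNNReal (U x)))
        (fun s _ => by
          refine (k'.le_opNorm _).trans ?_
          rw [mul_assoc]
          gcongr
          exact (P.norm_apply_le _ _).trans ((U : X →L[ℝ] X).le_opNorm x))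
      simpa using this
    have h2 : |f' (U x)| ≤ ‖f'‖ * ‖(U : X →L[ℝ] X)‖ * ‖x‖ := by
      refine (f'.le_opNorm _).trans ?_
      rw [mul_assoc]
      gcongr
      exact (U : X →L[ℝ] X).le_opNorm x
    have h3 : Real.exp (β * t) ≤ Real.exp |β| := Real.exp_le_exp.2 (by
      calc β * t ≤ |β| * t := by gcongr; exact le_abs_self _
        _ ≤ |β| := mul_le_of_le_one_right (abs_nonneg _) ht')
    refine (abs_add_le _ _).trans ?_
    rw [abs_mul, abs_mul, Real.abs_exp]
    calc Real.exp (β * t) * |f' (P.toFun t (U x) - U x)| + |Real.exp (β * t) - 1| * |f' (U x)|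
        ≤ Real.exp |β| * (‖k'‖ * ‖(U : X →L[ℝ] X)‖ * ‖x‖ * t) +
          |β| * Real.exp |β| * t * (‖f'‖ * ‖(U : X →L[ℝ] X)‖ * ‖x‖) := by
          gcongr
          exact abs_exp_sub_one_le t.coe_nonneg ht'
      _ = _ := by ring
  · have h1 := tendsto_inv_mul_integral (hcont (U x))
    have h2 := tendsto_inv_mul_integral
      (by fun_prop : Continuous fun s : ℝ => β * Real.exp (β * s))
    have h3 : ∀ t : ℝ≥0, ∫ s in (0 : ℝ)..t, β * Real.exp (β * s) = Real.exp (β * t) - 1 := by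
      intro t
      rw [intervalIntegral.integral_eq_sub_of_hasDerivAt (f := fun s => Real.exp (β * s))
        (fun s _ => by
          have := ((hasDerivAt_id s).const_mul β).exp
          simpa [mul_comm] using this) (Continuous.intervalIntegrable (by fun_prop) _ _)]
      simp
    have h4 : Tendsto (fun t : ℝ≥0 => Real.exp (β * t)) (𝓝[>] 0) (𝓝 1) := by
      have : Continuous fun t : ℝ≥0 => Real.exp (β * t) := by fun_prop
      simpa using (this.tendsto 0).mono_left nhdsWithin_le_nhds
    have h5 := (h4.mul h1).add (h2.mul_const (f' (U x)))
    have h6 : J k x = 1 * k' (P.toFun (Real.toNNReal 0) (U x)) + β * Real.exp (β * 0) * f' (U x) := by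
      have h7 : k' (U x) = J k x - β * f' (U x) := by
        change k₀ (U.symm (U x)) - β * f' (U x) = k₀ x - _
        rw [U.symm_apply_apply]
      rw [Real.toNNReal_zero, P.map_zero, one_apply_eq_self, h7]
      simp
    rw [h6]
    refine h5.congr fun t => ?_
    rw [hval, hint, h3]
    ring

theorem IsMDissipative.exists_c0Semigroup [IsUniformAddGroup E] (hJ : IsUniformInducing J)
    {G : Submodule ℝ (X × X)} (hG : IsMDissipative G) :
    ∃ S : C0Semigroup E, ∀ f k : E,
      (∀ x y, (x, y) ∈ G → J f y = J k x) → S.HasGenerator f k := by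
  obtain ⟨S, hS⟩ := hG.exists_c0Semigroup_conj hJ 0 (ContinuousLinearEquiv.refl ℝ X)
  exact ⟨S, fun f k h => hS f k (by simpa using h)⟩

theorem c0Semigroup_hasGenerator_unique [T2Space E] {S : C0Semigroup E} {f k k' : E}
    (h : S.HasGenerator f k) (h' : S.HasGenerator f k') : k = k' :=
  tendsto_nhds_unique h h'

/-- If some nonzero `h` annihilates the range of `lam - A`, then a second dual semigroup has a
generator extending `A`. -/
theorem IsMDissipative.exists_two_c0Semigroups [IsUniformAddGroup E] (hJ : IsUniformInducing J)
    {G : Submodule ℝ (X × X)} (hG : IsMDissipative G) {lam : ℝ} (hlam : 0 < lam) {h : X}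
    (hh : h ≠ 0) :
    ∃ S₁ S₂ : C0Semigroup E, S₁ ≠ S₂ ∧ ∀ f k : E, (∀ x y, (x, y) ∈ G → J f y = J k x) →
      J (lam • f - k) h = 0 → S₁.HasGenerator f k ∧ S₂.HasGenerator f k := by
  have hT2 := t2Space_of_isUniformInducing hJ
  obtain ⟨R, hR⟩ := hG.exists_isResolvent hlam
  -- The range of R contains the domain of G, which is dense, so the transpose of R is injective.
  have hJR : ∀ w : E, (∀ x, J w (R x) = 0) → w = 0 := by
    intro w hw
    refine eq_of_forall_pairing (J := J) fun x => ?_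
    rw [map_zero]
    have h1 : IsClosed {x | (J w : X →L[ℝ] ℝ) x = 0} :=
      isClosed_eq (J w : X →L[ℝ] ℝ).continuous continuous_const
    refine h1.closure_subset_iff.2 ?_ (hG.dense x)
    rintro x ⟨y, hxy⟩
    change J w x = 0
    rw [← hR.apply_mem hxy]
    exact hw _
  have hdual : ∃ w₀ : E, J w₀ h ≠ 0 := by
    obtain ⟨g, -, hg⟩ := exists_dual_vector ℝ h (norm_ne_zero_iff.2 hh)
    refine ⟨J.symm g, ?_⟩
    have : J (J.symm g) h = g h := DFunLike.congr_fun (J.apply_symm_apply _) h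
    rw [this, hg]
    simpa using hh
  obtain ⟨w₀, hw₀⟩ := hdual
  -- With u = R*w this is u(h) ≠ 1, which makes x ↦ x - u(x)h invertible. Doubling w repairs the one
  -- exceptional value.
  obtain ⟨w, hw, hwR⟩ : ∃ w : E, w ≠ 0 ∧ J w (R h) ≠ 1 := by
    have hne : w₀ ≠ 0 := by
      rintro rfl
      rw [map_zero] at hw₀
      exact hw₀ rfl
    by_cases h1 : J w₀ (R h) = 1
    · refine ⟨(2 : ℝ) • w₀, smul_ne_zero two_ne_zero hne, ?_⟩
      have : J ((2 : ℝ) • w₀) (R h) = 2 * J w₀ (R h) := by rw [map_smul]; rfl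
      rw [this, h1]; norm_num
    · exact ⟨w₀, hne, h1⟩
  let u := dualMap J hJ R w
  have hu : ∀ x, J u x = J w (R x) := dualMap_apply hJ R w
  have hu0 : u ≠ 0 := by
    intro h0
    refine hw (hJR w fun x => ?_)
    rw [← hu, h0, map_zero]; rfl
  let u₀ : X →L[ℝ] ℝ := J u
  let w₁ : X →L[ℝ] ℝ := J w
  have huh : u₀ h ≠ 1 := by
    change J u h ≠ 1
    rwa [hu]
  obtain ⟨S₁, hS₁⟩ := hG.exists_c0Semigroup hJ
  -- Let K f = f - f(h)u be the transpose of x ↦ x - u(x)h. The operator L₂ f = G*f + (λf - G*f)(h)u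
  -- satisfies λ - L₂ = K(λ - G*). Since (λ - G*)u = w, conjugation gives K⁻¹L₂K = G* + (·)(h)w = (G
  -- + B)*, where Bx = w(x)h.
  obtain ⟨S₂, hS₂⟩ := hG.exists_c0Semigroup_conj hJ (w₁.smulRight h) (subRankOne u₀ h huh)
  have hS₂' : ∀ f k : E, (∀ x y, (x, y) ∈ G → J f y = J k x) →
      S₂.HasGenerator f (k + J (lam • f - k) h • u) := by
    intro f k hfk
    refine hS₂ f _ fun x y hxy => ?_
    let f₀ : X →L[ℝ] ℝ := J f
    let k₀ : X →L[ℝ] ℝ := J k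
    have e1 : f₀ y = k₀ x := hfk x y hxy
    have e2 : lam * u₀ x - u₀ y = w₁ x := by
      have h1 : u₀ (lam • x - y) = w₁ (R (lam • x - y)) := hu _
      rwa [hR.apply_mem hxy, map_sub, map_smul] at h1
    have e3 : J (lam • f - k) h = lam * f₀ h - k₀ h := by
      rw [map_sub, map_smul]; rfl
    have e4 : ∀ z, J (k + J (lam • f - k) h • u) z = k₀ z + (lam * f₀ h - k₀ h) * u₀ z := by
      intro z; rw [map_add, map_smul, e3]; rfl
    rw [e4, subRankOne_symm_apply, subRankOne_symm_apply]
    change f₀ _ = _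
    have hne : 1 - u₀ h ≠ 0 := sub_ne_zero.2 huh.symm
    simp only [map_add, map_smul, smul_eq_mul, ContinuousLinearMap.smulRight_apply]
    rw [e1]
    have e5 : u₀ y = lam * u₀ x - w₁ x := by linarith
    rw [e5]
    field_simp
    ring
  refine ⟨S₁, S₂, ?_, fun f k hfk h0 => ⟨hS₁ f k hfk, ?_⟩⟩
  -- At f = R*w₀ one has λf - G*f = w₀ with w₀(h) ≠ 0, so the two generators differ there by the
  -- nonzero vector w₀(h)u.
  · rintro rfl
    let f := dualMap J hJ R w₀
    have hpair : ∀ x y, (x, y) ∈ G → J f y = J (lam • f - w₀) x := by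
      intro x y hxy
      let f₀ : X →L[ℝ] ℝ := J f
      let w₂ : X →L[ℝ] ℝ := J w₀
      have h1 : f₀ (lam • x - y) = w₂ (R (lam • x - y)) := dualMap_apply hJ R w₀ _
      rw [hR.apply_mem hxy, map_sub, map_smul, smul_eq_mul] at h1
      have h2 : J (lam • f - w₀) x = lam * f₀ x - w₂ x := by
        rw [map_sub, map_smul]; rfl
      rw [h2]
      change f₀ y = _
      linarith
    have h1 := c0Semigroup_hasGenerator_unique (hS₁ _ _ hpair) (hS₂' _ _ hpair)
    rw [sub_sub_cancel, left_eq_add, smul_eq_zero] at h1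
    exact h1.elim hw₀ hu0
  · have := hS₂' f k hfk
    rwa [h0, zero_smul, add_zero] at this

end Generation

/-! ### The dual of `L¹` and the dual of `L^∞` with the topology `𝒞(L^∞, L¹)` -/

section LInftyDuality

variable {m : Measure ℝ}

namespace LInftyC

/-- The class in `L^∞` of an essentially bounded function. -/
def mk {f : ℝ → ℝ} (hf : MemLp f ∞ m) : LInftyC m := hf.toLp f

/-- A representative of an element of `L^∞`. -/
def rep (f : LInftyC m) : ℝ → ℝ := (show Lp ℝ ∞ m from f)

theorem memLp_rep (f : LInftyC m) : MemLp f.rep ∞ m := Lp.memLp (show Lp ℝ ∞ m from f)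

theorem rep_mk {f : ℝ → ℝ} (hf : MemLp f ∞ m) : (mk hf).rep =ᵐ[m] f := hf.coeFn_toLp

theorem mk_rep (f : LInftyC m) : mk f.memLp_rep = f := Lp.toLp_coeFn _ _

theorem mk_eq_mk {f g : ℝ → ℝ} (hf : MemLp f ∞ m) (hg : MemLp g ∞ m) (h : f =ᵐ[m] g) :
    mk hf = mk hg := (MemLp.toLp_eq_toLp_iff hf hg).2 h

theorem mk_eq_zero {f : ℝ → ℝ} (hf : MemLp f ∞ m) (h : f =ᵐ[m] 0) : mk hf = 0 :=
  (mk_eq_mk hf MemLp.zero h).trans (MemLp.toLp_zero _)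

theorem toDual_apply' (f : LInftyC m) (g : Lp ℝ 1 m) : toDual m f g = ∫ x, f.rep x * g x ∂m :=
  toDual_apply m f g

theorem toDual_mk {f : ℝ → ℝ} (hf : MemLp f ∞ m) (g : Lp ℝ 1 m) :
    toDual m (mk hf) g = ∫ x, f x * g x ∂m := by
  rw [toDual_apply']
  exact integral_congr_ae ((rep_mk hf).mono fun x hx => by simp only [hx])

theorem toDual_mk_toLp {f g : ℝ → ℝ} (hf : MemLp f ∞ m) (hg : MemLp g 1 m) :
    toDual m (mk hf) (hg.toLp g) = ∫ x, f x * g x ∂m := by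
  rw [toDual_mk]
  exact integral_congr_ae (hg.coeFn_toLp.mono fun x hx => by simp only [hx])

theorem integrable_mul {f g : ℝ → ℝ} (hf : MemLp f ∞ m) (hg : Integrable g m) :
    Integrable (fun x => f x * g x) m := by
  have := (memLp_one_iff_integrable.2 hg).mul' (r := 1) hf
  exact memLp_one_iff_integrable.1 this

end LInftyC

theorem norm_toLp_one_eq {g : ℝ → ℝ} (hg : MemLp g 1 m) : ‖hg.toLp g‖ = ∫ x, |g x| ∂m := by
  rw [L1.norm_eq_integral_norm]
  exact integral_congr_ae (hg.coeFn_toLp.mono fun x hx => by simp only [hx, Real.norm_eq_abs])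

theorem integrable_coeFn_one (g : Lp ℝ 1 m) : Integrable g m :=
  memLp_one_iff_integrable.1 (Lp.memLp g)

theorem toDual_injective [SigmaFinite m] : Function.Injective (LInftyC.toDual m) := by
  rw [← LinearMap.ker_eq_bot, LinearMap.ker_eq_bot']
  intro f hf
  have hint : ∀ s : Set ℝ, MeasurableSet s → m s < ⊤ → IntegrableOn f.rep s m := fun s _ hms =>
    have : IsFiniteMeasure (m.restrict s) := ⟨by simpa using hms⟩
    memLp_one_iff_integrable.1 ((MemLp.restrict s f.memLp_rep).mono_exponent le_top)
  have h0 := ae_eq_zero_of_forall_setIntegral_eq_of_sigmaFinite hint (fun s hs hms => by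
    have h1 : LInftyC.toDual m f (indicatorConstLp 1 hs hms.ne 1) = 0 := by rw [hf]; rfl
    rw [LInftyC.toDual_apply'] at h1
    rw [← h1, ← integral_indicator hs]
    refine integral_congr_ae (EventuallyEq.symm <| (indicatorConstLp_coeFn (p := 1) (hs := hs) (hμs := hms.ne)
      (c := (1 : ℝ))).mono fun x hx => ?_)
    simp only [hx]
    by_cases hxs : x ∈ s <;> simp [hxs])
  exact Lp.ext (h0.trans (Lp.coeFn_zero ..).symm)

theorem norm_toLp_one_tendsto_zero {g : ℝ → ℝ} (hg : Integrable g m) {A : ℕ → Set ℝ}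
    (hA : ∀ n, MeasurableSet (A n)) (hlim : ∀ᵐ x ∂m, ∀ᶠ n in atTop, x ∉ A n) :
    Tendsto (fun n => ∫ x, |(A n).indicator g x| ∂m) atTop (𝓝 0) := by
  have := tendsto_integral_of_dominated_convergence (μ := m)
    (F := fun n x => |(A n).indicator g x|) (f := fun _ => 0) (fun x => |g x|)
    (fun n => (hg.1.indicator (hA n)).norm) hg.norm
    (fun n => ae_of_all _ fun x => by
      by_cases hx : x ∈ A n <;> simp [hx])
    (hlim.mono fun x hx => tendsto_const_nhds.congr' (hx.mono fun n hn => by simp [hn]))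
  simpa using this

/-- Let w > 0 be an integrable weight and s = √w. Multiplication by s maps L² into L¹, so the
functional pulls back to L² and is represented there by some k. Testing on sets gives |k| ≤ ‖Λ‖s,
hence k/s is bounded. It represents Λ on multiples of s by L² functions, which are dense in L¹. -/
theorem toDual_surjective [SigmaFinite m] : Function.Surjective (LInftyC.toDual m) := by
  intro Λ'
  let Λ : Lp ℝ 1 m →L[ℝ] ℝ := Λ'
  obtain ⟨w, hw0, hwm, hwi⟩ := exists_pos_lintegral_lt_of_sigmaFinite m one_ne_zero
  let s : ℝ → ℝ := fun x => Real.sqrt (w x)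
  have hs0 : ∀ x, 0 < s x := fun x => Real.sqrt_pos.2 (NNReal.coe_pos.2 (hw0 x))
  have hsm : Measurable s := by fun_prop
  have hwint : Integrable (fun x => (w x : ℝ)) m := by
    refine ⟨by fun_prop, ?_⟩
    rw [hasFiniteIntegral_iff_enorm]
    refine lt_of_le_of_lt (le_of_eq ?_) (hwi.trans ENNReal.one_lt_top)
    simp
  have hss : ∀ x, s x * s x = w x := fun x => Real.mul_self_sqrt (w x).2
  have hs2 : MemLp s 2 m := by
    rw [memLp_two_iff_integrable_sq hsm.aestronglyMeasurable]
    exact hwint.congr (ae_of_all _ fun x => by simp only [pow_two, hss])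
  let Φ : Lp ℝ 2 m →L[ℝ] Lp ℝ 1 m :=
    (ContinuousLinearMap.mul ℝ ℝ).holderL m 2 2 1 (hs2.toLp s)
  have hΦ : ∀ k, Φ k =ᵐ[m] fun x => s x * k x := fun k => by
    refine ((ContinuousLinearMap.mul ℝ ℝ).coeFn_holder (r := 1) (hs2.toLp s) k).trans ?_
    filter_upwards [hs2.coeFn_toLp] with x hx
    simp [hx]
  let k := (InnerProductSpace.toDual ℝ (Lp ℝ 2 m)).symm (Λ ∘L Φ)
  have hk : ∀ g, inner ℝ g k = Λ (Φ g) := fun g => by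
    rw [real_inner_comm, InnerProductSpace.toDual_symm_apply]; rfl
  set C := ‖Λ‖ with hC
  have hbound : ∀ (A : Set ℝ) (hA : MeasurableSet A) (hmA : m A < ⊤),
      |∫ x in A, k x ∂m| ≤ C * ∫ x in A, s x ∂m := by
    intro A hA hmA
    have h1 := L2.inner_indicatorConstLp_one (𝕜 := ℝ) hA hmA.ne k
    rw [← h1, hk]
    refine (Λ.le_opNorm _).trans ?_
    gcongr
    rw [L1.norm_eq_integral_norm, ← integral_indicator hA]
    refine le_of_eq (integral_congr_ae ?_)
    filter_upwards [hΦ (indicatorConstLp 2 hA hmA.ne 1),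
      indicatorConstLp_coeFn (p := 2) (hs := hA) (hμs := hmA.ne) (c := (1 : ℝ))] with x h1 h2
    rw [h1, h2]
    by_cases hx : x ∈ A
    · simp [hx, abs_of_pos (hs0 x)]
    · simp [hx]
  have hint2 : ∀ {g : ℝ → ℝ}, MemLp g 2 m → ∀ A : Set ℝ, m A < ⊤ → IntegrableOn g A m :=
    fun hg A hA => by
      have : IsFiniteMeasure (m.restrict A) := ⟨by simpa using hA⟩
      exact (hg.restrict A).integrable one_le_two
  -- The bound on integrals over all sets of finite measure localizes to the pointwise inequality.
  have hle1 : 0 ≤ᵐ[m] fun x => C * s x - k x :=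
    ae_nonneg_of_forall_setIntegral_nonneg_of_sigmaFinite
      (fun A _ hmA => ((hint2 hs2 A hmA).const_mul C).sub (hint2 (Lp.memLp k) A hmA))
      (fun A hA hmA => by
        rw [integral_sub ((hint2 hs2 A hmA).const_mul C) (hint2 (Lp.memLp k) A hmA),
          integral_const_mul]
        linarith [(abs_le.1 (hbound A hA hmA)).2])
  have hle2 : 0 ≤ᵐ[m] fun x => C * s x + k x :=
    ae_nonneg_of_forall_setIntegral_nonneg_of_sigmaFinite
      (fun A _ hmA => ((hint2 hs2 A hmA).const_mul C).add (hint2 (Lp.memLp k) A hmA))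
      (fun A hA hmA => by
        rw [integral_add ((hint2 hs2 A hmA).const_mul C) (hint2 (Lp.memLp k) A hmA),
          integral_const_mul]
        linarith [(abs_le.1 (hbound A hA hmA)).1])
  have hf : MemLp (fun x => k x / s x) ∞ m := by
    refine memLp_top_of_bound ((Lp.stronglyMeasurable k).measurable.div
      hsm).aestronglyMeasurable C ?_
    filter_upwards [hle1, hle2] with x h1 h2
    rw [Real.norm_eq_abs, abs_div, abs_of_pos (hs0 x), div_le_iff₀ (hs0 x), abs_le]
    simp only [Pi.zero_apply] at h1 h2
    constructor <;> linarith
  refine ⟨LInftyC.mk hf, ?_⟩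
  let Θ : Lp ℝ 1 m →L[ℝ] ℝ := LInftyC.toDual m (LInftyC.mk hf)
  have hΘ : ∀ g, Θ g = ∫ x, k x / s x * g x ∂m := LInftyC.toDual_mk hf
  have hΘΦ : ∀ g, Θ (Φ g) = Λ (Φ g) := by
    intro g
    rw [hΘ, ← hk, L2.inner_def]
    refine integral_congr_ae ((hΦ g).mono fun x hx => ?_)
    simp only [hx]
    have := (hs0 x).ne'
    simp only [RCLike.inner_apply, conj_trivial]
    field_simp
  refine DFunLike.ext _ _ fun g => ?_
  change Θ g = Λ g
  have hgi := integrable_coeFn_one g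
  have hgm : Measurable g := (Lp.stronglyMeasurable g).measurable
  -- Off this set |g| ≤ n w = n s², so g/s is dominated by n s and lies in L². The part of g on the
  -- set tends to 0 in L¹.
  let B : ℕ → Set ℝ := fun n => {x | n * (w x : ℝ) < |g x|}
  have hB : ∀ n, MeasurableSet (B n) := fun n =>
    measurableSet_lt (by fun_prop) (by fun_prop)
  have hlim := norm_toLp_one_tendsto_zero hgi hB (ae_of_all _ fun x => by
    obtain ⟨N, hN⟩ := exists_nat_ge (|g x| / w x)
    filter_upwards [eventually_ge_atTop N] with n hn
    have hw : (0 : ℝ) < w x := NNReal.coe_pos.2 (hw0 x)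
    rw [div_le_iff₀ hw] at hN
    have : (N : ℝ) ≤ n := by exact_mod_cast hn
    simp only [B, mem_ofPred_eq, not_lt]
    exact hN.trans (by gcongr))
  have key : ∀ n, |Θ g - Λ g| ≤ ‖Θ - Λ‖ * ∫ x, |(B n).indicator g x| ∂m := by
    intro n
    have hBi : MemLp ((B n).indicator g) 1 m := (Lp.memLp g).indicator (hB n)
    have hκ : MemLp (fun x => (B n)ᶜ.indicator g x / s x) 2 m := by
      refine (hs2.const_mul (n : ℝ)).mono
        ((hgm.indicator (hB n).compl).div hsm).aestronglyMeasurable (ae_of_all _ fun x => ?_)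
      rw [norm_div, Real.norm_of_nonneg (hs0 x).le, div_le_iff₀ (hs0 x),
        Real.norm_of_nonneg (mul_nonneg n.cast_nonneg (hs0 x).le), mul_assoc, hss]
      by_cases hx : x ∈ B n
      · simp only [mem_compl_iff, hx, not_true_eq_false, not_false_eq_true, indicator_of_notMem,
          norm_zero]
        positivity
      · simp only [mem_compl_iff, hx, not_false_eq_true, indicator_of_mem]
        exact not_lt.1 hx
    have hsplit : g = Φ (hκ.toLp _) + hBi.toLp _ := by
      refine Lp.ext ?_
      filter_upwards [Lp.coeFn_add (Φ (hκ.toLp _)) (hBi.toLp _), hΦ (hκ.toLp _), hκ.coeFn_toLp,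
        hBi.coeFn_toLp] with x h1 h2 h3 h4
      rw [h1, Pi.add_apply, h2, h3, h4, mul_div_cancel₀ _ (hs0 x).ne']
      by_cases hx : x ∈ B n <;> simp [hx]
    have h1 : Θ g - Λ g = (Θ - Λ) (hBi.toLp _) := by
      rw [sub_apply]
      nth_rw 1 2 [hsplit]
      rw [map_add, map_add, hΘΦ]
      ring
    rw [h1, ← norm_toLp_one_eq hBi]
    exact (Θ - Λ).le_opNorm _
  have h0 : |Θ g - Λ g| ≤ 0 := by
    refine ge_of_tendsto (by simpa using hlim.const_mul ‖Θ - Λ‖) (Eventually.of_forall key)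
  exact sub_eq_zero.1 (abs_nonpos_iff.1 h0)

variable (m) in
/-- The identification of `L^∞` with the dual of `L¹`. -/
def LInftyC.dualEquiv [SigmaFinite m] : LInftyC m ≃ₗ[ℝ] (Lp ℝ 1 m →L_c[ℝ] ℝ) :=
  LinearEquiv.ofBijective (LInftyC.toDual m) ⟨toDual_injective, toDual_surjective⟩

theorem LInftyC.isUniformInducing_dualEquiv [SigmaFinite m] :
    IsUniformInducing (LInftyC.dualEquiv m) := ⟨rfl⟩

theorem LInftyC.tendsto_of_forall_pairing [SigmaFinite m] {ι : Type*} {l : Filter ι}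
    {F : ι → LInftyC m} {F₀ : LInftyC m} {C : ℝ} (hF : ∀ᶠ i in l, ∀ᵐ x ∂m, |(F i).rep x| ≤ C)
    (h : ∀ g : Lp ℝ 1 m, Tendsto (fun i => toDual m (F i) g) l (𝓝 (toDual m F₀ g))) :
    Tendsto F l (𝓝 F₀) := by
  refine tendsto_of_pairing LInftyC.isUniformInducing_dualEquiv (C := C) ?_ h
  filter_upwards [hF] with i hi g
  change |toDual m (F i) g| ≤ _
  rw [toDual_apply', L1.norm_eq_integral_norm, ← integral_const_mul, ← Real.norm_eq_abs]
  refine norm_integral_le_of_norm_le ((integrable_coeFn_one g).norm.const_mul C) ?_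
  filter_upwards [hi] with x hx
  rw [norm_mul]
  exact mul_le_mul_of_nonneg_right hx (norm_nonneg _)

/-- A continuous functional on `L^∞` with the topology `𝒞(L^∞, L¹)` is given by an `L¹`
function. -/
theorem LInftyC.exists_eq_toDual [SigmaFinite m] (ℓ : LInftyC m →L[ℝ] ℝ) :
    ∃ h : Lp ℝ 1 m, ∀ f, ℓ f = toDual m f h := by
  classical
  have hind : ∀ A : Set ℝ, MeasurableSet A → MemLp (A.indicator fun _ => (1 : ℝ)) ∞ m :=
    fun A hA => (memLp_top_const 1).indicator hA
  -- Values on indicator functions define a signed measure whose Radon–Nikodym density is the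
  -- required `L¹` function.
  let ν : SignedMeasure ℝ :=
    { measureOf' := fun A => if hA : MeasurableSet A then ℓ (mk (hind A hA)) else 0
      empty' := by
        rw [dif_pos MeasurableSet.empty]
        have : mk (hind ∅ MeasurableSet.empty) = 0 := by
          exact mk_eq_zero _ (ae_of_all _ fun x => by simp)
        rw [this, map_zero]
      not_measurable' := fun A hA => dif_neg hA
      m_iUnion' := fun A hA hd => by
        simp only [hA, MeasurableSet.iUnion hA, dif_pos]
        have hmem : ∀ s : Finset ℕ, mk (hind (⋃ i ∈ s, A i) (s.measurableSet_biUnion fun i _ => hA i))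
            = ∑ i ∈ s, mk (hind (A i) (hA i)) := by
          intro s
          induction s using Finset.induction_on with
          | empty =>
            exact mk_eq_zero _ (ae_of_all _ fun x => by simp)
          | insert a s ha ih =>
            rw [Finset.sum_insert ha, ← ih]
            refine (mk_eq_mk _ ((hind (A a) (hA a)).add (hind (⋃ i ∈ s, A i)
              (s.measurableSet_biUnion fun i _ => hA i))) (ae_of_all _ fun x => ?_)).trans
              (MemLp.toLp_add _ _)
            rw [Finset.set_biUnion_insert, indicator_union_of_disjoint]
            · rfl
            · rw [Set.disjoint_iUnion₂_right]
              exact fun i hi => hd (fun h => ha (h ▸ hi))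
        -- Countable additivity: the partial sums are indicators of finite unions, bounded by 1, so
        -- convergence against each `L¹` function gives convergence for `𝒞(L^∞, L¹)`. In the norm of
        -- `L^∞` this would fail.
        have hlim : Tendsto (fun s : Finset ℕ => ∑ i ∈ s, mk (hind (A i) (hA i))) atTop
            (𝓝 (mk (hind (⋃ i, A i) (MeasurableSet.iUnion hA)))) := by
          refine tendsto_of_forall_pairing (C := 1) (Eventually.of_forall fun s => ?_) fun g => ?_
          · rw [← hmem]
            filter_upwards [rep_mk (hind (⋃ i ∈ s, A i) (s.measurableSet_biUnion fun i _ => hA i))]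
              with x hx
            rw [hx]
            by_cases h : x ∈ ⋃ i ∈ s, A i <;> simp [h]
          · have hval : ∀ (B : Set ℝ) (hB : MeasurableSet B),
                toDual m (mk (hind B hB)) g = ∫ x in B, g x ∂m := by
              intro B hB
              rw [toDual_mk, ← integral_indicator hB]
              congr 1
              ext x
              by_cases h : x ∈ B <;> simp [h]
            have := hasSum_integral_iUnion hA hd (integrable_coeFn_one g).integrableOn
            rw [hval _ (MeasurableSet.iUnion hA)]
            refine Tendsto.congr (fun s => ?_) this
            rw [map_sum]
            change _ = (∑ i ∈ s, toDual m (mk (hind (A i) (hA i)))) g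
            rw [sum_apply]
            exact Finset.sum_congr rfl fun i _ => (hval _ (hA i)).symm
        have := (ℓ.continuous.tendsto _).comp hlim
        refine this.congr fun s => ?_
        simp only [Function.comp, map_sum] }
  have hν : ∀ A (hA : MeasurableSet A), ν A = ℓ (mk (hind A hA)) := fun A hA => dif_pos hA
  have hac : ν ≪ᵥ m.toENNRealVectorMeasure := by
    refine VectorMeasure.AbsolutelyContinuous.mk fun A hA h0 => ?_
    rw [Measure.toENNRealVectorMeasure_apply_measurable hA] at h0
    rw [hν A hA]
    have : mk (hind A hA) = 0 := by
      refine mk_eq_zero _ ?_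
      filter_upwards [measure_eq_zero_iff_ae_notMem.1 h0] with x hx
      simp [hx]
    rw [this, map_zero]
  have hrn := ν.withDensityᵥ_rnDeriv_eq m hac
  have hint := SignedMeasure.integrable_rnDeriv ν m
  have hνi : ∀ A (hA : MeasurableSet A), ℓ (mk (hind A hA)) = ∫ x in A, ν.rnDeriv m x ∂m := by
    intro A hA
    rw [← hν A hA, ← withDensityᵥ_apply hint hA, hrn]
  have hh : MemLp (ν.rnDeriv m) 1 m := memLp_one_iff_integrable.2 hint
  refine ⟨hh.toLp _, fun f => ?_⟩
  have hsimple : ∀ (φ : SimpleFunc ℝ ℝ), ∃ hφ : MemLp φ ∞ m,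
      ℓ (mk hφ) = toDual m (mk hφ) (hh.toLp _) := by
    intro φ
    induction φ using SimpleFunc.induction with
    | const c hs =>
      rename_i s
      have h1 : ⇑(SimpleFunc.piecewise s hs (SimpleFunc.const ℝ c) (SimpleFunc.const ℝ 0)) =
          fun x => c * s.indicator (fun _ => (1 : ℝ)) x := by
        ext x
        by_cases h : x ∈ s <;> simp [h]
      rw [h1]
      refine ⟨(hind s hs).const_mul c, ?_⟩
      have h2 : mk ((hind s hs).const_mul c) = c • mk (hind s hs) := MemLp.toLp_const_smul c _
      rw [toDual_mk_toLp, h2, map_smul, hνi s hs, smul_eq_mul, ← integral_indicator hs,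
        ← integral_const_mul]
      congr 1
      ext x
      by_cases h : x ∈ s <;> simp [h]
    | add _ hf hg =>
      rename_i f g _
      obtain ⟨hf1, hf2⟩ := hf
      obtain ⟨hg1, hg2⟩ := hg
      refine ⟨hf1.add hg1, ?_⟩
      have : mk (hf1.add hg1) = mk hf1 + mk hg1 := MemLp.toLp_add _ _
      change ℓ (mk (hf1.add hg1)) = toDual m (mk (hf1.add hg1)) _
      rw [this, map_add, map_add, hf2, hg2]; rfl
  have hfm : StronglyMeasurable f.rep := Lp.stronglyMeasurable (show Lp ℝ ∞ m from f)
  set c := (eLpNormEssSup f.rep m).toReal with hc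
  have hfb : ∀ᵐ x ∂m, ‖f.rep x‖ ≤ c := by
    have h3 := f.memLp_rep.2
    rw [eLpNorm_exponent_top] at h3
    filter_upwards [ae_le_eLpNormEssSup (f := f.rep) (μ := m)] with x hx
    rwa [← ENNReal.ofReal_toReal h3.ne, ← ofReal_norm,
      ENNReal.ofReal_le_ofReal_iff ENNReal.toReal_nonneg] at hx
  -- The truncated approximations stay within the essential bound c of f, so they converge to f in
  -- `𝒞(L^∞, L¹)` and not only pointwise.
  choose hφ hφe using fun n => hsimple (hfm.approxBounded c n)
  have hlim : Tendsto (fun n => mk (hφ n)) atTop (𝓝 f) := by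
    refine tendsto_of_forall_pairing (C := c) (Eventually.of_forall fun n => ?_) fun g => ?_
    · filter_upwards [rep_mk (hφ n)] with x hx
      rw [hx]
      exact hfm.norm_approxBounded_le ENNReal.toReal_nonneg n x
    · simp only [toDual_mk]
      rw [toDual_apply']
      refine tendsto_integral_of_dominated_convergence (fun x => c * ‖g x‖)
        (fun n => (integrable_mul (hφ n) (integrable_coeFn_one g)).1)
        ((integrable_coeFn_one g).norm.const_mul c) (fun n => ae_of_all _ fun x => ?_) ?_
      · rw [norm_mul]
        gcongr
        exact hfm.norm_approxBounded_le ENNReal.toReal_nonneg n x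
      · filter_upwards [hfm.tendsto_approxBounded_ae hfb] with x hx
        exact hx.mul_const _
  have h1 := (ℓ.continuous.tendsto _).comp hlim
  have h2 : Tendsto (fun n => toDual m (mk (hφ n)) (hh.toLp _)) atTop
      (𝓝 (toDual m f (hh.toLp _))) := by
    have hc : Continuous (fun f : LInftyC m => toDual m f (hh.toLp _)) :=
      (continuous_eval_const _).comp
        (LInftyC.isUniformInducing_dualEquiv (m := m)).isInducing.continuous
    exact (hc.tendsto _).comp hlim
  exact tendsto_nhds_unique h1 (h2.congr fun n => (hφe n).symm)

theorem denseRange_of_forall_functional {E D : Type*} [AddCommGroup E] [Module ℝ E]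
    [TopologicalSpace E] [IsTopologicalAddGroup E] [ContinuousSMul ℝ E] [LocallyConvexSpace ℝ E]
    [AddCommGroup D] [Module ℝ D] (j : D →ₗ[ℝ] E)
    (h : ∀ ℓ : E →L[ℝ] ℝ, (∀ d, ℓ (j d) = 0) → ℓ = 0) : DenseRange j := by
  have hcl : closure (LinearMap.range j : Set E) = univ := by
    by_contra hne
    obtain ⟨x, hx⟩ := (ne_univ_iff_exists_notMem _).1 hne
    rw [← Submodule.topologicalClosure_coe] at hx
    obtain ⟨ℓ, u, hu, hux⟩ := geometric_hahn_banach_closed_point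
      (Submodule.convex (LinearMap.range j).topologicalClosure)
      (LinearMap.range j).isClosed_topologicalClosure hx
    have hu0 : 0 < u := by
      simpa using hu 0 (Submodule.zero_mem _)
    have h0 : ∀ d, ℓ (j d) = 0 := by
      intro d
      by_contra hd
      have := hu ((u / ℓ (j d)) • j d) (Submodule.smul_mem _ _
        ((LinearMap.range j).le_topologicalClosure ⟨d, rfl⟩))
      rw [map_smul, smul_eq_mul, div_mul_cancel₀ _ hd] at this
      exact lt_irrefl _ this
    rw [h ℓ h0] at hux
    exact absurd hux (by simpa using hu0.le)
  intro x
  have : x ∈ closure (LinearMap.range j : Set E) := hcl ▸ mem_univ x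
  rwa [LinearMap.coe_range] at this

instance LInftyC.locallyConvexSpace : LocallyConvexSpace ℝ (LInftyC m) :=
  have : LocallyConvexSpace ℝ (Lp ℝ 1 m →L_c[ℝ] ℝ) :=
    UniformConvergenceCLM.locallyConvexSpace ℝ _ ⟨∅, isCompact_empty⟩
      (directedOn_of_sup_mem fun _ _ => IsCompact.union)
  LocallyConvexSpace.induced (LInftyC.toDual m)

end LInftyDuality

/-! ### Uniqueness of the semigroup when `μ - A` has dense range for large `μ` -/

section Uniqueness

theorem integrableOn_exp_mul {g : ℝ → ℝ} (hg : Continuous g) {M κ μ : ℝ}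
    (hb : ∀ t, 0 ≤ t → |g t| ≤ M * Real.exp (κ * t)) (hμ : κ < μ) :
    IntegrableOn (fun t => Real.exp (-μ * t) * g t) (Ioi 0) := by
  have h1 : IntegrableOn (fun t => M * Real.exp (-(μ - κ) * t)) (Ioi 0) :=
    (integrableOn_exp_mul_Ioi (by linarith) 0).const_mul M
  refine h1.mono' (by fun_prop) ((ae_restrict_iff' measurableSet_Ioi).2 (ae_of_all _ fun t ht => ?_))
  rw [norm_mul, Real.norm_of_nonneg (Real.exp_nonneg _), Real.norm_eq_abs]
  calc Real.exp (-μ * t) * |g t| ≤ Real.exp (-μ * t) * (M * Real.exp (κ * t)) := by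
        gcongr; exact hb t (le_of_lt ht)
    _ = M * (Real.exp (-μ * t) * Real.exp (κ * t)) := by ring
    _ = _ := by rw [← Real.exp_add]; ring_nf

/-- Injectivity of the Laplace transform on continuous functions of exponential growth. -/
theorem eq_zero_of_laplace_eq_zero {g : ℝ → ℝ} (hg : Continuous g) {M κ μ₁ : ℝ}
    (hb : ∀ t, 0 ≤ t → |g t| ≤ M * Real.exp (κ * t)) (hμ₁ : κ < μ₁)
    (h : ∀ μ, μ₁ ≤ μ → ∫ t in Ioi 0, Real.exp (-μ * t) * g t = 0) {t : ℝ} (ht : 0 < t) :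
    g t = 0 := by
  have hM : 0 ≤ M := by simpa using (abs_nonneg _).trans (hb 0 le_rfl)
  let G : ℝ → ℝ := fun t => Real.exp (-μ₁ * t) * g t
  have hGc : Continuous G := by fun_prop
  have hGi : IntegrableOn G (Ioi 0) := integrableOn_exp_mul hg hb hμ₁
  have hGb : ∀ t, 0 ≤ t → |G t| ≤ M := by
    intro t ht
    simp only [G]
    rw [abs_mul, Real.abs_exp]
    calc Real.exp (-μ₁ * t) * |g t| ≤ Real.exp (-μ₁ * t) * (M * Real.exp (κ * t)) := by
          gcongr; exact hb t ht
      _ = M * (Real.exp (-μ₁ * t) * Real.exp (κ * t)) := by ring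
      _ = M * Real.exp (-(μ₁ - κ) * t) := by rw [← Real.exp_add]; ring_nf
      _ ≤ M * 1 := by
          gcongr
          rw [Real.exp_le_one_iff]
          nlinarith
      _ = M := mul_one M
  have hexp : ∀ t ∈ Ioi (0 : ℝ), Real.exp (-t) ∈ Icc (0 : ℝ) 1 := fun t ht =>
    ⟨Real.exp_nonneg _, Real.exp_le_one_iff.2 (by linarith [mem_Ioi.1 ht])⟩
  have hbdd : ∀ (φ : ℝ → ℝ) (C : ℝ), AEStronglyMeasurable φ (volume.restrict (Ioi 0)) →
      (∀ t ∈ Ioi (0 : ℝ), |φ t| ≤ C) → IntegrableOn (fun t => φ t * G t) (Ioi 0) :=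
    fun φ C hφ hC => hGi.bdd_mul hφ
      ((ae_restrict_iff' measurableSet_Ioi).2 (ae_of_all _ hC))
  have hpow : ∀ n : ℕ, ∫ t in Ioi 0, Real.exp (-t) ^ n * G t = 0 := by
    intro n
    refine Eq.trans ?_ (h (μ₁ + n) (by simp))
    refine integral_congr_ae (ae_of_all _ fun t => ?_)
    simp only [G]
    rw [← mul_assoc, ← Real.exp_nat_mul, ← Real.exp_add]
    ring_nf
  -- The hypothesis at μ₁ + n is a moment condition in the variable x = e^{-t}, so G is orthogonal
  -- to polynomials in x.
  have hpoly : ∀ p : Polynomial ℝ, ∫ t in Ioi 0, p.eval (Real.exp (-t)) * G t = 0 := by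
    intro p
    simp only [Polynomial.eval_eq_sum_range, Finset.sum_mul]
    rw [integral_finsetSum]
    · refine Finset.sum_eq_zero fun i _ => ?_
      simp only [mul_assoc]
      rw [integral_const_mul, hpow, mul_zero]
    · intro i _
      refine hbdd _ (|p.coeff i|) (by fun_prop) fun t ht => ?_
      rw [abs_mul, abs_pow, Real.abs_exp]
      exact mul_le_of_le_one_right (abs_nonneg _) (pow_le_one₀ (hexp t ht).1 (hexp t ht).2)
  -- The factor x makes the function continuous at 0, where G(-log x) is merely bounded. Weierstrass
  -- approximation of ψ then turns orthogonality to polynomials into ∫ e^{-t}G² = 0.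
  let ψ : ℝ → ℝ := fun x => x * G (-Real.log x)
  have hψc : ContinuousOn ψ (Icc 0 1) := by
    intro x hx
    rcases hx.1.eq_or_lt with rfl | hx0
    · have h0 : ψ 0 = 0 := by simp [ψ]
      rw [ContinuousWithinAt, h0]
      refine squeeze_zero_norm' (a := fun x => x * M) ?_ ?_
      · filter_upwards [self_mem_nhdsWithin] with y hy
        rw [norm_mul, Real.norm_of_nonneg hy.1]
        exact mul_le_mul_of_nonneg_left (hGb _ (by
          have := Real.log_nonpos hy.1 hy.2; linarith)) hy.1
      · have : Continuous fun x : ℝ => x * M := by fun_prop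
        simpa using (this.tendsto 0).mono_left nhdsWithin_le_nhds
    · refine ContinuousAt.continuousWithinAt ?_
      have : ContinuousAt (fun x => -Real.log x) x := (Real.continuousAt_log hx0.ne').neg
      exact continuousAt_id.mul (hGc.continuousAt.comp this)
  have hψ : ∀ t, ψ (Real.exp (-t)) * G t = Real.exp (-t) * (G t) ^ 2 := by
    intro t
    simp only [ψ, Real.log_exp, neg_neg]
    ring
  have hint2 : IntegrableOn (fun t => Real.exp (-t) * (G t) ^ 2) (Ioi 0) := by
    have := hbdd (fun t => Real.exp (-t) * G t) M (by fun_prop) fun t ht => by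
      rw [abs_mul, Real.abs_exp]
      exact (mul_le_of_le_one_left (abs_nonneg _) (hexp t ht).2).trans (hGb t (le_of_lt ht))
    refine this.congr_fun (fun t _ => ?_) measurableSet_Ioi
    simp only
    ring
  have hzero : ∫ t in Ioi 0, Real.exp (-t) * (G t) ^ 2 = 0 := by
    set C := ∫ t in Ioi 0, |G t| with hC
    have hC0 : 0 ≤ C := integral_nonneg fun _ => abs_nonneg _
    refine abs_eq_zero.1 (le_antisymm (le_of_forall_pos_le_add fun ε hε => ?_) (abs_nonneg _))
    obtain ⟨p, hp⟩ := exists_polynomial_near_of_continuousOn 0 1 ψ hψc (ε / (C + 1))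
      (by positivity)
    obtain ⟨K, hK⟩ := (isCompact_Icc.image (p.continuous (R := ℝ))).isBounded.exists_norm_le
      (s := (fun x => p.eval x) '' Icc (0 : ℝ) 1)
    have hpi : IntegrableOn (fun t => p.eval (Real.exp (-t)) * G t) (Ioi 0) :=
      hbdd _ K (by fun_prop) fun t ht => hK _ ⟨_, hexp t ht, rfl⟩
    have h1 : ∫ t in Ioi 0, Real.exp (-t) * (G t) ^ 2 =
        ∫ t in Ioi 0, (Real.exp (-t) * (G t) ^ 2 - p.eval (Real.exp (-t)) * G t) := by
      rw [integral_sub hint2 hpi, hpoly, sub_zero]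
    rw [h1, zero_add, ← Real.norm_eq_abs]
    calc _ ≤ ∫ t in Ioi 0, ε / (C + 1) * |G t| := by
          refine norm_integral_le_of_norm_le (hGi.norm.const_mul _)
            ((ae_restrict_iff' measurableSet_Ioi).2 (ae_of_all _ fun t ht => ?_))
          rw [← hψ, ← sub_mul, norm_mul, Real.norm_eq_abs, Real.norm_eq_abs, abs_sub_comm]
          gcongr
          exact (hp _ (hexp t ht)).le
      _ = ε / (C + 1) * C := by rw [integral_const_mul]
      _ ≤ ε := by
          rw [div_mul_eq_mul_div, div_le_iff₀ (by positivity)]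
          nlinarith
  have hae := (integral_eq_zero_iff_of_nonneg (fun t => by positivity) hint2).1 hzero
  have heq := Measure.eqOn_open_of_ae_eq hae isOpen_Ioi (by fun_prop) (by fun_prop) ht
  simp only [G, Pi.zero_apply, mul_eq_zero, Real.exp_ne_zero, false_or, pow_eq_zero_iff,
    ne_eq, OfNat.ofNat_ne_zero, not_false_eq_true] at heq
  exact heq

variable {E : Type*} [AddCommGroup E] [Module ℝ E] [UniformSpace E]

/-! ### Orbits, growth bounds and Laplace transforms of a C₀-semigroup -/

namespace C0Semigroup

variable (S : C0Semigroup E)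

/-- For s > t one has S(s)f - S(t)f = S(t)(S(s - t)f - f). This one-sided derivative suffices for
the fundamental theorem of calculus, given that orbits are continuous. -/
theorem hasDerivWithinAt_orbit (ℓ : E →L[ℝ] ℝ) {f k : E} (h : S.HasGenerator f k) {t : ℝ}
    (ht : 0 ≤ t) : HasDerivWithinAt (fun t : ℝ => ℓ (S.toFun t.toNNReal f))
      (ℓ (S.toFun t.toNNReal k)) (Ioi t) t := by
  rw [hasDerivWithinAt_iff_tendsto_slope' (by simp)]
  have h1 : Tendsto (fun s : ℝ => (s - t).toNNReal) (𝓝[>] t) (𝓝[>] 0) := by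
    refine tendsto_nhdsWithin_iff.2 ⟨?_, ?_⟩
    · have : Continuous fun s : ℝ => (s - t).toNNReal := by fun_prop
      simpa using (this.tendsto t).mono_left nhdsWithin_le_nhds
    · filter_upwards [self_mem_nhdsWithin] with s hs
      exact Real.toNNReal_pos.2 (sub_pos.2 hs)
  have h2 := ((ℓ.comp (S.toFun t.toNNReal)).continuous.tendsto _).comp (h.comp h1)
  refine h2.congr' ?_
  filter_upwards [self_mem_nhdsWithin] with s hs
  have hs' : t < s := hs
  have h3 : S.toFun s.toNNReal f = S.toFun t.toNNReal (S.toFun (s - t).toNNReal f) := by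
    have := S.map_add' t.toNNReal (s - t).toNNReal
    rw [← Real.toNNReal_add ht (by linarith), add_sub_cancel] at this
    rw [this]; rfl
  simp only [Function.comp, ContinuousLinearMap.comp_apply, slope, vsub_eq_sub, smul_eq_mul,
    map_smul, map_sub, h3]
  rw [Real.coe_toNNReal _ (by linarith)]

theorem ext {S₁ S₂ : C0Semigroup E} (h : S₁.toFun = S₂.toFun) : S₁ = S₂ := by
  cases S₁; cases S₂; cases h; rfl

variable [IsUniformAddGroup E]

/-- This is equicontinuity at 0 of the rescaled semigroup. The exponent is the same for all
functionals; only the neighbourhood depends on ℓ. -/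
theorem exists_nhds_bound : ∃ κ : ℝ, ∀ ℓ : E →L[ℝ] ℝ, ∃ N ∈ 𝓝 (0 : E), ∀ f ∈ N, ∀ t : ℝ≥0,
    |ℓ (S.toFun t f)| ≤ Real.exp (κ * t) := by
  obtain ⟨κ, hκ⟩ := S.equicontinuous'
  refine ⟨κ, fun ℓ => ?_⟩
  have h1 := hκ 0 {p : E × E | |ℓ p.1 - ℓ p.2| < 1} (by
    have := ℓ.uniformContinuous (Metric.dist_mem_uniformity zero_lt_one)
    exact this)
  refine ⟨_, h1, fun f hf t => ?_⟩
  have h2 := hf t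
  simp only [map_zero, smul_zero, zero_sub, abs_neg, map_smul, smul_eq_mul, mem_ofPred_eq] at h2
  rw [abs_mul, Real.abs_exp] at h2
  have h3 : Real.exp (κ * t) * Real.exp (-κ * t) = 1 := by rw [← Real.exp_add]; simp
  nlinarith [Real.exp_pos (κ * t), abs_nonneg (ℓ (S.toFun t f))]


/-- A growth bound for the semigroup. -/
def growth : ℝ := S.exists_nhds_bound.choose

theorem nhds_bound (ℓ : E →L[ℝ] ℝ) : ∃ N ∈ 𝓝 (0 : E), ∀ f ∈ N, ∀ t : ℝ≥0,
    |ℓ (S.toFun t f)| ≤ Real.exp (S.growth * t) := S.exists_nhds_bound.choose_spec ℓ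

theorem orbit_sub_le (ℓ : E →L[ℝ] ℝ) {f : E} {s t : ℝ≥0} (hst : s ≤ t) {ε κ : ℝ}
    (hκ : |S.growth| ≤ κ) (h : ∀ r : ℝ≥0,
      |ℓ (S.toFun r (S.toFun (t - s) f - f))| ≤ ε * Real.exp (S.growth * r)) (hε : 0 ≤ ε) :
    |ℓ (S.toFun t f) - ℓ (S.toFun s f)| ≤ ε * Real.exp (κ * s) := by
  have h1 : S.toFun t f = S.toFun s (S.toFun (t - s) f) := by
    have := S.map_add' s (t - s)
    rw [add_tsub_cancel_of_le hst] at this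
    rw [this]; rfl
  have h2 := h s
  rw [map_sub, map_sub, ← h1] at h2
  refine h2.trans ?_
  gcongr
  exact (le_abs_self _).trans hκ

variable [ContinuousSMul ℝ E]

/-- A small nonzero multiple of f lies in the neighbourhood given by `nhds_bound`. -/
theorem orbit_bound (ℓ : E →L[ℝ] ℝ) (f : E) : ∃ M : ℝ, ∀ t : ℝ≥0,
    |ℓ (S.toFun t f)| ≤ M * Real.exp (S.growth * t) := by
  obtain ⟨N, hN, h⟩ := S.nhds_bound ℓ
  have h1 : Tendsto (fun r : ℝ => r • f) (𝓝[≠] 0) (𝓝 0) := by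
    have : Continuous fun r : ℝ => r • f := by fun_prop
    simpa using (this.tendsto 0).mono_left nhdsWithin_le_nhds
  obtain ⟨r, hr, hr0⟩ := ((h1.eventually hN).and self_mem_nhdsWithin).exists
  refine ⟨|r|⁻¹, fun t => ?_⟩
  have := h _ hr t
  rw [map_smul, map_smul, smul_eq_mul, abs_mul] at this
  rw [← div_eq_inv_mul, le_div_iff₀ (abs_pos.2 hr0)]
  linarith

theorem continuous_orbit (ℓ : E →L[ℝ] ℝ) (f : E) : Continuous fun t : ℝ≥0 => ℓ (S.toFun t f) := by
  rw [continuous_iff_continuousAt]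
  intro t₀
  rw [Metric.continuousAt_iff]
  intro ε hε
  obtain ⟨N, hN, h⟩ := S.nhds_bound ℓ
  set κ := |S.growth|
  -- The difference of two orbit values is at most δe^{κs} with s the earlier time, and s ≤ t₀ + 1
  -- once the two times are within distance 1; this gives ε/2.
  set δ := ε / 2 / Real.exp (κ * (t₀ + 1)) with hδ
  have hδ0 : 0 < δ := by positivity
  have hN' : {g : E | δ⁻¹ • g ∈ N} ∈ 𝓝 (0 : E) := by
    have : Continuous fun g : E => δ⁻¹ • g := by fun_prop
    exact (this.tendsto' 0 0 (by simp)).eventually hN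
  have hS : ∀ᶠ r in 𝓝 (0 : ℝ≥0), S.toFun r f - f ∈ {g : E | δ⁻¹ • g ∈ N} := by
    have h1 : Tendsto (fun r => S.toFun r f - f) (𝓝[>] 0) (𝓝 0) := by
      simpa using (S.tendsto_zero' f).sub_const f
    have h2 := h1.eventually hN'
    rw [eventually_nhdsWithin_iff] at h2
    filter_upwards [h2] with r hr
    rcases eq_or_lt_of_le (zero_le (a := r)) with rfl | hr0
    · rw [S.map_zero']
      simpa using mem_of_mem_nhds hN
    · exact hr hr0
  obtain ⟨η, hη, hball⟩ := Metric.eventually_nhds_iff.1 hS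
  have key : ∀ s t : ℝ≥0, s ≤ t → dist t s < η → (s : ℝ) ≤ t₀ + 1 →
      |ℓ (S.toFun t f) - ℓ (S.toFun s f)| < ε := by
    intro s t hst hd hs
    have h1 : S.toFun (t - s) f - f ∈ {g : E | δ⁻¹ • g ∈ N} := by
      refine hball ?_
      rw [NNReal.dist_eq] at hd ⊢
      rwa [NNReal.coe_sub hst, NNReal.coe_zero, sub_zero]
    have h2 : ∀ r : ℝ≥0, |ℓ (S.toFun r (S.toFun (t - s) f - f))| ≤
        δ * Real.exp (S.growth * r) := by
      intro r
      have := h _ h1 r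
      rw [map_smul, map_smul, smul_eq_mul, abs_mul, abs_of_pos (inv_pos.2 hδ0),
        inv_mul_le_iff₀ hδ0] at this
      exact this
    refine lt_of_le_of_lt (S.orbit_sub_le ℓ hst le_rfl h2 hδ0.le) ?_
    calc δ * Real.exp (κ * s) ≤ δ * Real.exp (κ * (t₀ + 1)) := by gcongr
      _ = ε / 2 := by rw [hδ]; field_simp
      _ < ε := by linarith
  refine ⟨min η 1, by positivity, fun {t} ht => ?_⟩
  rw [lt_min_iff] at ht
  rw [Real.dist_eq]
  rcases le_total t₀ t with hle | hle
  · exact key t₀ t hle ht.1 (by linarith)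
  · rw [abs_sub_comm]
    refine key t t₀ hle (by rw [dist_comm]; exact ht.1) ?_
    have : (t : ℝ) ≤ t₀ := by exact_mod_cast hle
    linarith

theorem continuous_orbit_real (ℓ : E →L[ℝ] ℝ) (f : E) :
    Continuous fun t : ℝ => ℓ (S.toFun t.toNNReal f) :=
  (S.continuous_orbit ℓ f).comp continuous_real_toNNReal

theorem orbit_bound_real (ℓ : E →L[ℝ] ℝ) (f : E) : ∃ M : ℝ, ∀ t : ℝ, 0 ≤ t →
    |ℓ (S.toFun t.toNNReal f)| ≤ M * Real.exp (S.growth * t) := by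
  obtain ⟨M, hM⟩ := S.orbit_bound ℓ f
  refine ⟨M, fun t ht => ?_⟩
  have := hM t.toNNReal
  rwa [Real.coe_toNNReal t ht] at this

theorem integrableOn_orbit (ℓ : E →L[ℝ] ℝ) (f : E) {μ : ℝ} (hμ : S.growth < μ) :
    IntegrableOn (fun t => Real.exp (-μ * t) * ℓ (S.toFun t.toNNReal f)) (Ioi 0) := by
  obtain ⟨M, hM⟩ := S.orbit_bound_real ℓ f
  exact integrableOn_exp_mul (S.continuous_orbit_real ℓ f) hM hμ

/-- The functional `f ↦ ∫₀^∞ e^{-μt} ℓ(S(t) f) dt`. -/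
def laplace (ℓ : E →L[ℝ] ℝ) {μ : ℝ} (hμ : S.growth < μ) : E →L[ℝ] ℝ :=
  LinearMap.clmOfExistsBoundedImage
    { toFun := fun f => ∫ t in Ioi 0, Real.exp (-μ * t) * ℓ (S.toFun t.toNNReal f)
      map_add' := fun f g => by
        rw [← integral_add (S.integrableOn_orbit ℓ f hμ) (S.integrableOn_orbit ℓ g hμ)]
        simp only [map_add, mul_add]
      map_smul' := fun r f => by
        rw [RingHom.id_apply, smul_eq_mul, ← integral_const_mul]
        simp only [map_smul, smul_eq_mul, mul_left_comm] }
    (by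
      obtain ⟨N, hN, h⟩ := S.nhds_bound ℓ
      refine ⟨N, hN, NormedSpace.isVonNBounded_of_isBounded _ ?_⟩
      refine isBounded_iff_forall_norm_le.2 ⟨∫ t in Ioi 0, Real.exp (-(μ - S.growth) * t), ?_⟩
      rintro _ ⟨f, hf, rfl⟩
      refine norm_integral_le_of_norm_le (integrableOn_exp_mul_Ioi (by linarith) 0)
        ((ae_restrict_iff' measurableSet_Ioi).2 (ae_of_all _ fun t ht => ?_))
      rw [norm_mul, Real.norm_of_nonneg (Real.exp_nonneg _)]
      have h1 := h f hf t.toNNReal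
      rw [Real.coe_toNNReal t (le_of_lt ht)] at h1
      calc _ ≤ Real.exp (-μ * t) * Real.exp (S.growth * t) := by gcongr; exact h1
        _ = _ := by rw [← Real.exp_add]; ring_nf)

theorem laplace_apply (ℓ : E →L[ℝ] ℝ) {μ : ℝ} (hμ : S.growth < μ) (f : E) :
    S.laplace ℓ hμ f = ∫ t in Ioi 0, Real.exp (-μ * t) * ℓ (S.toFun t.toNNReal f) := rfl

/-- The right derivative of e^{-μt}ℓ(S(t)f) is -e^{-μt}ℓ(S(t)(μf - k)), and the boundary term at
infinity vanishes because μ exceeds the growth bound. -/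
theorem laplace_generator (ℓ : E →L[ℝ] ℝ) {f k : E} (h : S.HasGenerator f k) {μ : ℝ}
    (hμ : S.growth < μ) : S.laplace ℓ hμ (μ • f - k) = ℓ f := by
  have hd : ∀ t : ℝ, 0 ≤ t → HasDerivWithinAt
      (fun t : ℝ => Real.exp (-μ * t) * ℓ (S.toFun t.toNNReal f))
      (-(Real.exp (-μ * t) * ℓ (S.toFun t.toNNReal (μ • f - k)))) (Ioi t) t := by
    intro t ht
    have h1 : HasDerivAt (fun t : ℝ => Real.exp (-μ * t)) (Real.exp (-μ * t) * -μ) t := by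
      simpa using ((hasDerivAt_id t).const_mul (-μ)).exp
    convert! h1.hasDerivWithinAt.mul (S.hasDerivWithinAt_orbit ℓ h ht) using 1
    simp only [map_sub, map_smul, smul_eq_mul]
    ring
  have hc := S.continuous_orbit_real ℓ f
  have hc' := S.continuous_orbit_real ℓ (μ • f - k)
  have hint : ∀ T : ℝ, 0 ≤ T → ∫ t in (0 : ℝ)..T,
      Real.exp (-μ * t) * ℓ (S.toFun t.toNNReal (μ • f - k)) =
      ℓ f - Real.exp (-μ * T) * ℓ (S.toFun T.toNNReal f) := by
    intro T hT
    have := intervalIntegral.integral_eq_sub_of_hasDeriv_right (a := 0) (b := T)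
      (f := fun t : ℝ => Real.exp (-μ * t) * ℓ (S.toFun t.toNNReal f))
      (f' := fun t => -(Real.exp (-μ * t) * ℓ (S.toFun t.toNNReal (μ • f - k))))
      (((by fun_prop : Continuous fun t : ℝ => Real.exp (-μ * t)).mul hc).continuousOn)
      (fun t ht => hd t (by rw [min_eq_left hT] at ht; exact ht.1.le))
      (((by fun_prop : Continuous fun t : ℝ => Real.exp (-μ * t)).mul hc').neg.intervalIntegrable
        _ _)
    rw [intervalIntegral.integral_neg] at this
    simp only [mul_zero, Real.exp_zero, one_mul, Real.toNNReal_zero, S.map_zero',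
      ContinuousLinearMap.id_apply] at this
    linarith
  have hl1 := intervalIntegral_tendsto_integral_Ioi 0 (S.integrableOn_orbit ℓ (μ • f - k) hμ)
    tendsto_id
  obtain ⟨M, hM⟩ := S.orbit_bound_real ℓ f
  have hl2 : Tendsto (fun T : ℝ => Real.exp (-μ * T) * ℓ (S.toFun T.toNNReal f)) atTop (𝓝 0) := by
    have h0 : Tendsto (fun T : ℝ => M * Real.exp (-((μ - S.growth) * T))) atTop (𝓝 0) := by
      have := (Real.tendsto_exp_neg_atTop_nhds_zero.comp
        (tendsto_id.const_mul_atTop (sub_pos.2 hμ))).const_mul M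
      simpa using this
    refine squeeze_zero_norm' ?_ h0
    filter_upwards [eventually_ge_atTop 0] with T hT
    rw [norm_mul, Real.norm_of_nonneg (Real.exp_nonneg _), Real.norm_eq_abs]
    calc _ ≤ Real.exp (-μ * T) * (M * Real.exp (S.growth * T)) := by gcongr; exact hM T hT
      _ = M * (Real.exp (-μ * T) * Real.exp (S.growth * T)) := by ring
      _ = _ := by rw [← Real.exp_add]; ring_nf
  rw [laplace_apply]
  refine tendsto_nhds_unique hl1 ?_
  have h3 := hl2.const_sub (ℓ f)
  rw [sub_zero] at h3
  refine h3.congr' ?_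
  filter_upwards [eventually_ge_atTop 0] with T hT
  exact (hint T hT).symm

/-- On the range of μ - A both Laplace functionals are determined by A, so their difference
annihilates that range and is zero. Injectivity of the Laplace transform identifies ℓ(S₁(t)f) with
ℓ(S₂(t)f), and functionals separate points. -/
theorem eq_of_generatorExtends [T2Space E] [LocallyConvexSpace ℝ E] {D : Type*} [AddCommGroup D]
    [Module ℝ D] {j A : D →ₗ[ℝ] E} {lam : ℝ}
    (hA : ∀ μ : ℝ, lam ≤ μ → ∀ ℓ : E →L[ℝ] ℝ, (∀ d, ℓ (μ • j d - A d) = 0) → ℓ = 0)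
    {S₁ S₂ : C0Semigroup E} (h₁ : S₁.GeneratorExtends j A) (h₂ : S₂.GeneratorExtends j A) :
    S₁ = S₂ := by
  refine ext ?_
  funext t
  rcases eq_or_lt_of_le (zero_le (a := t)) with rfl | ht
  · rw [S₁.map_zero', S₂.map_zero']
  ext f
  by_contra hne
  obtain ⟨ℓ, hℓ⟩ := geometric_hahn_banach_point_point hne
  set μ₁ := max lam (max S₁.growth S₂.growth + 1) with hμ₁
  have hg1 : S₁.growth < μ₁ := lt_of_lt_of_le (lt_of_le_of_lt (le_max_left _ _) (lt_add_one _))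
    (le_max_right _ _)
  have hg2 : S₂.growth < μ₁ := lt_of_lt_of_le (lt_of_le_of_lt (le_max_right _ _) (lt_add_one _))
    (le_max_right _ _)
  obtain ⟨M₁, hM₁⟩ := S₁.orbit_bound_real ℓ f
  obtain ⟨M₂, hM₂⟩ := S₂.orbit_bound_real ℓ f
  have hlap : ∀ μ, μ₁ ≤ μ → ∫ t in Ioi 0, Real.exp (-μ * t) *
      (ℓ (S₁.toFun t.toNNReal f) - ℓ (S₂.toFun t.toNNReal f)) = 0 := by
    intro μ hμ
    have h0 := hA μ ((le_max_left _ _).trans hμ)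
      (S₁.laplace ℓ (hg1.trans_le hμ) - S₂.laplace ℓ (hg2.trans_le hμ)) (fun d => by
        rw [sub_apply, S₁.laplace_generator ℓ (h₁ d), S₂.laplace_generator ℓ (h₂ d), sub_self])
    have h3 : S₁.laplace ℓ (hg1.trans_le hμ) f - S₂.laplace ℓ (hg2.trans_le hμ) f = 0 := by
      rw [← sub_apply, h0]; rfl
    simp only [mul_sub]
    rw [integral_sub (S₁.integrableOn_orbit ℓ f (hg1.trans_le hμ))
      (S₂.integrableOn_orbit ℓ f (hg2.trans_le hμ))]
    exact h3
  have hM1 : 0 ≤ M₁ := by simpa using (abs_nonneg _).trans (hM₁ 0 le_rfl)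
  have hM2 : 0 ≤ M₂ := by simpa using (abs_nonneg _).trans (hM₂ 0 le_rfl)
  have := eq_zero_of_laplace_eq_zero
    ((S₁.continuous_orbit_real ℓ f).sub (S₂.continuous_orbit_real ℓ f))
    (M := M₁ + M₂) (κ := max S₁.growth S₂.growth) (μ₁ := μ₁) (fun t ht => by
      refine (abs_sub _ _).trans ?_
      rw [add_mul]
      refine add_le_add ((hM₁ t ht).trans ?_) ((hM₂ t ht).trans ?_)
      · gcongr; exact le_max_left _ _
      · gcongr; exact le_max_right _ _) (max_lt hg1 hg2) hlap (NNReal.coe_pos.2 ht)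
  rw [Pi.sub_apply, Real.toNNReal_coe] at this
  exact hℓ.ne (sub_eq_zero.1 this)

end C0Semigroup

end Uniqueness

/-! ### Locally absolutely continuous functions on an interval -/

section Primitive

theorem AbsolutelyContinuousOnInterval.congr {f g : ℝ → ℝ} {x y : ℝ}
    (hf : AbsolutelyContinuousOnInterval f x y) (h : EqOn f g (uIcc x y)) :
    AbsolutelyContinuousOnInterval g x y := by
  rw [absolutelyContinuousOnInterval_iff] at hf ⊢
  intro ε hε
  obtain ⟨δ, hδ, H⟩ := hf ε hε
  refine ⟨δ, hδ, fun E hE hlt => ?_⟩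
  refine lt_of_le_of_lt (le_of_eq (Finset.sum_congr rfl fun i hi => ?_)) (H E hE hlt)
  rw [h (hE.1 i hi).1, h (hE.1 i hi).2]

theorem AbsolutelyContinuousOnInterval.comp_lipschitz {f g : ℝ → ℝ} {x y : ℝ} {K : ℝ≥0}
    (hf : AbsolutelyContinuousOnInterval f x y) (hg : LipschitzOnWith K g (f '' uIcc x y)) :
    AbsolutelyContinuousOnInterval (fun t => g (f t)) x y := by
  rw [absolutelyContinuousOnInterval_iff] at hf ⊢
  intro ε hε
  obtain ⟨δ, hδ, H⟩ := hf (ε / (K + 1)) (by positivity)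
  refine ⟨δ, hδ, fun E hE hlt => ?_⟩
  have h1 := H E hE hlt
  rw [lt_div_iff₀ (by positivity)] at h1
  refine lt_of_le_of_lt ?_ h1
  rw [Finset.sum_mul]
  refine Finset.sum_le_sum fun i hi => ?_
  have h2 := hg.dist_le_mul _ (mem_image_of_mem f (hE.1 i hi).1) _
    (mem_image_of_mem f (hE.1 i hi).2)
  nlinarith [dist_nonneg (x := f (E.2 i).1) (y := f (E.2 i).2)]

theorem IsOpen.exists_mem_lt_lt {I : Set ℝ} (ho : IsOpen I) {x : ℝ} (hx : x ∈ I) :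
    ∃ r ∈ I, ∃ s ∈ I, r < x ∧ x < s := by
  obtain ⟨ε, hε, hb⟩ := Metric.isOpen_iff.1 ho x hx
  have h : |ε / 2| < ε := by rw [abs_of_pos (by positivity)]; linarith
  refine ⟨x - ε / 2, hb ?_, x + ε / 2, hb ?_, by linarith, by linarith⟩ <;>
  · rw [Metric.mem_ball, Real.dist_eq]
    simpa using h

/-- `f` is locally absolutely continuous on `I`, with almost everywhere derivative `f'`. -/
structure IsPrimitiveOn (I : Set ℝ) (f f' : ℝ → ℝ) : Prop where
  ac : ∀ x ∈ I, ∀ y ∈ I, AbsolutelyContinuousOnInterval f x y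
  ae_hasDerivAt : ∀ᵐ x, x ∈ I → HasDerivAt f (f' x) x

namespace IsPrimitiveOn

variable {I : Set ℝ} {f f' g g' : ℝ → ℝ}

theorem congr_deriv (h : IsPrimitiveOn I f f') (he : ∀ᵐ x, x ∈ I → f' x = g' x) :
    IsPrimitiveOn I f g' :=
  ⟨h.ac, by filter_upwards [h.ae_hasDerivAt, he] with x h1 h2 hx using h2 hx ▸ h1 hx⟩

theorem congr_deriv_on (h : IsPrimitiveOn I f f') (he : ∀ x ∈ I, f' x = g' x) :
    IsPrimitiveOn I f g' := h.congr_deriv (ae_of_all _ he)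

theorem add (hf : IsPrimitiveOn I f f') (hg : IsPrimitiveOn I g g') :
    IsPrimitiveOn I (fun x => f x + g x) (fun x => f' x + g' x) :=
  ⟨fun x hx y hy => (hf.ac x hx y hy).add (hg.ac x hx y hy), by
    filter_upwards [hf.ae_hasDerivAt, hg.ae_hasDerivAt] with x h1 h2 hx using (h1 hx).add (h2 hx)⟩

theorem sub (hf : IsPrimitiveOn I f f') (hg : IsPrimitiveOn I g g') :
    IsPrimitiveOn I (fun x => f x - g x) (fun x => f' x - g' x) :=
  ⟨fun x hx y hy => (hf.ac x hx y hy).sub (hg.ac x hx y hy), by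
    filter_upwards [hf.ae_hasDerivAt, hg.ae_hasDerivAt] with x h1 h2 hx using (h1 hx).sub (h2 hx)⟩

theorem mul (hf : IsPrimitiveOn I f f') (hg : IsPrimitiveOn I g g') :
    IsPrimitiveOn I (fun x => f x * g x) (fun x => f' x * g x + f x * g' x) :=
  ⟨fun x hx y hy => (hf.ac x hx y hy).mul (hg.ac x hx y hy), by
    filter_upwards [hf.ae_hasDerivAt, hg.ae_hasDerivAt] with x h1 h2 hx using (h1 hx).mul (h2 hx)⟩

theorem const_mul (hf : IsPrimitiveOn I f f') (r : ℝ) :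
    IsPrimitiveOn I (fun x => r * f x) (fun x => r * f' x) :=
  ⟨fun x hx y hy => (hf.ac x hx y hy).const_mul r, by
    filter_upwards [hf.ae_hasDerivAt] with x h1 hx using (h1 hx).const_mul r⟩

theorem const (I : Set ℝ) (r : ℝ) : IsPrimitiveOn I (fun _ => r) (fun _ => 0) :=
  ⟨fun _ _ _ _ => contDiffOn_const.absolutelyContinuousOnInterval,
    ae_of_all _ fun x _ => hasDerivAt_const x r⟩

theorem of_contDiff (I : Set ℝ) (h : ContDiff ℝ 1 f) : IsPrimitiveOn I f (deriv f) :=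
  ⟨fun _ _ _ _ => h.contDiffOn.absolutelyContinuousOnInterval,
    ae_of_all _ fun x _ => (h.differentiable one_ne_zero x).hasDerivAt⟩

theorem mono {J : Set ℝ} (hf : IsPrimitiveOn I f f') (h : J ⊆ I) : IsPrimitiveOn J f f' :=
  ⟨fun x hx y hy => hf.ac x (h hx) y (h hy), by
    filter_upwards [hf.ae_hasDerivAt] with x h1 hx using h1 (h hx)⟩

theorem continuousOn (hf : IsPrimitiveOn I f f') (ho : IsOpen I) : ContinuousOn f I := by
  intro x hx
  obtain ⟨r, h1, s, h2, hr, hs⟩ := ho.exists_mem_lt_lt hx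
  refine ((hf.ac _ h1 _ h2).continuousOn.continuousAt ?_).continuousWithinAt
  rw [uIcc_of_le (hr.trans hs).le]
  exact Icc_mem_nhds hr hs

variable [hI : I.OrdConnected]

theorem deriv_ae_eq (hf : IsPrimitiveOn I f f') {x y : ℝ} (hx : x ∈ I) (hy : y ∈ I) :
    ∀ᵐ t, t ∈ uIoc x y → deriv f t = f' t := by
  filter_upwards [hf.ae_hasDerivAt] with t ht h
  exact (ht (hI.uIcc_subset hx hy (uIoc_subset_uIcc h))).deriv

theorem intervalIntegrable (hf : IsPrimitiveOn I f f') {x y : ℝ} (hx : x ∈ I) (hy : y ∈ I) :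
    IntervalIntegrable f' volume x y :=
  (hf.ac x hx y hy).intervalIntegrable_deriv.congr_ae
    ((ae_restrict_iff' measurableSet_uIoc).2 (hf.deriv_ae_eq hx hy))

theorem integral_eq (hf : IsPrimitiveOn I f f') {x y : ℝ} (hx : x ∈ I) (hy : y ∈ I) :
    ∫ t in x..y, f' t = f y - f x := by
  rw [← (hf.ac x hx y hy).integral_deriv_eq_sub]
  refine intervalIntegral.integral_congr_ae ?_
  filter_upwards [hf.deriv_ae_eq hx hy] with t ht h using (ht h).symm

theorem comp (hf : IsPrimitiveOn I f f') {U : Set ℝ} (hU : IsOpen U) (hUf : ∀ x ∈ I, f x ∈ U)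
    (hg : ContDiffOn ℝ 1 g U) :
    IsPrimitiveOn I (fun x => g (f x)) (fun x => deriv g (f x) * f' x) := by
  refine ⟨fun x hx y hy => ?_, ?_⟩
  · have hc := (hf.ac x hx y hy).continuousOn
    have hconv : Convex ℝ (f '' uIcc x y) :=
      (((isPreconnected_uIcc).image f hc).ordConnected).convex
    have hsub : f '' uIcc x y ⊆ U := by
      rintro _ ⟨t, ht, rfl⟩
      exact hUf t (hI.uIcc_subset hx hy ht)
    obtain ⟨K, hK⟩ := (hg.mono hsub).exists_lipschitzOnWith one_ne_zero hconv
      (isCompact_uIcc.image_of_continuousOn hc)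
    exact (hf.ac x hx y hy).comp_lipschitz hK
  · filter_upwards [hf.ae_hasDerivAt] with x h1 hx
    have h2 : HasDerivAt g (deriv g (f x)) (f x) :=
      (((hg.contDiffAt (hU.mem_nhds (hUf x hx))).differentiableAt one_ne_zero)).hasDerivAt
    exact h2.comp x (h1 hx)

theorem eq_of_deriv_zero (hf : IsPrimitiveOn I f (fun _ => 0)) {x y : ℝ} (hx : x ∈ I)
    (hy : y ∈ I) : f x = f y := by
  have := hf.integral_eq hx hy
  simp only [intervalIntegral.integral_zero] at this
  linarith

theorem le_of_deriv_nonneg (hf : IsPrimitiveOn I f f') (h : ∀ᵐ x, x ∈ I → 0 ≤ f' x) {x y : ℝ}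
    (hx : x ∈ I) (hy : y ∈ I) (hxy : x ≤ y) : f x ≤ f y := by
  have := hf.integral_eq hx hy
  have h2 : 0 ≤ ∫ t in x..y, f' t := by
    refine intervalIntegral.integral_nonneg_of_ae_restrict hxy ?_
    refine (ae_restrict_iff' measurableSet_Icc).2 ?_
    filter_upwards [h] with t ht h' using ht (hI.out hx hy h')
  linarith

/-- Absolute continuity and Lebesgue differentiation are available on compact intervals; the almost
everywhere statement on I follows because a locally null set is null. -/
theorem of_integral (ho : IsOpen I) {c : ℝ} (hc : c ∈ I)
    (hi : ∀ x ∈ I, ∀ y ∈ I, IntervalIntegrable f' volume x y)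
    (h : ∀ x ∈ I, f x = f c + ∫ t in c..x, f' t) : IsPrimitiveOn I f f' := by
  have hac : ∀ x ∈ I, ∀ z ∈ I, f z - f x = ∫ t in x..z, f' t := by
    intro x hx z hz
    rw [h z hz, h x hx]
    rw [← intervalIntegral.integral_add_adjacent_intervals (hi c hc x hx) (hi x hx z hz)]
    ring
  refine ⟨fun x hx y hy => ?_, ?_⟩
  · have h1 := ((hi x hx y hy).absolutelyContinuousOnInterval_intervalIntegral
      (c := x) left_mem_uIcc).add
      (contDiffOn_const (c := f x) (n := 1)).absolutelyContinuousOnInterval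
    refine h1.congr fun z hz => ?_
    have := hac x hx z (hI.uIcc_subset hx hy hz)
    simp only [Pi.add_apply]
    linarith
  · rw [ae_iff]
    refine measure_null_of_locally_null _ fun x hx => ?_
    simp only [mem_ofPred_eq, Classical.not_imp] at hx
    obtain ⟨r, h1, s, h2, hr, hs⟩ := ho.exists_mem_lt_lt hx.1
    have hn : Ioo r s ∈ 𝓝 x := Ioo_mem_nhds hr hs
    refine ⟨_, inter_mem_nhdsWithin _ hn, ?_⟩
    have h3 := (hi _ h1 _ h2).ae_hasDerivAt_integral
    rw [ae_iff] at h3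
    refine measure_mono_null (fun z hz => ?_) h3
    simp only [mem_inter_iff, mem_ofPred_eq, Classical.not_imp] at hz ⊢
    have hz' : z ∈ uIcc r s := by
      rw [uIcc_of_le (hr.trans hs).le]; exact Ioo_subset_Icc_self hz.2
    refine ⟨hz', fun H => hz.1.2 ?_⟩
    have h4 := (H _ left_mem_uIcc).const_add (f r)
    refine h4.congr_of_eventuallyEq ?_
    filter_upwards [ho.mem_nhds hz.1.1] with y hy
    rw [← hac _ h1 y hy]
    ring

end IsPrimitiveOn

end Primitive

/-! ### The Sturm–Liouville system `u' = p v`, `v' = q u - k` -/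

section SturmLiouville

/-- The standing assumptions on the system `u' = p v`, `v' = q u` on the open interval `I`. -/
structure IsSturmLiouville (I : Set ℝ) (p q : ℝ → ℝ) : Prop where
  isOpen : IsOpen I
  ordConnected : I.OrdConnected
  continuousOn : ContinuousOn p I
  p_pos : ∀ x ∈ I, 0 < p x
  intervalIntegrable : ∀ x ∈ I, ∀ y ∈ I, IntervalIntegrable q volume x y
  q_pos : ∀ᵐ x, x ∈ I → 0 < q x

/-- `(u, v)` solves `u' = p v`, `v' = q u - k` on `I`. -/
structure IsSturmSolution (I : Set ℝ) (p q k u v : ℝ → ℝ) : Prop where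
  fst : IsPrimitiveOn I u (fun x => p x * v x)
  snd : IsPrimitiveOn I v (fun x => q x * u x - k x)

/-- The Picard iterates of the equation `u' = p v`, `v' = q u` with `u(c) = 1`, `v(c) = 0`. -/
def sturmIter (p q : ℝ → ℝ) (c : ℝ) : ℕ → ℝ → ℝ≥0∞
  | 0, _ => 1
  | n + 1, y => ∫⁻ r in uIoc c y, ENNReal.ofReal (p r) *
      ∫⁻ t in uIoc c r, ENNReal.ofReal (q t) * sturmIter p q c n t

/-- The sum of the Picard iterates. -/
def sturmSum (p q : ℝ → ℝ) (c y : ℝ) : ℝ≥0∞ := ∑' n, sturmIter p q c n y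

/-- The function is monotone to the right of c and antitone to its left, so no measurability of f is
needed. -/
theorem measurable_setLIntegral_uIoc (f : ℝ → ℝ≥0∞) (c : ℝ) :
    Measurable fun y => ∫⁻ t in uIoc c y, f t := by
  have h : (fun y => ∫⁻ t in uIoc c y, f t) =
      fun y => if y ∈ Ici c then ∫⁻ t in Ioc c y, f t else ∫⁻ t in Ioc y c, f t := by
    funext y
    split_ifs with hy
    · rw [uIoc_of_le hy]
    · rw [uIoc_of_ge (le_of_lt (not_le.1 hy))]
  rw [h]
  refine Measurable.ite measurableSet_Ici (Monotone.measurable fun x y hxy => ?_)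
    (Antitone.measurable fun x y hxy => ?_)
  · exact lintegral_mono_set (Ioc_subset_Ioc_right hxy)
  · exact lintegral_mono_set (Ioc_subset_Ioc_left hxy)

theorem measurable_sturmIter (p q : ℝ → ℝ) (c : ℝ) (n : ℕ) : Measurable (sturmIter p q c n) := by
  cases n with
  | zero => exact measurable_const
  | succ n => exact measurable_setLIntegral_uIoc _ c

theorem measurable_sturmSum (p q : ℝ → ℝ) (c : ℝ) : Measurable (sturmSum p q c) :=
  Measurable.tsum (measurable_sturmIter p q c)

namespace IsSturmLiouville

variable {I : Set ℝ} {p q : ℝ → ℝ} {c : ℝ}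

theorem uIoc_subset (hS : IsSturmLiouville I p q) {x y : ℝ} (hx : x ∈ I) (hy : y ∈ I) :
    uIoc x y ⊆ I :=
  uIoc_subset_uIcc.trans (hS.ordConnected.uIcc_subset hx hy)

theorem aemeasurable_p (hS : IsSturmLiouville I p q) {x y : ℝ} (hx : x ∈ I) (hy : y ∈ I) :
    AEMeasurable (fun t => ENNReal.ofReal (p t)) (volume.restrict (uIoc x y)) :=
  ((hS.continuousOn.mono (hS.uIoc_subset hx hy)).aemeasurable measurableSet_uIoc).ennreal_ofReal

theorem aemeasurable_q (hS : IsSturmLiouville I p q) {x y : ℝ} (hx : x ∈ I) (hy : y ∈ I) :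
    AEMeasurable (fun t => ENNReal.ofReal (q t)) (volume.restrict (uIoc x y)) :=
  (hS.intervalIntegrable x hx y hy).def'.aemeasurable.ennreal_ofReal

theorem lintegral_q_lt_top (hS : IsSturmLiouville I p q) {x y : ℝ} (hx : x ∈ I) (hy : y ∈ I) :
    ∫⁻ t in uIoc x y, ENNReal.ofReal (q t) < ⊤ :=
  (hS.intervalIntegrable x hx y hy).def'.lintegral_lt_top

/-- All terms are nonnegative, so the series may be summed inside both integrals; the term n = 0
contributes the constant 1. -/
theorem sturmSum_eq (hS : IsSturmLiouville I p q) (hc : c ∈ I) {y : ℝ} (hy : y ∈ I) :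
    sturmSum p q c y = 1 + ∫⁻ r in uIoc c y, ENNReal.ofReal (p r) *
      ∫⁻ t in uIoc c r, ENNReal.ofReal (q t) * sturmSum p q c t := by
  rw [sturmSum, tsum_eq_zero_add' ENNReal.summable]
  congr 1
  simp only [sturmIter]
  rw [← lintegral_tsum (f := fun n r => ENNReal.ofReal (p r) *
    ∫⁻ t in uIoc c r, ENNReal.ofReal (q t) * sturmIter p q c n t) fun n =>
    (hS.aemeasurable_p hc hy).mul (measurable_setLIntegral_uIoc _ c).aemeasurable]
  refine setLIntegral_congr_fun measurableSet_uIoc fun r hr => ?_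
  simp only [ENNReal.tsum_mul_left]
  rw [← lintegral_tsum (f := fun n t => ENNReal.ofReal (q t) * sturmIter p q c n t) fun n =>
    (hS.aemeasurable_q hc (hS.uIoc_subset hc hy hr)).mul
      (measurable_sturmIter p q c n).aemeasurable]
  simp only [ENNReal.tsum_mul_left, sturmSum]

/-- With M a bound for p and Q the integral of q between c and y, induction bounds the n-th iterate
by (MQ|x - c|)ⁿ/n!. The inner integral costs only the factor Q, as q is merely integrable, and the
outer one raises the power of |x - c|. -/
theorem exists_sturmSum_le (hS : IsSturmLiouville I p q) (hc : c ∈ I) {y : ℝ} (hy : y ∈ I) :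
    ∃ C : ℝ, ∀ x ∈ uIcc c y, sturmSum p q c x ≤ ENNReal.ofReal C := by
  have hsub : uIcc c y ⊆ I := hS.ordConnected.uIcc_subset hc hy
  obtain ⟨M, hM⟩ := isCompact_uIcc.exists_bound_of_continuousOn (hS.continuousOn.mono hsub)
  have hM0 : 0 ≤ M := (norm_nonneg _).trans (hM c left_mem_uIcc)
  set Q := ∫⁻ t in uIoc c y, ENNReal.ofReal (q t) with hQ
  have hQt : Q ≠ ⊤ := (hS.lintegral_q_lt_top hc hy).ne
  set K := M * Q.toReal with hK
  have hK0 : 0 ≤ K := mul_nonneg hM0 ENNReal.toReal_nonneg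
  have hmono : ∀ r ∈ uIcc c y, uIoc c r ⊆ uIoc c y := fun r hr t ht => by
    simp only [mem_uIcc, mem_uIoc] at *
    grind
  have hbound : ∀ n, ∀ x ∈ uIcc c y,
      sturmIter p q c n x ≤ ENNReal.ofReal ((K * |x - c|) ^ n / n.factorial) := by
    intro n
    induction n with
    | zero => intro x hx; simp [sturmIter]
    | succ n ih =>
      intro x hx
      have h1 : ∀ r ∈ uIoc c x, ENNReal.ofReal (p r) *
          ∫⁻ t in uIoc c r, ENNReal.ofReal (q t) * sturmIter p q c n t ≤
          ENNReal.ofReal (K ^ (n + 1) / n.factorial * |r - c| ^ n) := by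
        intro r hr
        have hr' : r ∈ uIcc c y := uIoc_subset_uIcc (hmono x hx hr)
        have h2 : ∫⁻ t in uIoc c r, ENNReal.ofReal (q t) * sturmIter p q c n t ≤
            Q * ENNReal.ofReal ((K * |r - c|) ^ n / n.factorial) := by
          rw [hQ, ← lintegral_mul_const' _ _ ENNReal.ofReal_ne_top]
          refine (setLIntegral_mono' measurableSet_uIoc fun t ht => ?_).trans
            (lintegral_mono_set (hmono r hr'))
          refine mul_le_mul_right ((ih t (uIoc_subset_uIcc (hmono r hr' ht))).trans ?_) _
          refine ENNReal.ofReal_le_ofReal ?_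
          have : |t - c| ≤ |r - c| := by
            rw [mem_uIoc] at ht
            rcases ht with ht | ht
            · rw [abs_of_nonneg (by linarith), abs_of_nonneg (by linarith)]; linarith
            · rw [abs_of_nonpos (by linarith), abs_of_nonpos (by linarith)]; linarith
          gcongr
        have h3 : p r ≤ M := (le_abs_self _).trans (hM r hr')
        calc _ ≤ ENNReal.ofReal M * (Q * ENNReal.ofReal ((K * |r - c|) ^ n / n.factorial)) :=
              mul_le_mul' (ENNReal.ofReal_le_ofReal h3) h2
          _ = _ := by
            rw [← ENNReal.ofReal_toReal hQt, ← ENNReal.ofReal_mul ENNReal.toReal_nonneg,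
              ← ENNReal.ofReal_mul hM0]
            congr 1
            rw [hK]
            ring
      have h4 : IntegrableOn (fun r => |r - c| ^ n) (uIoc c x) :=
        (Continuous.intervalIntegrable (by fun_prop) c x).def'
      calc sturmIter p q c (n + 1) x
          ≤ ∫⁻ r in uIoc c x, ENNReal.ofReal (K ^ (n + 1) / n.factorial * |r - c| ^ n) :=
            setLIntegral_mono' measurableSet_uIoc h1
        _ = ENNReal.ofReal (∫ r in uIoc c x, K ^ (n + 1) / n.factorial * |r - c| ^ n) :=
            (ofReal_integral_eq_lintegral_ofReal (h4.const_mul _)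
              (ae_of_all _ fun r => by positivity)).symm
        _ = _ := by
            rw [integral_const_mul, integral_pow_abs_sub_uIoc, Nat.factorial_succ]
            congr 1
            push_cast
            rw [mul_pow K]
            field_simp
  refine ⟨Real.exp (K * |y - c|), fun x hx => ?_⟩
  have h5 : |x - c| ≤ |y - c| := abs_sub_left_of_mem_uIcc hx
  calc sturmSum p q c x ≤ ∑' n : ℕ, ENNReal.ofReal ((K * |y - c|) ^ n / n.factorial) := by
        refine ENNReal.tsum_le_tsum fun n => (hbound n x hx).trans (ENNReal.ofReal_le_ofReal ?_)
        gcongr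
    _ = ENNReal.ofReal (∑' n : ℕ, (K * |y - c|) ^ n / n.factorial) :=
        (ENNReal.ofReal_tsum_of_nonneg (fun n => by positivity)
          (Real.summable_pow_div_factorial _)).symm
    _ = _ := by rw [Real.exp_eq_exp_ℝ, NormedSpace.exp_eq_tsum_div]

/-- The finite sum of the Picard series satisfies the integral equation, which is converted from
extended nonnegative integrals to oriented real ones. -/
theorem exists_solution (hS : IsSturmLiouville I p q) (hc : c ∈ I) :
    ∃ u v : ℝ → ℝ, IsSturmSolution I p q (fun _ => 0) u v ∧ v c = 0 ∧
      ∀ x ∈ I, 1 ≤ u x ∧ ENNReal.ofReal (u x) = sturmSum p q c x := by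
  have := hS.ordConnected
  set u : ℝ → ℝ := fun x => (sturmSum p q c x).toReal with hu
  have hlt : ∀ x ∈ I, sturmSum p q c x ≠ ⊤ := by
    intro x hx
    obtain ⟨C, hC⟩ := hS.exists_sturmSum_le hc hx
    exact ne_top_of_le_ne_top ENNReal.ofReal_ne_top (hC x right_mem_uIcc)
  have huS : ∀ x ∈ I, ENNReal.ofReal (u x) = sturmSum p q c x := fun x hx =>
    ENNReal.ofReal_toReal (hlt x hx)
  have hum : Measurable u := (measurable_sturmSum p q c).ennreal_toReal
  have hu1 : ∀ x ∈ I, 1 ≤ u x := by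
    intro x hx
    rw [← ENNReal.toReal_one]
    refine ENNReal.toReal_mono (hlt x hx) ?_
    rw [hS.sturmSum_eq hc hx]
    exact le_self_add
  have hint : ∀ x ∈ I, IntervalIntegrable (fun t => q t * u t) volume c x := by
    intro x hx
    obtain ⟨C, hC⟩ := hS.exists_sturmSum_le hc hx
    rw [intervalIntegrable_iff]
    refine (hS.intervalIntegrable c hc x hx).def'.mul_bdd (c := max C 0)
      hum.aestronglyMeasurable ?_
    refine (ae_restrict_iff' measurableSet_uIoc).2 (ae_of_all _ fun t ht => ?_)
    rw [Real.norm_of_nonneg ENNReal.toReal_nonneg]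
    have h1 := ENNReal.toReal_mono ENNReal.ofReal_ne_top (hC t (uIoc_subset_uIcc ht))
    rwa [ENNReal.toReal_ofReal'] at h1
  have hint' : ∀ x ∈ I, ∀ y ∈ I, IntervalIntegrable (fun t => q t * u t) volume x y :=
    fun x hx y hy => (hint x hx).symm.trans (hint y hy)
  set v : ℝ → ℝ := fun x => ∫ t in c..x, q t * u t with hv
  have hvp : IsPrimitiveOn I v (fun t => q t * u t) := by
    refine IsPrimitiveOn.of_integral hS.isOpen hc hint' fun x hx => ?_
    simp [hv]
  -- Oriented integrals from c change sign to the left of c, while integrals over `uIoc` do not. The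
  -- sign s reconciles them, and s·v is nonnegative on both sides.
  set s : ℝ → ℝ := fun y => if c ≤ y then 1 else -1 with hs
  have hss : ∀ y, s y * s y = 1 := fun y => by simp only [hs]; split_ifs <;> norm_num
  have hsv : ∀ x, v x = s x * ∫ t in uIoc c x, q t * u t := fun x => by
    simp only [hv, hs, intervalIntegral.intervalIntegral_eq_integral_uIoc, smul_eq_mul]
  have hnn : ∀ x ∈ I, 0 ≤ᵐ[volume.restrict (uIoc c x)] fun t => q t * u t := by
    intro x hx
    refine (ae_restrict_iff' measurableSet_uIoc).2 ?_
    filter_upwards [hS.q_pos] with t ht h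
    exact mul_nonneg (ht (hS.uIoc_subset hc hx h)).le ENNReal.toReal_nonneg
  have hvl : ∀ x ∈ I, ∫⁻ t in uIoc c x, ENNReal.ofReal (q t) * sturmSum p q c t =
      ENNReal.ofReal (s x * v x) := by
    intro x hx
    rw [hsv, ← mul_assoc, hss, one_mul, ofReal_integral_eq_lintegral_ofReal (hint x hx).def'
      (hnn x hx)]
    refine setLIntegral_congr_fun measurableSet_uIoc fun t ht => ?_
    rw [ENNReal.ofReal_mul' ENNReal.toReal_nonneg, huS t (hS.uIoc_subset hc hx ht)]
  have hs0 : ∀ x ∈ I, 0 ≤ s x * v x := fun x hx => by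
    rw [hsv, ← mul_assoc, hss, one_mul]
    exact integral_nonneg_of_ae (hnn x hx)
  have hvc : ContinuousOn v I := hvp.continuousOn hS.isOpen
  have hpv : ∀ x ∈ I, ∀ y ∈ I, IntervalIntegrable (fun t => p t * v t) volume x y :=
    fun x hx y hy => ((hS.continuousOn.mul hvc).mono
      (hS.ordConnected.uIcc_subset hx hy)).intervalIntegrable
  have hse : ∀ y, ∀ r ∈ uIoc c y, s r * v r = s y * v r := by
    intro y r hr
    rcases eq_or_ne r c with rfl | hrc
    · simp [hv]
    congr 1
    rw [mem_uIoc] at hr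
    simp only [hs]
    rcases hr with hr | hr
    · rw [if_pos hr.1.le, if_pos (hr.1.le.trans hr.2)]
    · rw [if_neg (not_le.2 (lt_of_le_of_ne hr.2 hrc)),
        if_neg (not_le.2 (hr.1.trans_le hr.2))]
  have hue : ∀ y ∈ I, u y = 1 + ∫ t in c..y, p t * v t := by
    intro y hy
    have h1 : ∫ t in c..y, p t * v t = ∫ t in uIoc c y, p t * (s t * v t) := by
      rw [intervalIntegral.intervalIntegral_eq_integral_uIoc, smul_eq_mul, ← integral_const_mul]
      refine setIntegral_congr_fun measurableSet_uIoc fun t ht => ?_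
      rw [hse y t ht]
      simp only [hs]
      ring
    have h2 : IntegrableOn (fun t => p t * (s t * v t)) (uIoc c y) := by
      refine IntegrableOn.congr_fun ((hpv c hc y hy).def'.const_mul (s y)) (fun t ht => ?_)
        measurableSet_uIoc
      rw [hse y t ht]
      ring
    have h3 : 0 ≤ᵐ[volume.restrict (uIoc c y)] fun t => p t * (s t * v t) :=
      (ae_restrict_iff' measurableSet_uIoc).2 (ae_of_all _ fun t ht =>
        mul_nonneg (hS.p_pos t (hS.uIoc_subset hc hy ht)).le (hs0 t (hS.uIoc_subset hc hy ht)))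
    have h4 : sturmSum p q c y = 1 + ENNReal.ofReal (∫ t in uIoc c y, p t * (s t * v t)) := by
      rw [hS.sturmSum_eq hc hy, ofReal_integral_eq_lintegral_ofReal h2 h3]
      congr 1
      refine setLIntegral_congr_fun measurableSet_uIoc fun t ht => ?_
      rw [hvl t (hS.uIoc_subset hc hy ht), ENNReal.ofReal_mul
        (hS.p_pos t (hS.uIoc_subset hc hy ht)).le]
    rw [h1]
    simp only [hu]
    rw [h4, ENNReal.toReal_add ENNReal.one_ne_top ENNReal.ofReal_ne_top, ENNReal.toReal_one,
      ENNReal.toReal_ofReal (integral_nonneg_of_ae h3)]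
  refine ⟨u, v, ⟨?_, hvp.congr_deriv_on fun x _ => by simp⟩, by simp [hv], fun x hx =>
    ⟨hu1 x hx, huS x hx⟩⟩
  refine IsPrimitiveOn.of_integral hS.isOpen hc hpv fun x hx => ?_
  rw [hue x hx, hue c hc]
  simp

end IsSturmLiouville

end SturmLiouville

/-! ### Solutions decaying at the two end points -/

section DecayingPair

variable {I : Set ℝ} {p q : ℝ → ℝ} {c : ℝ}

theorem IsPrimitiveOn.lt_of_deriv_pos [hI : I.OrdConnected] {f f' : ℝ → ℝ}
    (hf : IsPrimitiveOn I f f') (h : ∀ᵐ x, x ∈ I → 0 < f' x) {x y : ℝ}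
    (hx : x ∈ I) (hy : y ∈ I) (hxy : x < y) : f x < f y := by
  refine lt_of_le_of_ne (hf.le_of_deriv_nonneg (h.mono fun x hx h => (hx h).le) hx hy hxy.le)
    fun he => ?_
  have h1 := hf.integral_eq hx hy
  rw [he, sub_self, intervalIntegral.integral_of_le hxy.le] at h1
  have h2 : ∀ᵐ t ∂volume.restrict (Ioc x y), 0 < f' t := by
    refine (ae_restrict_iff' measurableSet_Ioc).2 ?_
    filter_upwards [h] with t ht h' using ht (hI.out hx hy (Ioc_subset_Icc_self h'))
  have h3 := (integral_eq_zero_iff_of_nonneg_ae (h2.mono fun t ht => ht.le)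
    ((intervalIntegrable_iff_integrableOn_Ioc_of_le hxy.le).1 (hf.intervalIntegrable hx hy))).1 h1
  have h4 : ∀ᵐ t ∂volume.restrict (Ioc x y), False := by
    filter_upwards [h2, h3] with t h5 h6
    exact h5.ne' h6
  rw [ae_iff] at h4
  simp [not_false_eq_true] at h4
  linarith

/-- A pair of positive solutions `(h₁, v₁)` and `(h₂, v₂)` of the homogeneous Sturm–Liouville
system, the first one decreasing and the second one increasing, with Wronskian `W`. -/
structure IsDecayingPair (I : Set ℝ) (p q : ℝ → ℝ) (W : ℝ) (h₁ v₁ h₂ v₂ : ℝ → ℝ) : Prop where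
  sol₁ : IsSturmSolution I p q (fun _ => 0) h₁ v₁
  sol₂ : IsSturmSolution I p q (fun _ => 0) h₂ v₂
  pos₁ : ∀ x ∈ I, 0 < h₁ x
  pos₂ : ∀ x ∈ I, 0 < h₂ x
  nonpos₁ : ∀ x ∈ I, v₁ x ≤ 0
  nonneg₂ : ∀ x ∈ I, 0 ≤ v₂ x
  W_pos : 0 < W
  wronskian : ∀ x ∈ I, h₁ x * v₂ x - h₂ x * v₁ x = W

namespace IsSturmLiouville

/-- Reduction of order: with u the Picard solution and F' = p/u², every u·(A + BF) is again a
solution. As F is strictly increasing and bounded, subtracting it from its supremum, or its infimum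
from it, produces positive solutions with the required monotonicity. On the side of c where F - F(c)
has the favourable sign they are comparable with u. -/
theorem exists_decayingPair (hS : IsSturmLiouville I p q) (hc : c ∈ I) :
    ∃ W h₁ v₁ h₂ v₂, IsDecayingPair I p q W h₁ v₁ h₂ v₂ ∧ ∃ K : ℝ, 0 < K ∧
      (∀ x ∈ I, c ≤ x → sturmSum p q c x ≤ ENNReal.ofReal (K * h₂ x) ∧
        ENNReal.ofReal (h₂ x) ≤ ENNReal.ofReal K * sturmSum p q c x) ∧
      (∀ x ∈ I, x ≤ c → sturmSum p q c x ≤ ENNReal.ofReal (K * h₁ x) ∧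
        ENNReal.ofReal (h₁ x) ≤ ENNReal.ofReal K * sturmSum p q c x) := by
  have hord := hS.ordConnected
  obtain ⟨u, v, hsol, hvc, hu⟩ := hS.exists_solution hc
  have hu0 : ∀ x ∈ I, 0 < u x := fun x hx => zero_lt_one.trans_le (hu x hx).1
  have hcu : ContinuousOn u I := hsol.fst.continuousOn hS.isOpen
  have hvlt : ∀ x ∈ I, ∀ y ∈ I, x < y → v x < v y := fun x hx y hy =>
    hsol.snd.lt_of_deriv_pos (by
      filter_upwards [hS.q_pos] with t ht h
      rw [sub_zero]
      exact mul_pos (ht h) (hu0 t h)) hx hy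
  have hvle : ∀ x ∈ I, ∀ y ∈ I, x ≤ y → v x ≤ v y := fun x hx y hy hxy =>
    hxy.eq_or_lt.elim (fun h => h ▸ le_rfl) fun h => (hvlt x hx y hy h).le
  have hcd : ContinuousOn (fun x => p x / u x ^ 2) I :=
    hS.continuousOn.div (hcu.pow 2) fun x hx => (pow_pos (hu0 x hx) 2).ne'
  set F : ℝ → ℝ := fun x => ∫ t in c..x, p t / u t ^ 2 with hF
  have hFp : IsPrimitiveOn I F (fun x => p x / u x ^ 2) :=
    IsPrimitiveOn.of_integral hS.isOpen hc (fun x hx y hy =>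
      (hcd.mono (hord.uIcc_subset hx hy)).intervalIntegrable) fun x hx => by simp [hF]
  have hFlt : ∀ x ∈ I, ∀ y ∈ I, x < y → F x < F y := fun x hx y hy =>
    hFp.lt_of_deriv_pos (ae_of_all _ fun t ht =>
      div_pos (hS.p_pos t ht) (pow_pos (hu0 t ht) 2)) hx hy
  have hFle : ∀ x ∈ I, ∀ y ∈ I, x ≤ y → F x ≤ F y := fun x hx y hy hxy =>
    hxy.eq_or_lt.elim (fun h => h ▸ le_rfl) fun h => (hFlt x hx y hy h).le
  have hinv : IsPrimitiveOn I (fun x => (u x)⁻¹) (fun x => -(p x * v x / u x ^ 2)) := by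
    have := hsol.fst.comp (g := fun t => t⁻¹) (U := Ioi 0) isOpen_Ioi hu0
      (contDiffOn_inv ℝ |>.mono fun t ht => ne_of_gt ht)
    refine this.congr_deriv_on fun x hx => ?_
    rw [deriv_inv]
    ring
  have hFc : F c = 0 := by simp [hF]
  -- bounds for `F` at the two end points
  have hA : ∀ x ∈ I, 0 < v x → ∀ y ∈ I, v x * (F y - F x) ≤ (u x)⁻¹ := by
    intro x hx hvx y hy
    rcases le_total y x with hyx | hxy
    · have := hFle y hy x hx hyx
      have := inv_pos.2 (hu0 x hx)
      nlinarith
    -- The derivative is (v(t) - v(x))p/u², nonnegative to the right of x because v is increasing.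
    -- Thus the variation of 1/u controls that of F.
    have hJ : IsPrimitiveOn (I ∩ Ici x) (fun t => -1 * (u t)⁻¹ - v x * F t)
        (fun t => -1 * -(p t * v t / u t ^ 2) - v x * (p t / u t ^ 2)) :=
      ((hinv.const_mul (-1)).sub (hFp.const_mul (v x))).mono inter_subset_left
    have := hJ.le_of_deriv_nonneg (ae_of_all _ fun t ht => by
      have h1 := hvle x hx t ht.1 ht.2
      have h2 := div_pos (hS.p_pos t ht.1) (pow_pos (hu0 t ht.1) 2)
      have h3 : -1 * -(p t * v t / u t ^ 2) - v x * (p t / u t ^ 2) =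
        (v t - v x) * (p t / u t ^ 2) := by ring
      rw [h3]
      exact mul_nonneg (sub_nonneg.2 h1) h2.le) (x := x) (y := y) ⟨hx, le_refl x⟩ ⟨hy, hxy⟩ hxy
    have := inv_pos.2 (hu0 y hy)
    linarith
  have hB : ∀ x ∈ I, v x < 0 → ∀ y ∈ I, -v x * (F x - F y) ≤ (u x)⁻¹ := by
    intro x hx hvx y hy
    rcases le_total x y with hyx | hxy
    · have := hFle x hx y hy hyx
      have := inv_pos.2 (hu0 x hx)
      nlinarith
    have hJ : IsPrimitiveOn (I ∩ Iic x) (fun t => (u t)⁻¹ - (-v x) * F t)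
        (fun t => -(p t * v t / u t ^ 2) - (-v x) * (p t / u t ^ 2)) :=
      (hinv.sub (hFp.const_mul (-v x))).mono inter_subset_left
    have := hJ.le_of_deriv_nonneg (ae_of_all _ fun t ht => by
      have h1 := hvle t ht.1 x hx ht.2
      have h2 := div_pos (hS.p_pos t ht.1) (pow_pos (hu0 t ht.1) 2)
      have h3 : -(p t * v t / u t ^ 2) - (-v x) * (p t / u t ^ 2) =
        (v x - v t) * (p t / u t ^ 2) := by ring
      rw [h3]
      exact mul_nonneg (sub_nonneg.2 h1) h2.le) (x := y) (y := x) ⟨hy, hxy⟩ ⟨hx, le_refl x⟩ hxy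
    have := inv_pos.2 (hu0 y hy)
    linarith
  -- At c itself v vanishes, so the bounds on F are taken at points on either side, where v has a
  -- strict sign.
  obtain ⟨r, hr, s, hs, hrc, hcs⟩ := hS.isOpen.exists_mem_lt_lt hc
  have hvs : 0 < v s := hvc ▸ hvlt c hc s hs hcs
  have hvr : v r < 0 := hvc ▸ hvlt r hr c hc hrc
  have hbA : BddAbove (F '' I) := by
    refine ⟨F s + (v s)⁻¹ * (u s)⁻¹, ?_⟩
    rintro _ ⟨y, hy, rfl⟩
    have := hA s hs hvs y hy
    rw [mul_comm, ← le_div_iff₀ hvs, div_eq_inv_mul] at this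
    linarith
  have hbB : BddBelow (F '' I) := by
    refine ⟨F r - (-v r)⁻¹ * (u r)⁻¹, ?_⟩
    rintro _ ⟨y, hy, rfl⟩
    have := hB r hr hvr y hy
    rw [mul_comm, ← le_div_iff₀ (neg_pos.2 hvr), div_eq_inv_mul] at this
    linarith
  set κ₁ := sSup (F '' I) with hκ₁
  set κ₂ := -sInf (F '' I) with hκ₂
  have hF1 : ∀ x ∈ I, F x < κ₁ := by
    intro x hx
    obtain ⟨_, _, y, hy, _, hxy⟩ := hS.isOpen.exists_mem_lt_lt hx
    exact (hFlt x hx y hy hxy).trans_le (le_csSup hbA ⟨y, hy, rfl⟩)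
  have hF2 : ∀ x ∈ I, 0 < κ₂ + F x := by
    intro x hx
    obtain ⟨y, hy, _, _, hxy, _⟩ := hS.isOpen.exists_mem_lt_lt hx
    have h1 := hFlt y hy x hx hxy
    have h2 : sInf (F '' I) ≤ F y := csInf_le hbB ⟨y, hy, rfl⟩
    rw [hκ₂]
    linarith
  have hκ₁0 : 0 < κ₁ := hFc ▸ hF1 c hc
  have hκ₂0 : 0 < κ₂ := by simpa [hFc] using hF2 c hc
  have hG1 : IsPrimitiveOn I (fun x => κ₁ - F x) (fun x => 0 - p x / u x ^ 2) :=
    (IsPrimitiveOn.const I κ₁).sub hFp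
  have hG2 : IsPrimitiveOn I (fun x => κ₂ + F x) (fun x => 0 + p x / u x ^ 2) :=
    (IsPrimitiveOn.const I κ₂).add hFp
  have hne : (F '' I).Nonempty := ⟨F c, c, hc, rfl⟩
  -- In the Wronskian the terms with v cancel and (κ₁ - F) + (κ₂ + F) remains. As F(c) = 0, one has
  -- κ₂u ≤ h₂ ≤ (κ₁ + κ₂)u to the right of c and κ₁u ≤ h₁ ≤ (κ₁ + κ₂)u to the left, whence the
  -- comparison constant.
  refine ⟨κ₁ + κ₂, fun x => u x * (κ₁ - F x), fun x => v x * (κ₁ - F x) - (u x)⁻¹,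
    fun x => u x * (κ₂ + F x), fun x => v x * (κ₂ + F x) + (u x)⁻¹,
    ⟨⟨(hsol.fst.mul hG1).congr_deriv_on fun x hx => ?_,
      ((hsol.snd.mul hG1).sub hinv).congr_deriv_on fun x hx => ?_⟩,
     ⟨(hsol.fst.mul hG2).congr_deriv_on fun x hx => ?_,
      ((hsol.snd.mul hG2).add hinv).congr_deriv_on fun x hx => ?_⟩,
     fun x hx => mul_pos (hu0 x hx) (sub_pos.2 (hF1 x hx)),
     fun x hx => mul_pos (hu0 x hx) (hF2 x hx), fun x hx => ?_, fun x hx => ?_,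
     add_pos hκ₁0 hκ₂0, fun x hx => ?_⟩, max (κ₁ + κ₂) (max κ₁⁻¹ κ₂⁻¹), ?_, fun x hx hcx => ?_,
     fun x hx hcx => ?_⟩
  · have := (hu0 x hx).ne'
    field_simp
    ring
  · have := (hu0 x hx).ne'
    field_simp
    ring
  · have := (hu0 x hx).ne'
    field_simp
    ring
  · have := (hu0 x hx).ne'
    field_simp
    ring
  · have h0 := inv_pos.2 (hu0 x hx)
    rcases le_or_gt (v x) 0 with hv | hv
    · have := hF1 x hx
      nlinarith
    -- Taking the supremum over y in `hA` gives v(κ₁ - F) ≤ 1/u, which is precisely v₁ ≤ 0.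
    · have h1 : κ₁ ≤ F x + (v x)⁻¹ * (u x)⁻¹ := by
        refine csSup_le hne ?_
        rintro _ ⟨y, hy, rfl⟩
        have := hA x hx hv y hy
        rw [mul_comm, ← le_div_iff₀ hv, div_eq_inv_mul] at this
        linarith
      have h2 : v x * (κ₁ - F x) ≤ v x * ((v x)⁻¹ * (u x)⁻¹) :=
        mul_le_mul_of_nonneg_left (by linarith) hv.le
      rw [mul_inv_cancel_left₀ hv.ne'] at h2
      linarith
  · have h0 := inv_pos.2 (hu0 x hx)
    rcases le_or_gt 0 (v x) with hv | hv
    · have := hF2 x hx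
      positivity
    · have hv' := neg_pos.2 hv
      have h1 : F x - (-v x)⁻¹ * (u x)⁻¹ ≤ -κ₂ := by
        rw [hκ₂, neg_neg]
        refine le_csInf hne ?_
        rintro _ ⟨y, hy, rfl⟩
        have := hB x hx hv y hy
        rw [mul_comm, ← le_div_iff₀ hv', div_eq_inv_mul] at this
        linarith
      have h2 : -v x * (κ₂ + F x) ≤ -v x * ((-v x)⁻¹ * (u x)⁻¹) :=
        mul_le_mul_of_nonneg_left (by linarith) hv'.le
      rw [mul_inv_cancel_left₀ hv'.ne'] at h2
      linarith
  · have := (hu0 x hx).ne'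
    field_simp
    ring
  · positivity
  · rw [← (hu x hx).2]
    have hFx : 0 ≤ F x := hFc ▸ hFle c hc x hx hcx
    have h1 := hF1 x hx
    have h2 := hu0 x hx
    have hm : κ₂⁻¹ ≤ max (κ₁ + κ₂) (max κ₁⁻¹ κ₂⁻¹) := (le_max_right _ _).trans (le_max_right _ _)
    refine ⟨ENNReal.ofReal_le_ofReal ?_, ?_⟩
    · calc u x = κ₂⁻¹ * (u x * κ₂) := by field_simp
        _ ≤ max (κ₁ + κ₂) (max κ₁⁻¹ κ₂⁻¹) * (u x * (κ₂ + F x)) := by gcongr; linarith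
    · rw [← ENNReal.ofReal_mul (by positivity)]
      refine ENNReal.ofReal_le_ofReal ?_
      refine (mul_le_mul_of_nonneg_left (le_trans ?_ (le_max_left _ _)) h2.le).trans_eq
        (mul_comm _ _)
      linarith
  · rw [← (hu x hx).2]
    have hFx : F x ≤ 0 := hFc ▸ hFle x hx c hc hcx
    have h1 := hF2 x hx
    have h2 := hu0 x hx
    have hm : κ₁⁻¹ ≤ max (κ₁ + κ₂) (max κ₁⁻¹ κ₂⁻¹) := (le_max_left _ _).trans (le_max_right _ _)
    refine ⟨ENNReal.ofReal_le_ofReal ?_, ?_⟩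
    · calc u x = κ₁⁻¹ * (u x * κ₁) := by field_simp
        _ ≤ max (κ₁ + κ₂) (max κ₁⁻¹ κ₂⁻¹) * (u x * (κ₁ - F x)) := by gcongr; linarith
    · rw [← ENNReal.ofReal_mul (by positivity)]
      refine ENNReal.ofReal_le_ofReal ?_
      refine (mul_le_mul_of_nonneg_left (le_trans ?_ (le_max_left _ _)) h2.le).trans_eq
        (mul_comm _ _)
      linarith

end IsSturmLiouville

end DecayingPair

/-! ### Weighted measures on an open interval -/

section Weight

/-- The measure `ρ dx` on `I`. -/
def weightMeasure (I : Set ℝ) (ρ : ℝ → ℝ) : Measure ℝ :=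
  (volume.restrict I).withDensity fun x => ENNReal.ofReal (ρ x)

instance (I : Set ℝ) (ρ : ℝ → ℝ) : SigmaFinite (weightMeasure I ρ) :=
  inferInstanceAs (SigmaFinite ((volume.restrict I).withDensity fun x => ENNReal.ofReal (ρ x)))

variable {I : Set ℝ}

theorem locallyIntegrableOn_of_intervalIntegrable {f : ℝ → ℝ} (ho : IsOpen I)
    (h : ∀ x ∈ I, ∀ y ∈ I, IntervalIntegrable f volume x y) : LocallyIntegrableOn f I := by
  intro x hx
  obtain ⟨r, hr, s, hs, hrx, hxs⟩ := ho.exists_mem_lt_lt hx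
  refine ⟨Ioc r s, mem_nhdsWithin_of_mem_nhds (Ioc_mem_nhds hrx hxs), ?_⟩
  exact (intervalIntegrable_iff_integrableOn_Ioc_of_le (hrx.trans hxs).le).1 (h r hr s hs)

/-- Running maxima and minima of an enumeration of the rational points of I form the end points,
which treats finite and infinite ends alike. -/
theorem IsOpen.exists_exhaustion (ho : IsOpen I) (hne : I.Nonempty) :
    ∃ r s : ℕ → ℝ, Antitone r ∧ Monotone s ∧ (∀ n, r n ∈ I ∧ s n ∈ I) ∧
      ∀ x ∈ I, ∃ n, r n < x ∧ x < s n := by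
  set D : Set ℝ := I ∩ range ((↑) : ℚ → ℝ)
  have hD : D.Countable := (countable_range _).mono inter_subset_right
  have hlt : ∀ x ∈ I, (∃ d ∈ D, d < x) ∧ ∃ d ∈ D, x < d := by
    intro x hx
    obtain ⟨ε, hε, hb⟩ := Metric.isOpen_iff.1 ho x hx
    constructor
    · obtain ⟨d, h1, h2⟩ := exists_rat_btwn (show x - ε < x by linarith)
      refine ⟨d, ⟨hb ?_, d, rfl⟩, h2⟩
      rw [Metric.mem_ball, Real.dist_eq, abs_lt]
      constructor <;> linarith
    · obtain ⟨d, h1, h2⟩ := exists_rat_btwn (show x < x + ε by linarith)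
      refine ⟨d, ⟨hb ?_, d, rfl⟩, h1⟩
      rw [Metric.mem_ball, Real.dist_eq, abs_lt]
      constructor <;> linarith
  obtain ⟨x, hx⟩ := hne
  obtain ⟨e, he⟩ := hD.exists_eq_range ⟨_, (hlt x hx).2.choose_spec.1⟩
  have heI : ∀ n, e n ∈ I := fun n => (he.symm ▸ mem_range_self n : e n ∈ D).1
  have hs : ∀ n, partialSups e n ∈ I := by
    intro n
    induction n with
    | zero => simpa using heI 0
    | succ n ih =>
      rw [partialSups_add_one]
      rcases max_choice (partialSups e n) (e (n + 1)) with h | h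
      · exact (congrArg (· ∈ I) h).mpr ih
      · exact (congrArg (· ∈ I) h).mpr (heI _)
  have hr : ∀ n, -partialSups (fun k => -e k) n ∈ I := by
    intro n
    induction n with
    | zero => simpa using heI 0
    | succ n ih =>
      rw [partialSups_add_one]
      rcases max_choice (partialSups (fun k => -e k) n) (-e (n + 1)) with h | h
      · exact (congrArg (-· ∈ I) h).mpr ih
      · exact (congrArg (-· ∈ I) h).mpr (by simpa using heI (n + 1))
  refine ⟨fun n => -partialSups (fun k => -e k) n, partialSups e,
    fun m n h => neg_le_neg ((partialSups (fun k => -e k)).monotone h), (partialSups e).monotone,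
    fun n => ⟨hr n, hs n⟩, fun x hx => ?_⟩
  obtain ⟨⟨d, hd, hdx⟩, d', hd', hxd'⟩ := hlt x hx
  rw [he] at hd hd'
  obtain ⟨k, rfl⟩ := hd
  obtain ⟨l, rfl⟩ := hd'
  refine ⟨max k l, ?_, ?_⟩
  · have : -e k ≤ partialSups (fun k => -e k) (max k l) :=
      le_partialSups_of_le (fun k => -e k) (le_max_left _ _)
    linarith
  · exact hxd'.trans_le (le_partialSups_of_le e (le_max_right _ _))

theorem setLIntegral_inter_Ioi_le (ho : IsOpen I) {f : ℝ → ℝ≥0∞} {C : ℝ≥0∞}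
    {x : ℝ} (hx : x ∈ I) (h : ∀ y ∈ I, ∫⁻ t in Ioc x y, f t ≤ C) :
    ∫⁻ t in I ∩ Ioi x, f t ≤ C := by
  obtain ⟨r, s, -, hs, hrs, hex⟩ := ho.exists_exhaustion ⟨x, hx⟩
  have h1 : I ∩ Ioi x ⊆ ⋃ n, Ioc x (s n) := fun t ht => by
    obtain ⟨n, -, hn⟩ := hex t ht.1
    exact mem_iUnion.2 ⟨n, ht.2, hn.le⟩
  refine (lintegral_mono_set h1).trans ?_
  rw [setLIntegral_iUnion_of_directed _
    (Monotone.directed_le fun m n hmn => Ioc_subset_Ioc_right (hs hmn))]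
  exact iSup_le fun n => h _ (hrs n).2

theorem setLIntegral_inter_Iic_le (ho : IsOpen I) {f : ℝ → ℝ≥0∞} {C : ℝ≥0∞}
    {x : ℝ} (hx : x ∈ I) (h : ∀ y ∈ I, ∫⁻ t in Ioc y x, f t ≤ C) :
    ∫⁻ t in I ∩ Iic x, f t ≤ C := by
  obtain ⟨r, s, hr, -, hrs, hex⟩ := ho.exists_exhaustion ⟨x, hx⟩
  have h1 : I ∩ Iic x ⊆ ⋃ n, Ioc (r n) x := fun t ht => by
    obtain ⟨n, hn, -⟩ := hex t ht.1
    exact mem_iUnion.2 ⟨n, hn, ht.2⟩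
  refine (lintegral_mono_set h1).trans ?_
  rw [setLIntegral_iUnion_of_directed _
    (Monotone.directed_le fun m n hmn => Ioc_subset_Ioc_left (hr hmn))]
  exact iSup_le fun n => h _ (hrs n).1

/-- Integrals over an exhaustion converge to the integral over I, and the intervals of the
exhaustion eventually contain [r₀, s₀]. Closed conditions thus need only be checked on large compact
intervals, where boundary terms can be controlled. -/
theorem setIntegral_mem_of_isClosed (ho : IsOpen I) [hI : I.OrdConnected] {f : ℝ → ℝ}
    (hf : IntegrableOn f I) {r₀ s₀ : ℝ} (hr₀ : r₀ ∈ I) (hs₀ : s₀ ∈ I) {T : Set ℝ}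
    (hT : IsClosed T) (h : ∀ r ∈ I, r ≤ r₀ → ∀ s ∈ I, s₀ ≤ s → r ≤ s → ∫ t in r..s, f t ∈ T) :
    ∫ t in I, f t ∈ T := by
  obtain ⟨r, s, hr, hs, hrs, hex⟩ := ho.exists_exhaustion ⟨r₀, hr₀⟩
  have hU : ⋃ n, Ioc (r n) (s n) = I := by
    refine subset_antisymm (iUnion_subset fun n => ?_) fun x hx => ?_
    · exact Ioc_subset_Icc_self.trans (hI.out (hrs n).1 (hrs n).2)
    · obtain ⟨n, h1, h2⟩ := hex x hx
      exact mem_iUnion.2 ⟨n, h1, h2.le⟩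
  have hlim := tendsto_setIntegral_of_monotone (μ := volume) (f := f)
    (s := fun n => Ioc (r n) (s n)) (fun n => measurableSet_Ioc)
    (fun m n hmn => Ioc_subset_Ioc (hr hmn) (hs hmn)) (by rwa [hU])
  rw [hU] at hlim
  refine hT.mem_of_tendsto hlim ?_
  obtain ⟨n₁, h1, h2⟩ := hex r₀ hr₀
  obtain ⟨n₂, h3, h4⟩ := hex s₀ hs₀
  filter_upwards [eventually_ge_atTop (max n₁ n₂)] with n hn
  have hn1 := (le_max_left _ _).trans hn
  have hn2 := (le_max_right _ _).trans hn
  have h5 : r n ≤ s n := (hr hn1).trans (h1.le.trans (h2.le.trans (hs hn1)))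
  have := h (r n) (hrs n).1 ((hr hn1).trans h1.le) (s n) (hrs n).2 (h4.le.trans (hs hn2)) h5
  rwa [intervalIntegral.integral_of_le h5] at this

/-- The standing assumptions on a weight on an open interval. -/
structure IsWeight (I : Set ℝ) (ρ : ℝ → ℝ) : Prop where
  isOpen : IsOpen I
  ordConnected : I.OrdConnected
  pos : ∀ᵐ x, x ∈ I → 0 < ρ x
  intervalIntegrable : ∀ x ∈ I, ∀ y ∈ I, IntervalIntegrable ρ volume x y

namespace IsWeight

variable {ρ : ℝ → ℝ}

theorem aestronglyMeasurable (h : IsWeight I ρ) :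
    AEStronglyMeasurable ρ (volume.restrict I) :=
  (locallyIntegrableOn_of_intervalIntegrable h.isOpen h.intervalIntegrable).aestronglyMeasurable

theorem ae_restrict_pos (h : IsWeight I ρ) : ∀ᵐ x ∂volume.restrict I, 0 < ρ x :=
  (ae_restrict_iff' h.isOpen.measurableSet).2 h.pos

theorem ae_iff (h : IsWeight I ρ) {P : ℝ → Prop} :
    (∀ᵐ x ∂weightMeasure I ρ, P x) ↔ ∀ᵐ x, x ∈ I → P x := by
  rw [weightMeasure, ae_withDensity_iff' h.aestronglyMeasurable.aemeasurable.ennreal_ofReal,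
    ae_restrict_iff' h.isOpen.measurableSet]
  refine eventually_congr ?_
  filter_upwards [h.pos] with x hx
  refine imp_congr_right fun hI => ?_
  simp [hx hI]

theorem absolutelyContinuous (h : IsWeight I ρ) : volume.restrict I ≪ weightMeasure I ρ :=
  withDensity_absolutelyContinuous' h.aestronglyMeasurable.aemeasurable.ennreal_ofReal
    (h.ae_restrict_pos.mono fun x hx => by simpa using hx)

theorem absolutelyContinuous' : weightMeasure I ρ ≪ volume.restrict I :=
  withDensity_absolutelyContinuous _ _

theorem integrable_iff (h : IsWeight I ρ) {g : ℝ → ℝ} :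
    Integrable g (weightMeasure I ρ) ↔ IntegrableOn (fun x => ρ x * g x) I := by
  rw [weightMeasure, integrable_withDensity_iff_integrable_smul₀'
    h.aestronglyMeasurable.aemeasurable.ennreal_ofReal (ae_of_all _ fun x => ENNReal.ofReal_lt_top)]
  refine integrable_congr ?_
  filter_upwards [h.ae_restrict_pos] with x hx
  rw [ENNReal.toReal_ofReal hx.le, smul_eq_mul]

theorem integral_eq (h : IsWeight I ρ) (g : ℝ → ℝ) :
    ∫ x, g x ∂weightMeasure I ρ = ∫ x in I, ρ x * g x := by
  rw [weightMeasure, integral_withDensity_eq_integral_toReal_smul₀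
    h.aestronglyMeasurable.aemeasurable.ennreal_ofReal (ae_of_all _ fun x => ENNReal.ofReal_lt_top)]
  refine integral_congr_ae ?_
  filter_upwards [h.ae_restrict_pos] with x hx
  rw [ENNReal.toReal_ofReal hx.le, smul_eq_mul]

theorem intervalIntegrable_of_integrable (h : IsWeight I ρ) {g : ℝ → ℝ}
    (hg : Integrable g (weightMeasure I ρ)) {x y : ℝ} (hx : x ∈ I) (hy : y ∈ I) :
    IntervalIntegrable (fun t => ρ t * g t) volume x y :=
  intervalIntegrable_iff.2 ((h.integrable_iff.1 hg).mono_set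
    (uIoc_subset_uIcc.trans (h.ordConnected.uIcc_subset hx hy)))

end IsWeight

end Weight

/-! ### Solutions of the inhomogeneous system which decay at the end points -/

section DecayingSolution

variable {I : Set ℝ} {p q ρ h₁ v₁ h₂ v₂ k k' u u' v v' : ℝ → ℝ} {lam W : ℝ}

namespace IsSturmSolution

theorem add (h : IsSturmSolution I p q k u v) (h' : IsSturmSolution I p q k' u' v') :
    IsSturmSolution I p q (fun x => k x + k' x) (fun x => u x + u' x) (fun x => v x + v' x) :=
  ⟨(h.fst.add h'.fst).congr_deriv_on fun x _ => by ring,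
    (h.snd.add h'.snd).congr_deriv_on fun x _ => by ring⟩

theorem const_mul (h : IsSturmSolution I p q k u v) (r : ℝ) :
    IsSturmSolution I p q (fun x => r * k x) (fun x => r * u x) (fun x => r * v x) :=
  ⟨(h.fst.const_mul r).congr_deriv_on fun x _ => by ring,
    (h.snd.const_mul r).congr_deriv_on fun x _ => by ring⟩

/-- Green's identity. -/
theorem wronskian (h : IsSturmSolution I p q k u v) (h' : IsSturmSolution I p q k' u' v') :
    IsPrimitiveOn I (fun x => u x * v' x - v x * u' x) (fun x => k x * u' x - u x * k' x) :=
  ((h.fst.mul h'.snd).sub (h.snd.mul h'.fst)).congr_deriv_on fun x _ => by ring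

end IsSturmSolution

/-- `(u, v)` solves the inhomogeneous system and is a multiple of `(h₁, v₁)`, respectively
`(h₂, v₂)`, near the right, respectively left, end point. -/
structure IsDecayingSolution (I : Set ℝ) (p q h₁ v₁ h₂ v₂ k u v : ℝ → ℝ) : Prop where
  sol : IsSturmSolution I p q k u v
  right : ∃ s ∈ I, ∃ C : ℝ, ∀ x ∈ I, s ≤ x → u x = C * h₁ x ∧ v x = C * v₁ x
  left : ∃ r ∈ I, ∃ C : ℝ, ∀ x ∈ I, x ≤ r → u x = C * h₂ x ∧ v x = C * v₂ x

namespace IsDecayingSolution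

theorem add (h : IsDecayingSolution I p q h₁ v₁ h₂ v₂ k u v)
    (h' : IsDecayingSolution I p q h₁ v₁ h₂ v₂ k' u' v') :
    IsDecayingSolution I p q h₁ v₁ h₂ v₂ (fun x => k x + k' x) (fun x => u x + u' x)
      (fun x => v x + v' x) := by
  obtain ⟨s, hs, C, hC⟩ := h.right
  obtain ⟨s', hs', C', hC'⟩ := h'.right
  obtain ⟨r, hr, D, hD⟩ := h.left
  obtain ⟨r', hr', D', hD'⟩ := h'.left
  refine ⟨h.sol.add h'.sol, ⟨max s s', ?_, C + C', fun x hx hsx => ?_⟩,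
    ⟨min r r', ?_, D + D', fun x hx hxr => ?_⟩⟩
  · rcases max_choice s s' with e | e <;> rwa [e]
  · obtain ⟨h1, h2⟩ := hC x hx ((le_max_left _ _).trans hsx)
    obtain ⟨h3, h4⟩ := hC' x hx ((le_max_right _ _).trans hsx)
    rw [h1, h2, h3, h4, add_mul, add_mul]
    exact ⟨rfl, rfl⟩
  · rcases min_choice r r' with e | e <;> rwa [e]
  · obtain ⟨h1, h2⟩ := hD x hx (hxr.trans (min_le_left _ _))
    obtain ⟨h3, h4⟩ := hD' x hx (hxr.trans (min_le_right _ _))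
    rw [h1, h2, h3, h4, add_mul, add_mul]
    exact ⟨rfl, rfl⟩

theorem const_mul (h : IsDecayingSolution I p q h₁ v₁ h₂ v₂ k u v) (r : ℝ) :
    IsDecayingSolution I p q h₁ v₁ h₂ v₂ (fun x => r * k x) (fun x => r * u x)
      (fun x => r * v x) := by
  obtain ⟨s, hs, C, hC⟩ := h.right
  obtain ⟨r', hr', D, hD⟩ := h.left
  refine ⟨h.sol.const_mul r, ⟨s, hs, r * C, fun x hx hsx => ?_⟩,
    ⟨r', hr', r * D, fun x hx hxr => ?_⟩⟩
  · rw [(hC x hx hsx).1, (hC x hx hsx).2, mul_assoc, mul_assoc]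
    exact ⟨rfl, rfl⟩
  · rw [(hD x hx hxr).1, (hD x hx hxr).2, mul_assoc, mul_assoc]
    exact ⟨rfl, rfl⟩

end IsDecayingSolution

namespace IsDecayingPair

/-- Variation of constants with the Green function W⁻¹h₁(max)h₂(min). Beyond the support of k one of
the two integrals vanishes and the other is constant, so only a multiple of h₁ or of h₂ is left. -/
theorem exists_decayingSolution (hP : IsDecayingPair I p q W h₁ v₁ h₂ v₂)
    (hS : IsSturmLiouville I p q) (hk : ∀ x ∈ I, ∀ y ∈ I, IntervalIntegrable k volume x y)
    {r s : ℝ} (hr : r ∈ I) (hs : s ∈ I) (hk0 : ∀ᵐ x, x ∈ I → x ∉ Ioc r s → k x = 0) :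
    ∃ u v, IsDecayingSolution I p q h₁ v₁ h₂ v₂ k u v := by
  have hord := hS.ordConnected
  have hint : ∀ h : ℝ → ℝ, ContinuousOn h I → ∀ x ∈ I, ∀ y ∈ I,
      IntervalIntegrable (fun t => h t * k t) volume x y := fun h hh x hx y hy =>
    (hk x hx y hy).continuousOn_mul (hh.mono (hord.uIcc_subset hx hy))
  have hi1 := hint h₁ (hP.sol₁.fst.continuousOn hS.isOpen)
  have hi2 := hint h₂ (hP.sol₂.fst.continuousOn hS.isOpen)
  have hA : IsPrimitiveOn I (fun x => ∫ t in r..x, h₂ t * k t) (fun t => h₂ t * k t) :=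
    IsPrimitiveOn.of_integral hS.isOpen hr hi2 fun x hx => by simp
  have hB : IsPrimitiveOn I (fun x => ∫ t in s..x, h₁ t * k t) (fun t => h₁ t * k t) :=
    IsPrimitiveOn.of_integral hS.isOpen hs hi1 fun x hx => by simp
  have hz : ∀ h : ℝ → ℝ, ∀ x ∈ I, ∀ y ∈ I, (∀ t ∈ uIoc x y, t ∉ Ioc r s) →
      ∫ t in x..y, h t * k t = 0 := by
    intro h x hx y hy hxy
    rw [← intervalIntegral.integral_zero (a := x) (b := y) (μ := volume) (E := ℝ)]
    refine intervalIntegral.integral_congr_ae ?_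
    filter_upwards [hk0] with t ht htx
    rw [ht (hS.uIoc_subset hx hy htx) (hxy t htx), mul_zero]
  have hW := hP.W_pos.ne'
  refine ⟨fun x => W⁻¹ * (h₁ x * (∫ t in r..x, h₂ t * k t) - h₂ x * ∫ t in s..x, h₁ t * k t),
    fun x => W⁻¹ * (v₁ x * (∫ t in r..x, h₂ t * k t) - v₂ x * ∫ t in s..x, h₁ t * k t),
    ⟨⟨(((hP.sol₁.fst.mul hA).sub (hP.sol₂.fst.mul hB)).const_mul W⁻¹).congr_deriv_on
      fun x hx => by ring, (((hP.sol₁.snd.mul hA).sub (hP.sol₂.snd.mul hB)).const_mul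
      W⁻¹).congr_deriv_on fun x hx => ?_⟩, ⟨s, hs, W⁻¹ * ∫ t in r..s, h₂ t * k t,
      fun x hx hsx => ?_⟩, ⟨r, hr, -(W⁻¹ * ∫ t in s..r, h₁ t * k t), fun x hx hxr => ?_⟩⟩⟩
  · have hw := hP.wronskian x hx
    field_simp
    rw [← hw]
    ring
  · have hoc : ∀ t ∈ uIoc s x, t ∉ Ioc r s := fun t ht h => by
      rw [uIoc_of_le hsx] at ht
      exact absurd h.2 (not_le.2 ht.1)
    rw [hz _ s hs x hx hoc, ← intervalIntegral.integral_add_adjacent_intervals (hi2 r hr s hs)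
      (hi2 s hs x hx), hz _ s hs x hx hoc]
    constructor <;> ring
  · have hoc : ∀ t ∈ uIoc r x, t ∉ Ioc r s := fun t ht h => by
      rw [uIoc_of_ge hxr] at ht
      exact absurd h.1 (not_lt.2 ht.2)
    rw [hz _ r hr x hx hoc, ← intervalIntegral.integral_add_adjacent_intervals (hi1 s hs r hr)
      (hi1 r hr x hx), hz _ r hr x hx hoc]
    constructor <;> ring

/-- Every homogeneous solution is a combination of the two decaying solutions. -/
theorem exists_eq_combination (hP : IsDecayingPair I p q W h₁ v₁ h₂ v₂) [I.OrdConnected]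
    (hu : IsSturmSolution I p q (fun _ => 0) u v) :
    ∃ C₁ C₂ : ℝ, ∀ x ∈ I, u x = C₁ * h₁ x + C₂ * h₂ x := by
  rcases I.eq_empty_or_nonempty with rfl | ⟨c, hc⟩
  · exact ⟨0, 0, by simp⟩
  have h1 : ∀ {h w : ℝ → ℝ}, IsSturmSolution I p q (fun _ => 0) h w → ∀ x ∈ I,
      u x * w x - v x * h x = u c * w c - v c * h c := fun hh x hx =>
    ((hu.wronskian hh).congr_deriv_on (g' := fun _ => 0) fun x _ => by ring).eq_of_deriv_zero hx hc
  refine ⟨W⁻¹ * (u c * v₂ c - v c * h₂ c), -W⁻¹ * (u c * v₁ c - v c * h₁ c), fun x hx => ?_⟩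
  rw [← h1 hP.sol₁ x hx, ← h1 hP.sol₂ x hx]
  have hW := hP.W_pos.ne'
  have := hP.wronskian x hx
  field_simp
  rw [← this]
  ring

end IsDecayingPair

/-- The Sturm–Liouville system with the weight `ρ`, where `q` dominates `lam ρ`. -/
structure IsWeightedSturmLiouville (I : Set ℝ) (p q ρ : ℝ → ℝ) (lam : ℝ) : Prop where
  sturm : IsSturmLiouville I p q
  weight : IsWeight I ρ
  lam_pos : 0 < lam
  le : ∀ᵐ x, x ∈ I → lam * ρ x ≤ q x

namespace IsWeightedSturmLiouville

/-- Since λρ ≤ q and h > 0, one has λρh ≤ qh = w', and the increment of w bounds the weighted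
integral. -/
theorem lintegral_Ioc_le (hS : IsWeightedSturmLiouville I p q ρ lam)
    {h w : ℝ → ℝ} (hh : IsSturmSolution I p q (fun _ => 0) h w)
    (hpos : ∀ x ∈ I, 0 < h x) {x y : ℝ} (hx : x ∈ I) (hy : y ∈ I) :
    ∫⁻ t in Ioc x y, ‖ρ t * h t‖ₑ ≤ ENNReal.ofReal (lam⁻¹ * (w y - w x)) := by
  have := hS.sturm.ordConnected
  have hlam := hS.lam_pos
  rcases le_or_gt y x with hyx | hxy
  · simp [Ioc_eq_empty (not_lt.2 hyx)]
  have h1 := hh.snd.intervalIntegrable hx hy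
  have h2 := hh.snd.integral_eq hx hy
  rw [intervalIntegral.integral_of_le hxy.le] at h2
  rw [intervalIntegrable_iff_integrableOn_Ioc_of_le hxy.le] at h1
  have hsub : ∀ t ∈ Ioc x y, t ∈ I := fun t ht =>
    hS.sturm.ordConnected.out hx hy (Ioc_subset_Icc_self ht)
  rw [← h2, ← integral_const_mul, ofReal_integral_eq_lintegral_ofReal (h1.const_mul _)]
  · refine lintegral_mono_ae ((ae_restrict_iff' measurableSet_Ioc).2 ?_)
    filter_upwards [hS.le, hS.weight.pos] with t h3 h4 ht
    have h5 := h3 (hsub t ht)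
    have h6 := h4 (hsub t ht)
    have h7 := hpos t (hsub t ht)
    rw [Real.enorm_of_nonneg (mul_pos h6 h7).le]
    refine ENNReal.ofReal_le_ofReal ?_
    rw [sub_zero, ← div_eq_inv_mul, le_div_iff₀ hlam]
    nlinarith
  · refine (ae_restrict_iff' measurableSet_Ioc).2 ?_
    filter_upwards [hS.sturm.q_pos] with t h3 ht
    have := h3 (hsub t ht)
    have h7 := hpos t (hsub t ht)
    simp only [Pi.zero_apply, sub_zero]
    positivity

theorem aestronglyMeasurable_mul (hS : IsWeightedSturmLiouville I p q ρ lam)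
    {h : ℝ → ℝ} (hh : ContinuousOn h I) :
    AEStronglyMeasurable (fun t => ρ t * h t) (volume.restrict I) :=
  hS.weight.aestronglyMeasurable.mul
    (hh.aestronglyMeasurable hS.sturm.isOpen.measurableSet)

/-- The increment of v₁ over (x, y] is at most -v₁(x) because v₁(y) ≤ 0, a bound independent of y.
-/
theorem integrableOn_right (hS : IsWeightedSturmLiouville I p q ρ lam)
    (hP : IsDecayingPair I p q W h₁ v₁ h₂ v₂) {x : ℝ} (hx : x ∈ I) :
    IntegrableOn (fun t => ρ t * h₁ t) (I ∩ Ioi x) := by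
  have hc := hP.sol₁.fst.continuousOn hS.sturm.isOpen
  refine ⟨(hS.aestronglyMeasurable_mul hc).mono_measure
    (Measure.restrict_mono inter_subset_left le_rfl), ?_⟩
  refine lt_of_le_of_lt (setLIntegral_inter_Ioi_le (C := ENNReal.ofReal (lam⁻¹ * -v₁ x))
    hS.sturm.isOpen hx fun y hy => ?_) ENNReal.ofReal_lt_top
  refine (hS.lintegral_Ioc_le hP.sol₁ hP.pos₁ hx hy).trans (ENNReal.ofReal_le_ofReal ?_)
  have := hP.nonpos₁ y hy
  have := inv_pos.2 hS.lam_pos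
  gcongr
  linarith

theorem integrableOn_left (hS : IsWeightedSturmLiouville I p q ρ lam)
    (hP : IsDecayingPair I p q W h₁ v₁ h₂ v₂) {x : ℝ} (hx : x ∈ I) :
    IntegrableOn (fun t => ρ t * h₂ t) (I ∩ Iic x) := by
  have hc := hP.sol₂.fst.continuousOn hS.sturm.isOpen
  refine ⟨(hS.aestronglyMeasurable_mul hc).mono_measure
    (Measure.restrict_mono inter_subset_left le_rfl), ?_⟩
  refine lt_of_le_of_lt (setLIntegral_inter_Iic_le (C := ENNReal.ofReal (lam⁻¹ * v₂ x))
    hS.sturm.isOpen hx fun y hy => ?_) ENNReal.ofReal_lt_top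
  refine (hS.lintegral_Ioc_le hP.sol₂ hP.pos₂ hy hx).trans (ENNReal.ofReal_le_ofReal ?_)
  have := hP.nonneg₂ y hy
  have := inv_pos.2 hS.lam_pos
  gcongr
  linarith

theorem integrable (hS : IsWeightedSturmLiouville I p q ρ lam)
    (hP : IsDecayingPair I p q W h₁ v₁ h₂ v₂) (hu : IsDecayingSolution I p q h₁ v₁ h₂ v₂ k u v) :
    Integrable u (weightMeasure I ρ) := by
  have := hS.sturm.ordConnected
  rw [hS.weight.integrable_iff]
  obtain ⟨s, hs, C, hC⟩ := hu.right
  obtain ⟨r, hr, D, hD⟩ := hu.left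
  have h1 : IntegrableOn (fun t => ρ t * u t) (I ∩ Ioi s) := by
    refine IntegrableOn.congr_fun ((hS.integrableOn_right hP hs).const_mul C) (fun x hx => ?_)
      (hS.sturm.isOpen.measurableSet.inter measurableSet_Ioi)
    rw [(hC x hx.1 (le_of_lt hx.2)).1]
    ring
  have h2 : IntegrableOn (fun t => ρ t * u t) (I ∩ Iic r) := by
    refine IntegrableOn.congr_fun ((hS.integrableOn_left hP hr).const_mul D) (fun x hx => ?_)
      (hS.sturm.isOpen.measurableSet.inter measurableSet_Iic)
    rw [(hD x hx.1 hx.2).1]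
    ring
  have h3 : IntegrableOn (fun t => ρ t * u t) (uIoc r s) :=
    ((hS.weight.intervalIntegrable r hr s hs).mul_continuousOn
      ((hu.sol.fst.continuousOn hS.sturm.isOpen).mono
        (hS.sturm.ordConnected.uIcc_subset hr hs))).def'
  refine ((h1.union h2).union h3).mono_set fun x hx => ?_
  rcases le_or_gt x r with h | h
  · exact Or.inl (Or.inr ⟨hx, h⟩)
  · rcases le_or_gt x s with h' | h'
    · exact Or.inr (mem_uIoc.2 (Or.inl ⟨h, h'⟩))
    · exact Or.inl (Or.inl ⟨hx, h'⟩)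

/-- Testing the equation against `arctan (n u)`. -/
theorem integral_arctan_mul_nonpos (hS : IsWeightedSturmLiouville I p q ρ lam)
    (hP : IsDecayingPair I p q W h₁ v₁ h₂ v₂) (hu : IsDecayingSolution I p q h₁ v₁ h₂ v₂ k u v)
    {y : ℝ → ℝ} (hy : Integrable y (weightMeasure I ρ))
    (hyk : ∀ᵐ x, x ∈ I → ρ x * y x = lam * ρ x * u x - k x) {n : ℝ} (hn : 0 < n) :
    ∫ x, Real.arctan (n * u x) * y x ∂weightMeasure I ρ ≤ 0 := by
  have := hS.sturm.ordConnected
  obtain ⟨s, hs, C, hC⟩ := hu.right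
  obtain ⟨r, hr, D, hD⟩ := hu.left
  have huc := hu.sol.fst.continuousOn hS.sturm.isOpen
  have hθc : ContinuousOn (fun x => Real.arctan (n * u x)) I :=
    Real.continuous_arctan.comp_continuousOn (continuousOn_const.mul huc)
  have hint : Integrable (fun x => Real.arctan (n * u x) * y x) (weightMeasure I ρ) := by
    refine hy.bdd_mul (c := Real.pi / 2) ?_ (ae_of_all _ fun x => ?_)
    · exact (hθc.aestronglyMeasurable hS.sturm.isOpen.measurableSet).mono_ac
        IsWeight.absolutelyContinuous'
    · exact (abs_lt.2 ⟨by linarith [Real.neg_pi_div_two_lt_arctan (n * u x)],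
        Real.arctan_lt_pi_div_two _⟩).le
  rw [hS.weight.integral_eq]
  refine setIntegral_mem_of_isClosed hS.sturm.isOpen (hS.weight.integrable_iff.1 hint) hr hs
    isClosed_Iic fun a ha har b hb hsb hab => ?_
  have hθ : IsPrimitiveOn I (fun x => Real.arctan (n * u x))
      (fun x => 1 / (1 + (n * u x) ^ 2) * (n * (p x * v x))) := by
    refine ((hu.sol.fst.const_mul n).comp isOpen_univ (fun _ _ => mem_univ _)
      (Real.contDiff_arctan.contDiffOn)).congr_deriv_on fun x _ => ?_
    rw [Real.deriv_arctan]
  have hprod := hθ.mul hu.sol.snd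
  have h1 := hprod.integral_eq ha hb
  have hsign : ∀ x : ℝ, 0 ≤ Real.arctan (n * x) * x := by
    intro x
    rcases le_total 0 x with hx | hx
    · exact mul_nonneg (Real.arctan_nonneg.2 (by positivity)) hx
    · exact mul_nonneg_of_nonpos_of_nonpos (Real.arctan_zero ▸
        Real.arctan_strictMono.monotone (mul_nonpos_of_nonneg_of_nonpos hn.le hx)) hx
  -- Near the right end u = C h₁ and v = C v₁ with h₁ > 0 and v₁ ≤ 0. The arctangent has the sign of
  -- C, so the boundary term has the good sign; the left end is symmetric.
  have hb' : Real.arctan (n * u b) * v b ≤ 0 := by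
    obtain ⟨e1, e2⟩ := hC b hb hsb
    have h2 := hsign (u b)
    rw [e2]
    have h3 := hP.pos₁ b hb
    have h4 := hP.nonpos₁ b hb
    have h5 : 0 ≤ Real.arctan (n * u b) * C := by
      rw [e1, ← mul_assoc] at h2
      rw [e1]
      exact nonneg_of_mul_nonneg_left h2 h3
    rw [← mul_assoc]
    exact mul_nonpos_of_nonneg_of_nonpos h5 h4
  have ha' : 0 ≤ Real.arctan (n * u a) * v a := by
    obtain ⟨e1, e2⟩ := hD a ha har
    have h2 := hsign (u a)
    rw [e2]
    have h3 := hP.pos₂ a ha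
    have h4 := hP.nonneg₂ a ha
    have h5 : 0 ≤ Real.arctan (n * u a) * D := by
      rw [e1, ← mul_assoc] at h2
      rw [e1]
      exact nonneg_of_mul_nonneg_left h2 h3
    rw [← mul_assoc]
    exact mul_nonneg h5 h4
  -- With θ = arctan(n u), the derivative of θv is θ'v + θ(qu - k). Here θ'v ≥ 0 because u' = p v,
  -- and θqu ≥ λρθu because θu ≥ 0, so it dominates θρy.
  refine le_trans (intervalIntegral.integral_mono_ae_restrict hab
    (hS.weight.intervalIntegrable_of_integrable hint ha hb)
    (hprod.intervalIntegrable ha hb) ?_) (h1.trans_le (by linarith))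
  refine (ae_restrict_iff' measurableSet_Icc).2 ?_
  filter_upwards [hyk, hS.le] with x h2 h3 hx
  have hxI := hS.sturm.ordConnected.out ha hb hx
  have h4 : ρ x * (Real.arctan (n * u x) * y x) =
      Real.arctan (n * u x) * (lam * ρ x * u x - k x) := by
    rw [← h2 hxI]
    ring
  have h5 := mul_nonneg (hsign (u x)) (sub_nonneg.2 (h3 hxI))
  have h6 : 0 ≤ 1 / (1 + (n * u x) ^ 2) * (n * (p x * v x)) * v x := by
    have h7 := (hS.sturm.p_pos x hxI).le
    have h8 : 1 / (1 + (n * u x) ^ 2) * (n * (p x * v x)) * v x =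
      1 / (1 + (n * u x) ^ 2) * (n * (p x * v x ^ 2)) := by ring
    rw [h8]
    positivity
  rw [h4]
  linarith

/-- As n grows, arctan(n u)u tends to (π/2)|u|. Pairing μu - y with arctan(n u) bounds it from above
by (π/2)‖μu - y‖, and the contribution of y has the sign supplied by `integral_arctan_mul_nonpos`.
This is dissipativity in the norm of `L¹`. -/
theorem mul_integral_abs_le (hS : IsWeightedSturmLiouville I p q ρ lam)
    (hP : IsDecayingPair I p q W h₁ v₁ h₂ v₂) (hu : IsDecayingSolution I p q h₁ v₁ h₂ v₂ k u v)
    {y : ℝ → ℝ} (hy : Integrable y (weightMeasure I ρ))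
    (hyk : ∀ᵐ x, x ∈ I → ρ x * y x = lam * ρ x * u x - k x) (μ : ℝ) :
    μ * ∫ x, |u x| ∂weightMeasure I ρ ≤ ∫ x, |μ * u x - y x| ∂weightMeasure I ρ := by
  have hui := hS.integrable hP hu
  have huc := hu.sol.fst.continuousOn hS.sturm.isOpen
  have hθm : ∀ n : ℝ, AEStronglyMeasurable (fun x => Real.arctan (n * u x))
      (weightMeasure I ρ) := fun n =>
    ((Real.continuous_arctan.comp_continuousOn (continuousOn_const.mul huc)).aestronglyMeasurable
      hS.sturm.isOpen.measurableSet).mono_ac IsWeight.absolutelyContinuous'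
  have hθb : ∀ t : ℝ, |Real.arctan t| ≤ Real.pi / 2 := fun t =>
    (abs_lt.2 ⟨by linarith [Real.neg_pi_div_two_lt_arctan t], Real.arctan_lt_pi_div_two _⟩).le
  have hint : ∀ (n : ℝ) {f : ℝ → ℝ}, Integrable f (weightMeasure I ρ) →
      Integrable (fun x => Real.arctan (n * u x) * f x) (weightMeasure I ρ) := fun n f hf =>
    hf.bdd_mul (hθm n) (ae_of_all _ fun x => hθb _)
  have hz : Integrable (fun x => μ * u x - y x) (weightMeasure I ρ) := (hui.const_mul μ).sub hy
  have hbound : ∀ n : ℕ, μ * ∫ x, Real.arctan ((n + 1 : ℝ) * u x) * u x ∂weightMeasure I ρ ≤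
      Real.pi / 2 * ∫ x, |μ * u x - y x| ∂weightMeasure I ρ := by
    intro n
    have h1 := hS.integral_arctan_mul_nonpos hP hu hy hyk (n := n + 1) (by positivity)
    have h2 : ∫ x, Real.arctan ((n + 1 : ℝ) * u x) * (μ * u x - y x) ∂weightMeasure I ρ =
        μ * (∫ x, Real.arctan ((n + 1 : ℝ) * u x) * u x ∂weightMeasure I ρ) -
        ∫ x, Real.arctan ((n + 1 : ℝ) * u x) * y x ∂weightMeasure I ρ := by
      rw [← integral_const_mul, ← integral_sub ((hint _ hui).const_mul μ) (hint _ hy)]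
      exact integral_congr_ae (ae_of_all _ fun x => by ring)
    have h3 : ∫ x, Real.arctan ((n + 1 : ℝ) * u x) * (μ * u x - y x) ∂weightMeasure I ρ ≤
        Real.pi / 2 * ∫ x, |μ * u x - y x| ∂weightMeasure I ρ := by
      rw [← integral_const_mul]
      refine integral_mono (hint _ hz) (hz.abs.const_mul _) fun x => ?_
      refine (le_abs_self _).trans ?_
      rw [abs_mul]
      exact mul_le_mul_of_nonneg_right (hθb _) (abs_nonneg _)
    linarith
  have hlim : Tendsto (fun n : ℕ => ∫ x, Real.arctan ((n + 1 : ℝ) * u x) * u x ∂weightMeasure I ρ)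
      atTop (𝓝 (∫ x, Real.pi / 2 * |u x| ∂weightMeasure I ρ)) := by
    refine tendsto_integral_of_dominated_convergence (fun x => Real.pi / 2 * |u x|)
      (fun n => (hint _ hui).aestronglyMeasurable) (hui.abs.const_mul _)
      (fun n => ae_of_all _ fun x => ?_) (ae_of_all _ fun x => ?_)
    · rw [norm_mul]
      exact mul_le_mul_of_nonneg_right (hθb _) (abs_nonneg _)
    · have hn : Tendsto (fun n : ℕ => (n + 1 : ℝ)) atTop atTop :=
        tendsto_atTop_add_const_right _ _ tendsto_natCast_atTop_atTop
      rcases lt_trichotomy (u x) 0 with hx | hx | hx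
      · have h1 := ((Real.tendsto_arctan_atBot.mono_right nhdsWithin_le_nhds).comp
          (hn.atTop_mul_const_of_neg hx)).mul_const (u x)
        rw [abs_of_neg hx, mul_neg, ← neg_mul]
        exact h1
      · simp [hx]
      · have h1 := ((Real.tendsto_arctan_atTop.mono_right nhdsWithin_le_nhds).comp
          (hn.atTop_mul_const hx)).mul_const (u x)
        rw [abs_of_pos hx]
        exact h1
  have h5 := le_of_tendsto' (hlim.const_mul μ) hbound
  rw [integral_const_mul] at h5
  have := Real.pi_pos
  nlinarith

end IsWeightedSturmLiouville

end DecayingSolution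

/-! ### The pre-adjoint of the operator on `L¹` -/

section Graph

/-- The closure of a densely defined dissipative operator is `m`-dissipative if `lam - A` has dense
range. -/
theorem IsMDissipative.of_dense {X : Type*} [NormedAddCommGroup X] [NormedSpace ℝ X]
    [CompleteSpace X] {G : Submodule ℝ (X × X)}
    (hG : ∀ x y, (x, y) ∈ G → ∀ μ : ℝ, 0 < μ → μ * ‖x‖ ≤ ‖μ • x - y‖) {lam : ℝ} (hlam : 0 < lam)
    (hr : Dense {z | ∃ x y, (x, y) ∈ G ∧ lam • x - y = z}) (hd : Dense {x | ∃ y, (x, y) ∈ G}) :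
    IsMDissipative G.topologicalClosure where
  dissipative x y hxy μ hμ := by
    have hcl : IsClosed {z : X × X | μ * ‖z.1‖ ≤ ‖μ • z.1 - z.2‖} :=
      isClosed_le (by fun_prop) (by fun_prop)
    exact closure_minimal (fun z hz => hG z.1 z.2 hz μ hμ) hcl hxy
  range := by
    refine ⟨lam, hlam, fun z => ?_⟩
    obtain ⟨w, hw, hwz⟩ := mem_closure_iff_seq_limit.1 (hr z)
    choose x y hxy hw using hw
    -- Dissipativity bounds lam‖xₙ - x_N‖ by ‖wₙ - w_N‖, so approximate preimages converge and the
    -- limit lies in the closed graph.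
    have hcau : CauchySeq x := by
      rw [Metric.cauchySeq_iff']
      intro ε hε
      obtain ⟨N, hN⟩ := Metric.cauchySeq_iff'.1 hwz.cauchySeq (lam * ε) (by positivity)
      refine ⟨N, fun n hn => ?_⟩
      have h1 := hG _ _ (G.sub_mem (hxy n) (hxy N)) lam hlam
      have h2 : lam • (x n - x N) - (y n - y N) = w n - w N := by
        rw [← hw n, ← hw N, smul_sub]
        abel
      have h3 := hN n hn
      rw [dist_eq_norm] at h3 ⊢
      change lam * ‖x n - x N‖ ≤ ‖lam • (x n - x N) - (y n - y N)‖ at h1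
      rw [h2] at h1
      exact lt_of_mul_lt_mul_left (h1.trans_lt h3) hlam.le
    obtain ⟨x₀, hx₀⟩ := cauchySeq_tendsto_of_complete hcau
    refine ⟨x₀, lam • x₀ - z, ?_, by abel⟩
    have hy : Tendsto y atTop (𝓝 (lam • x₀ - z)) := by
      refine ((hx₀.const_smul lam).sub hwz).congr fun n => ?_
      rw [← hw n]
      abel
    have hxy' : ∀ n, (x n, y n) ∈ (G : Set (X × X)) := hxy
    exact mem_closure_of_tendsto (hx₀.prodMk_nhds hy) (Eventually.of_forall hxy')
  dense := hd.mono (by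
    rintro x ⟨y, hy⟩
    exact ⟨y, subset_closure hy⟩)

theorem IsOpen.exists_subset_Ioo {I : Set ℝ} (ho : IsOpen I) (hne : I.Nonempty) {K : Set ℝ}
    (hK : IsCompact K) (hKI : K ⊆ I) : ∃ r ∈ I, ∃ s ∈ I, r ≤ s ∧ K ⊆ Ioo r s := by
  rcases K.eq_empty_or_nonempty with rfl | hK0
  · obtain ⟨c, hc⟩ := hne
    exact ⟨c, hc, c, hc, le_rfl, empty_subset _⟩
  · obtain ⟨r, hr, _, _, hr', _⟩ := ho.exists_mem_lt_lt (hKI (hK.sInf_mem hK0))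
    obtain ⟨_, _, s, hs, _, hs'⟩ := ho.exists_mem_lt_lt (hKI (hK.sSup_mem hK0))
    have h : K ⊆ Ioo r s := fun x hx =>
      ⟨hr'.trans_le (csInf_le hK.bddBelow hx), (le_csSup hK.bddAbove hx).trans_lt hs'⟩
    obtain ⟨x, hx⟩ := hK0
    exact ⟨r, hr, s, hs, ((h hx).1.trans (h hx).2).le, h⟩

variable {Ω : Opens ℝ} {p q ρ : ℝ → ℝ} {lam : ℝ}

namespace IsWeight

theorem measure_Icc_lt_top (h : IsWeight Ω ρ) {r s : ℝ} (hr : r ∈ Ω) (hs : s ∈ Ω) :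
    weightMeasure Ω ρ (Icc r s) < ⊤ := by
  rcases le_or_gt r s with hrs | hrs
  · have hI : IntegrableOn ρ (Icc r s) :=
      (intervalIntegrable_iff_integrableOn_Icc_of_le hrs).1 (h.intervalIntegrable r hr s hs)
    rw [weightMeasure, withDensity_apply _ measurableSet_Icc,
      Measure.restrict_restrict measurableSet_Icc]
    exact (lintegral_mono_set inter_subset_left).trans_lt hI.lintegral_lt_top
  · simp [Icc_eq_empty (not_le.2 hrs)]

theorem memLp_one_of_memLp_top (h : IsWeight Ω ρ) {f : ℝ → ℝ}
    (hf : MemLp f ∞ (weightMeasure Ω ρ)) (φ : 𝓓(Ω, ℝ)) (h0 : ∀ x ∉ tsupport φ, f x = 0) :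
    MemLp f 1 (weightMeasure Ω ρ) := by
  rcases (Ω : Set ℝ).eq_empty_or_nonempty with hΩ | hΩ
  · have : weightMeasure Ω ρ = 0 := by rw [weightMeasure, hΩ]; simp
    rw [this]
    simp
  obtain ⟨r, hr, s, hs, -, hK⟩ := h.isOpen.exists_subset_Ioo hΩ φ.hasCompactSupport
    φ.tsupport_subset
  exact hf.mono_exponent_of_measure_support_ne_top
    (fun x hx => h0 x fun hx' => hx (Ioo_subset_Icc_self (hK hx')))
    (h.measure_Icc_lt_top hr hs).ne le_top

theorem memLp_top_testFunction (φ : 𝓓(Ω, ℝ)) (m : Measure ℝ) : MemLp (φ : ℝ → ℝ) ∞ m :=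
  φ.continuous.memLp_top_of_hasCompactSupport φ.hasCompactSupport m

theorem memLp_one_testFunction (h : IsWeight Ω ρ) (φ : 𝓓(Ω, ℝ)) :
    MemLp (φ : ℝ → ℝ) 1 (weightMeasure Ω ρ) :=
  h.memLp_one_of_memLp_top (memLp_top_testFunction φ _) φ
    fun _ hx => image_eq_zero_of_notMem_tsupport hx

/-- The inclusion of the test functions into `L¹`. -/
def testInclusionOne (h : IsWeight Ω ρ) : 𝓓(Ω, ℝ) →ₗ[ℝ] Lp ℝ 1 (weightMeasure Ω ρ) where
  toFun φ := (h.memLp_one_testFunction φ).toLp φ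
  map_add' _ _ := rfl
  map_smul' _ _ := rfl

theorem ae_eq_zero_of_forall_test (h : IsWeight Ω ρ) {f : ℝ → ℝ}
    (hf : ∀ x ∈ Ω, ∀ y ∈ Ω, IntervalIntegrable (fun t => ρ t * f t) volume x y)
    (h0 : ∀ φ : 𝓓(Ω, ℝ), ∫ x, f x * φ x ∂weightMeasure Ω ρ = 0) :
    f =ᵐ[weightMeasure Ω ρ] 0 := by
  have h1 := h.isOpen.ae_eq_zero_of_integral_contDiff_smul_eq_zero
    (locallyIntegrableOn_of_intervalIntegrable h.isOpen hf) (fun g hg hgc hgs => by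
      have h2 := h0 ⟨g, hg, hgc, hgs⟩
      rw [h.integral_eq] at h2
      rw [← h2, ← setIntegral_eq_integral_of_forall_compl_eq_zero (s := Ω)]
      · refine integral_congr_ae (ae_of_all _ fun x => ?_)
        change g x * (ρ x * f x) = ρ x * (f x * g x)
        ring
      · intro x hx
        rw [image_eq_zero_of_notMem_tsupport fun hx' => hx (hgs hx'), zero_smul])
  refine h.ae_iff.2 ?_
  filter_upwards [h1, h.pos] with x h2 h3 hx
  exact (mul_eq_zero.1 (h2 hx)).resolve_left (h3 hx).ne'

theorem intervalIntegrable_of_memLp_top (h : IsWeight Ω ρ) {f : ℝ → ℝ}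
    (hf : MemLp f ∞ (weightMeasure Ω ρ)) {x y : ℝ} (hx : x ∈ Ω) (hy : y ∈ Ω) :
    IntervalIntegrable (fun t => ρ t * f t) volume x y := by
  have hsub : uIoc x y ⊆ Ω := uIoc_subset_uIcc.trans (h.ordConnected.uIcc_subset hx hy)
  have hb := h.ae_iff.1 (ae_le_eLpNormEssSup (f := f) (μ := weightMeasure Ω ρ))
  have hlt := hf.2
  rw [eLpNorm_exponent_top] at hlt
  rw [intervalIntegrable_iff]
  refine (h.intervalIntegrable x hx y hy).def'.mul_bdd
    (c := (eLpNormEssSup f (weightMeasure Ω ρ)).toReal)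
    ((hf.1.mono_ac h.absolutelyContinuous).mono_measure (Measure.restrict_mono hsub le_rfl)) ?_
  refine (ae_restrict_iff' measurableSet_uIoc).2 ?_
  filter_upwards [hb] with t ht htx
  have := ENNReal.toReal_mono hlt.ne (ht (hsub htx))
  simpa using this

theorem denseRange_testInclusionOne (h : IsWeight Ω ρ) : DenseRange h.testInclusionOne := by
  refine denseRange_of_forall_functional _ fun ℓ hℓ => ?_
  obtain ⟨f, rfl⟩ := toDual_surjective ℓ
  have h1 : f.rep =ᵐ[weightMeasure Ω ρ] 0 := by
    refine h.ae_eq_zero_of_forall_test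
      (fun x hx y hy => h.intervalIntegrable_of_memLp_top f.memLp_rep hx hy) fun φ => ?_
    have h2 := hℓ φ
    rw [← LInftyC.mk_rep f] at h2
    exact (LInftyC.toDual_mk_toLp _ (h.memLp_one_testFunction φ)).symm.trans h2
  have h2 : f = 0 := by
    rw [← LInftyC.mk_rep f]
    exact LInftyC.mk_eq_zero _ h1
  rw [h2, map_zero]
  rfl

end IsWeight

/-- `𝓐` is the operator on test functions which corresponds to the Sturm–Liouville system:
`(lam - 𝓐) φ = g` means that `(φ, ψ)` solves the system with right-hand side `ρ g`, where
`ψ = φ' / p`. -/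
structure IsTestOperator (Ω : Opens ℝ) (p q ρ : ℝ → ℝ) (lam : ℝ)
    (𝓐 : 𝓓(Ω, ℝ) → ℝ → ℝ) : Prop where
  memLp : ∀ φ, MemLp (𝓐 φ) ∞ (weightMeasure Ω ρ)
  eq_zero : ∀ φ : 𝓓(Ω, ℝ), ∀ x ∉ tsupport φ, 𝓐 φ x = 0
  exists_sol : ∀ φ : 𝓓(Ω, ℝ), ∃ ψ : ℝ → ℝ,
    IsSturmSolution Ω p q (fun x => ρ x * (lam * φ x - 𝓐 φ x)) φ ψ ∧ ∀ x ∉ tsupport φ, ψ x = 0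

variable {𝓐 : 𝓓(Ω, ℝ) → ℝ → ℝ} {W : ℝ} {h₁ v₁ h₂ v₂ k u v : ℝ → ℝ}

/-- The Wronskian of (u, v) with (φ, ψ) vanishes off the support of φ, so its derivative integrates
to zero. No behaviour of u at the end points is needed. -/
theorem IsTestOperator.green (hA : IsTestOperator Ω p q ρ lam 𝓐) (hS : IsSturmLiouville Ω p q)
    (hu : IsSturmSolution Ω p q k u v) (φ : 𝓓(Ω, ℝ)) :
    ∫ x in Ω, (k x * φ x - u x * (ρ x * (lam * φ x - 𝓐 φ x))) = 0 := by
  have := hS.ordConnected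
  rcases (Ω : Set ℝ).eq_empty_or_nonempty with hΩ | hΩ
  · rw [hΩ]
    simp
  obtain ⟨r, hr, s, hs, hrs, hK⟩ := hS.isOpen.exists_subset_Ioo hΩ φ.hasCompactSupport
    φ.tsupport_subset
  obtain ⟨ψ, hψ, hψ0⟩ := hA.exists_sol φ
  have hn : ∀ x ∉ Ioo r s, x ∉ tsupport φ := fun x hx hx' => hx (hK hx')
  have hr0 := hn r (by simp)
  have hs0 := hn s (by simp)
  have h1 := (hu.wronskian hψ).integral_eq hr hs
  rw [hψ0 r hr0, hψ0 s hs0, image_eq_zero_of_notMem_tsupport hr0,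
    image_eq_zero_of_notMem_tsupport hs0, intervalIntegral.integral_of_le hrs] at h1
  have hsub : Ioc r s ⊆ Ω := Ioc_subset_Icc_self.trans (hS.ordConnected.out hr hs)
  rw [← setIntegral_eq_of_subset_of_forall_sdiff_eq_zero hS.isOpen.measurableSet hsub] at h1
  · simpa using h1
  · intro x hx
    have := hn x fun h => hx.2 (Ioo_subset_Ioc_self h)
    rw [hA.eq_zero φ x this, image_eq_zero_of_notMem_tsupport this]
    ring

/-- The graph of the restriction of the maximal operator on `L¹` to the functions which are
multiples of the decaying solutions near the end points. -/
def decayingGraph (Ω : Opens ℝ) (p q ρ : ℝ → ℝ) (lam : ℝ) (h₁ v₁ h₂ v₂ : ℝ → ℝ)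
    (hΩ : (Ω : Set ℝ).Nonempty) :
    Submodule ℝ (Lp ℝ 1 (weightMeasure Ω ρ) × Lp ℝ 1 (weightMeasure Ω ρ)) where
  carrier := {z | ∃ k u v, IsDecayingSolution Ω p q h₁ v₁ h₂ v₂ k u v ∧
    z.1 =ᵐ[weightMeasure Ω ρ] u ∧
    ∀ᵐ x ∂weightMeasure Ω ρ, ρ x * z.2 x = lam * ρ x * u x - k x}
  add_mem' := by
    rintro z w ⟨k, u, v, h, h1, h2⟩ ⟨k', u', v', h', h1', h2'⟩
    refine ⟨_, _, _, h.add h', ?_, ?_⟩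
    · filter_upwards [Lp.coeFn_add z.1 w.1, h1, h1'] with x e1 e2 e3
      rw [Prod.fst_add, e1, Pi.add_apply, e2, e3]
    · filter_upwards [Lp.coeFn_add z.2 w.2, h2, h2'] with x e1 e2 e3
      rw [Prod.snd_add, e1, Pi.add_apply, mul_add, e2, e3]
      ring
  zero_mem' := by
    obtain ⟨c, hc⟩ := hΩ
    have h0 := IsPrimitiveOn.const (Ω : Set ℝ) 0
    refine ⟨fun _ => 0, fun _ => 0, fun _ => 0, ⟨⟨h0.congr_deriv_on fun x _ => by ring,
      h0.congr_deriv_on fun x _ => by ring⟩, ⟨c, hc, 0, by simp⟩, ⟨c, hc, 0, by simp⟩⟩,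
      Lp.coeFn_zero ℝ 1 _, ?_⟩
    filter_upwards [Lp.coeFn_zero ℝ 1 (weightMeasure Ω ρ)] with x hx
    rw [Prod.snd_zero, hx]
    simp
  smul_mem' := by
    rintro r z ⟨k, u, v, h, h1, h2⟩
    refine ⟨_, _, _, h.const_mul r, ?_, ?_⟩
    · filter_upwards [Lp.coeFn_smul r z.1, h1] with x e1 e2
      rw [Prod.smul_fst, e1, Pi.smul_apply, e2, smul_eq_mul]
    · filter_upwards [Lp.coeFn_smul r z.2, h2] with x e1 e2
      rw [Prod.smul_snd, e1, Pi.smul_apply, smul_eq_mul, mul_left_comm, e2]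
      ring

theorem mem_decayingGraph {hΩ : (Ω : Set ℝ).Nonempty} {x y : Lp ℝ 1 (weightMeasure Ω ρ)} :
    (x, y) ∈ decayingGraph Ω p q ρ lam h₁ v₁ h₂ v₂ hΩ ↔
    ∃ k u v, IsDecayingSolution Ω p q h₁ v₁ h₂ v₂ k u v ∧ x =ᵐ[weightMeasure Ω ρ] u ∧
    ∀ᵐ t ∂weightMeasure Ω ρ, ρ t * y t = lam * ρ t * u t - k t := Iff.rfl

theorem IsTestOperator.toLp_mem_decayingGraph (hA : IsTestOperator Ω p q ρ lam 𝓐)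
    (hρ : IsWeight Ω ρ) (hΩ : (Ω : Set ℝ).Nonempty) (φ : 𝓓(Ω, ℝ)) :
    (hρ.testInclusionOne φ, (hρ.memLp_one_of_memLp_top (hA.memLp φ) φ (hA.eq_zero φ)).toLp _) ∈
      decayingGraph Ω p q ρ lam h₁ v₁ h₂ v₂ hΩ := by
  obtain ⟨ψ, hψ, hψ0⟩ := hA.exists_sol φ
  obtain ⟨r, hr, s, hs, -, hK⟩ := hρ.isOpen.exists_subset_Ioo hΩ φ.hasCompactSupport
    φ.tsupport_subset
  have h0 : ∀ x ∉ Ioo r s, φ x = 0 ∧ ψ x = 0 := fun x hx =>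
    ⟨image_eq_zero_of_notMem_tsupport fun hx' => hx (hK hx'), hψ0 x fun hx' => hx (hK hx')⟩
  refine ⟨_, _, _, ⟨hψ, ⟨s, hs, 0, fun x _ hsx => ?_⟩, ⟨r, hr, 0, fun x _ hxr => ?_⟩⟩,
    MemLp.coeFn_toLp (hρ.memLp_one_testFunction φ), ?_⟩
  · rw [zero_mul, zero_mul]
    exact h0 x fun h => absurd h.2 (not_lt.2 hsx)
  · rw [zero_mul, zero_mul]
    exact h0 x fun h => absurd h.1 (not_lt.2 hxr)
  · filter_upwards [MemLp.coeFn_toLp (hρ.memLp_one_of_memLp_top (hA.memLp φ) φ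
      (hA.eq_zero φ))] with x hx
    rw [hx]
    ring

namespace IsWeightedSturmLiouville

/-- Test functions are dense in `L¹`. They lie in the domain, and by variation of constants also in
the range of lam minus the operator; dissipativity comes from `mul_integral_abs_le`. -/
theorem isMDissipative (hS : IsWeightedSturmLiouville Ω p q ρ lam)
    (hP : IsDecayingPair Ω p q W h₁ v₁ h₂ v₂) (hA : IsTestOperator Ω p q ρ lam 𝓐)
    (hΩ : (Ω : Set ℝ).Nonempty) :
    IsMDissipative (decayingGraph Ω p q ρ lam h₁ v₁ h₂ v₂ hΩ).topologicalClosure := by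
  have hρ := hS.weight
  refine IsMDissipative.of_dense (fun x y hxy μ _ => ?_) hS.lam_pos
    (hρ.denseRange_testInclusionOne.mono ?_) (hρ.denseRange_testInclusionOne.mono ?_)
  · obtain ⟨k, u, v, hu, hxu, hyk⟩ := mem_decayingGraph.1 hxy
    have h1 := hS.mul_integral_abs_le hP hu (integrable_coeFn_one y) (hρ.ae_iff.1 hyk) μ
    rw [L1.norm_eq_integral_norm, L1.norm_eq_integral_norm]
    refine le_trans (le_of_eq ?_) (h1.trans (le_of_eq ?_))
    · congr 1
      exact integral_congr_ae (hxu.mono fun t ht => by simp only [ht, Real.norm_eq_abs])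
    · refine integral_congr_ae ?_
      filter_upwards [hxu, Lp.coeFn_sub (μ • x) y, Lp.coeFn_smul μ x] with t e1 e2 e3
      rw [e2, Pi.sub_apply, e3, Pi.smul_apply, e1, Real.norm_eq_abs, smul_eq_mul]
  · rintro _ ⟨φ, rfl⟩
    obtain ⟨r, hr, s, hs, -, hK⟩ := hρ.isOpen.exists_subset_Ioo hΩ φ.hasCompactSupport
      φ.tsupport_subset
    obtain ⟨u, v, hu⟩ := hP.exists_decayingSolution hS.sturm (k := fun x => ρ x * φ x)
      (fun x hx y hy => hρ.intervalIntegrable_of_memLp_top (IsWeight.memLp_top_testFunction φ _)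
        hx hy) hr hs (ae_of_all _ fun x _ hx => by
        rw [image_eq_zero_of_notMem_tsupport fun hx' => hx (Ioo_subset_Ioc_self (hK hx')),
          mul_zero])
    have hui := memLp_one_iff_integrable.2 (hS.integrable hP hu)
    refine ⟨hui.toLp u, lam • hui.toLp u - hρ.testInclusionOne φ, ⟨_, u, v, hu, hui.coeFn_toLp, ?_⟩,
      by abel⟩
    filter_upwards [Lp.coeFn_sub (lam • hui.toLp u) (hρ.testInclusionOne φ),
      Lp.coeFn_smul lam (hui.toLp u), hui.coeFn_toLp,
      (hρ.memLp_one_testFunction φ).coeFn_toLp] with t e1 e2 e3 e4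
    have e5 : (hρ.testInclusionOne φ) t = φ t := e4
    rw [e1, Pi.sub_apply, e2, Pi.smul_apply, e3, e5, smul_eq_mul]
    ring
  · rintro _ ⟨φ, rfl⟩
    exact ⟨_, hA.toLp_mem_decayingGraph hρ hΩ φ⟩

/-- The operator on test functions is dual to the decaying graph. -/
theorem toDual_eq (hS : IsWeightedSturmLiouville Ω p q ρ lam) {hΩ : (Ω : Set ℝ).Nonempty}
    (hA : IsTestOperator Ω p q ρ lam 𝓐) (φ : 𝓓(Ω, ℝ)) {x y : Lp ℝ 1 (weightMeasure Ω ρ)}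
    (hxy : (x, y) ∈ (decayingGraph Ω p q ρ lam h₁ v₁ h₂ v₂ hΩ).topologicalClosure) :
    LInftyC.toDual _ (LInftyC.mk (IsWeight.memLp_top_testFunction φ _)) y =
      LInftyC.toDual _ (LInftyC.mk (hA.memLp φ)) x := by
  set F : Lp ℝ 1 (weightMeasure Ω ρ) →L[ℝ] ℝ :=
    LInftyC.toDual _ (LInftyC.mk (IsWeight.memLp_top_testFunction φ _))
  set K : Lp ℝ 1 (weightMeasure Ω ρ) →L[ℝ] ℝ := LInftyC.toDual _ (LInftyC.mk (hA.memLp φ))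
  have hcl : IsClosed {z : Lp ℝ 1 (weightMeasure Ω ρ) × Lp ℝ 1 (weightMeasure Ω ρ) |
      F z.2 = K z.1} := isClosed_eq (by fun_prop) (by fun_prop)
  refine closure_minimal (fun z hz => ?_) hcl hxy
  obtain ⟨k, u, v, hu, hxu, hyk⟩ := hz
  have h1 := hA.green hS.sturm hu.sol φ
  have h2 : F z.2 = ∫ x, φ x * z.2 x ∂weightMeasure Ω ρ := LInftyC.toDual_mk _ _
  have h3 : K z.1 = ∫ x, 𝓐 φ x * z.1 x ∂weightMeasure Ω ρ := LInftyC.toDual_mk _ _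
  have h4 := LInftyC.integrable_mul (IsWeight.memLp_top_testFunction φ (weightMeasure Ω ρ))
    (integrable_coeFn_one z.2)
  have h5 := LInftyC.integrable_mul (hA.memLp φ) (integrable_coeFn_one z.1)
  change F z.2 = K z.1
  rw [h2, h3, eq_comm, ← sub_eq_zero, ← integral_sub h5 h4, hS.weight.integral_eq, ← h1]
  refine integral_congr_ae ((ae_restrict_iff' hS.weight.isOpen.measurableSet).2 ?_)
  filter_upwards [hS.weight.ae_iff.1 hxu, hS.weight.ae_iff.1 hyk] with t e1 e2 ht
  have e3 : k t = lam * ρ t * u t - ρ t * z.2 t := by rw [e2 ht]; ring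
  rw [e1 ht, e3]
  ring

/-- An integrable homogeneous solution is annihilated by the range of `lam - 𝓐`. -/
theorem integral_mul_solution (hS : IsWeightedSturmLiouville Ω p q ρ lam)
    (hA : IsTestOperator Ω p q ρ lam 𝓐) (hu : IsSturmSolution Ω p q (fun _ => 0) u v)
    (φ : 𝓓(Ω, ℝ)) : ∫ x, (lam * φ x - 𝓐 φ x) * u x ∂weightMeasure Ω ρ = 0 := by
  have h1 := hA.green hS.sturm hu φ
  rw [hS.weight.integral_eq, ← neg_eq_zero, ← integral_neg, ← h1]
  refine integral_congr_ae (ae_of_all _ fun t => ?_)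
  ring

end IsWeightedSturmLiouville

end Graph

/-! ### Weak solutions -/

section Weak

variable {Ω : Opens ℝ}

/-- The derivative of a test function. -/
def testDeriv : 𝓓(Ω, ℝ) →ₗ[ℝ] 𝓓(Ω, ℝ) where
  toFun φ := ⟨deriv φ, (contDiff_infty_iff_deriv.1 φ.contDiff).2, φ.hasCompactSupport.deriv,
    (closure_minimal support_deriv_subset isClosed_closure).trans φ.tsupport_subset⟩
  map_add' φ ψ := by
    ext x
    exact deriv_add (φ.contDiff.differentiable (by simp) x) (ψ.contDiff.differentiable (by simp) x)
  map_smul' r φ := by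
    ext x
    exact deriv_const_smul_field r _

theorem tsupport_testDeriv_subset (φ : 𝓓(Ω, ℝ)) : tsupport (testDeriv φ) ⊆ tsupport φ :=
  closure_minimal support_deriv_subset isClosed_closure

theorem isPrimitiveOn_test (φ : 𝓓(Ω, ℝ)) : IsPrimitiveOn Ω φ (testDeriv φ) :=
  IsPrimitiveOn.of_contDiff _ (φ.contDiff.of_le (by simp))

theorem setIntegral_eq_intervalIntegral_of_test [hI : (Ω : Set ℝ).OrdConnected]
    (hΩ : (Ω : Set ℝ).Nonempty) (φ : 𝓓(Ω, ℝ)) {f : ℝ → ℝ} (h0 : ∀ x ∉ tsupport φ, f x = 0) :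
    ∃ r ∈ Ω, ∃ s ∈ Ω, r ≤ s ∧ r ∉ tsupport φ ∧ s ∉ tsupport φ ∧
      (∀ x, x ∉ Ioc r s → f x = 0) ∧ ∫ x in Ω, f x = ∫ x in r..s, f x := by
  obtain ⟨r, hr, s, hs, hrs, hK⟩ := Ω.isOpen.exists_subset_Ioo hΩ φ.hasCompactSupport
    φ.tsupport_subset
  have h1 : ∀ x, x ∉ Ioc r s → f x = 0 := fun x hx =>
    h0 x fun h => hx (Ioo_subset_Ioc_self (hK h))
  refine ⟨r, hr, s, hs, hrs, fun h => (lt_irrefl r (hK h).1), fun h => (lt_irrefl s (hK h).2),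
    h1, ?_⟩
  rw [intervalIntegral.integral_of_le hrs]
  exact setIntegral_eq_of_subset_of_forall_sdiff_eq_zero Ω.isOpen.measurableSet
    (Ioc_subset_Icc_self.trans (hI.out hr hs)) fun x hx => h1 x hx.2

theorem setIntegral_deriv_eq_zero [hI : (Ω : Set ℝ).OrdConnected] (φ : 𝓓(Ω, ℝ)) {G G' : ℝ → ℝ}
    (hG : IsPrimitiveOn Ω G G') (h0 : ∀ x ∉ tsupport φ, G x = 0 ∧ G' x = 0) :
    ∫ x in Ω, G' x = 0 := by
  rcases (Ω : Set ℝ).eq_empty_or_nonempty with hΩ | hΩ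
  · rw [hΩ]; simp
  obtain ⟨r, hr, s, hs, -, hr0, hs0, -, h⟩ :=
    setIntegral_eq_intervalIntegral_of_test hΩ φ fun x hx => (h0 x hx).2
  rw [h, hG.integral_eq hr hs, (h0 r hr0).1, (h0 s hs0).1, sub_zero]

theorem integrableOn_mul_test [hI : (Ω : Set ℝ).OrdConnected] {F : ℝ → ℝ}
    (hF : ∀ x ∈ Ω, ∀ y ∈ Ω, IntervalIntegrable F volume x y) (φ : 𝓓(Ω, ℝ)) :
    IntegrableOn (fun x => F x * φ x) Ω := by
  rcases (Ω : Set ℝ).eq_empty_or_nonempty with hΩ | hΩ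
  · rw [hΩ]; simp
  obtain ⟨r, hr, s, hs, hrs, -, -, h0, -⟩ := setIntegral_eq_intervalIntegral_of_test hΩ φ
    (f := fun x => F x * φ x)
    fun x hx => by rw [image_eq_zero_of_notMem_tsupport hx, mul_zero]
  have h1 : IntegrableOn (fun x => F x * φ x) (Ioc r s) :=
    (intervalIntegrable_iff_integrableOn_Ioc_of_le hrs).1
      ((hF r hr s hs).mul_continuousOn φ.continuous.continuousOn)
  refine (integrableOn_iff_integrable_of_support_subset fun x hx => ?_).1 h1 |>.integrableOn
  by_contra hx'
  exact hx (h0 x hx')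

/-- The functional `φ ↦ ∫ F φ` on test functions. -/
def testPairing [(Ω : Set ℝ).OrdConnected] (F : ℝ → ℝ)
    (hF : ∀ x ∈ Ω, ∀ y ∈ Ω, IntervalIntegrable F volume x y) : 𝓓(Ω, ℝ) →ₗ[ℝ] ℝ where
  toFun φ := ∫ x in Ω, F x * φ x
  map_add' φ ψ := by
    rw [← integral_add (integrableOn_mul_test hF φ) (integrableOn_mul_test hF ψ)]
    refine integral_congr_ae (ae_of_all _ fun x => ?_)
    exact mul_add _ _ _
  map_smul' r φ := by
    rw [RingHom.id_apply, smul_eq_mul, ← integral_const_mul]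
    refine integral_congr_ae (ae_of_all _ fun x => ?_)
    exact mul_left_comm _ _ _

theorem exists_testFunction_integral_eq_one (hΩ : (Ω : Set ℝ).Nonempty) :
    ∃ η : 𝓓(Ω, ℝ), ∫ x, η x = 1 := by
  obtain ⟨c, hc⟩ := hΩ
  obtain ⟨ε, hε, hb⟩ := Metric.isOpen_iff.1 Ω.isOpen c hc
  let B : ContDiffBump c := ⟨ε / 4, ε / 2, by positivity, by linarith⟩
  refine ⟨⟨B.normed volume, B.contDiff_normed, B.hasCompactSupport_normed, ?_⟩,
    B.integral_normed⟩
  rw [B.tsupport_normed_eq]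
  exact (Metric.closedBall_subset_ball (by change ε / 2 < ε; linarith)).trans hb

/-- A test function with vanishing integral is the derivative of a test function. -/
theorem exists_testDeriv_eq [hI : (Ω : Set ℝ).OrdConnected] (hΩ : (Ω : Set ℝ).Nonempty)
    (θ : 𝓓(Ω, ℝ)) (hθ : ∫ x, θ x = 0) : ∃ φ : 𝓓(Ω, ℝ), testDeriv φ = θ := by
  obtain ⟨r, hr, s, hs, hrs, -, -, h0, -⟩ := setIntegral_eq_intervalIntegral_of_test hΩ θ
    (f := θ) fun x hx => image_eq_zero_of_notMem_tsupport hx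
  set φ : ℝ → ℝ := fun x => ∫ t in r..x, θ t with hφ
  have hd : ∀ x, HasDerivAt φ (θ x) x := fun x =>
    intervalIntegral.integral_hasDerivAt_right (θ.continuous.intervalIntegrable _ _)
      (θ.continuous.stronglyMeasurableAtFilter _ _) θ.continuous.continuousAt
  have hderiv : deriv φ = θ := funext fun x => (hd x).deriv
  have hsm : ContDiff ℝ ∞ φ :=
    contDiff_infty_iff_deriv.2 ⟨fun x => (hd x).differentiableAt, hderiv ▸ θ.contDiff⟩
  have hsupp : Function.support φ ⊆ Icc r s := by
    intro x hx
    by_contra hx'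
    refine hx ?_
    rw [mem_Icc, not_and_or, not_le, not_le] at hx'
    rcases hx' with hx' | hx'
    · simp only [hφ]
      rw [intervalIntegral.integral_of_ge hx'.le, neg_eq_zero]
      exact setIntegral_eq_zero_of_forall_eq_zero fun t ht =>
        h0 t fun h => absurd h.1 (not_lt.2 ht.2)
    · simp only [hφ]
      rw [intervalIntegral.integral_of_le (hrs.trans hx'.le), ← hθ]
      exact setIntegral_eq_integral_of_forall_compl_eq_zero fun t ht =>
        h0 t fun h => ht (Ioc_subset_Ioc_right hx'.le h)
  have hts : tsupport φ ⊆ Icc r s := closure_minimal hsupp isClosed_Icc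
  refine ⟨⟨φ, hsm, isCompact_Icc.of_isClosed_subset isClosed_closure hts,
    hts.trans (hI.out hr hs)⟩, ?_⟩
  ext x
  exact (hd x).deriv

theorem integrable_test (φ : 𝓓(Ω, ℝ)) : Integrable φ :=
  φ.continuous.integrable_of_hasCompactSupport φ.hasCompactSupport

/-- A functional on test functions which vanishes on derivatives is a multiple of the integral. -/
theorem exists_eq_const_mul_integral [hI : (Ω : Set ℝ).OrdConnected] (hΩ : (Ω : Set ℝ).Nonempty)
    (ℓ : 𝓓(Ω, ℝ) →ₗ[ℝ] ℝ) (hℓ : ∀ φ, ℓ (testDeriv φ) = 0) :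
    ∃ C : ℝ, ∀ φ : 𝓓(Ω, ℝ), ℓ φ = C * ∫ x, φ x := by
  obtain ⟨η, hη⟩ := exists_testFunction_integral_eq_one hΩ
  refine ⟨ℓ η, fun φ => ?_⟩
  obtain ⟨χ, hχ⟩ := exists_testDeriv_eq hΩ (φ - (∫ x, φ x) • η) (by
    have : ∫ x, (φ x - (∫ y, φ y) * η x) = 0 := by
      rw [integral_sub (integrable_test φ) ((integrable_test η).const_mul _), integral_const_mul,
        hη, mul_one, sub_self]
    exact this)
  have h1 := hℓ χ
  rw [hχ, map_sub, map_smul, smul_eq_mul] at h1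
  linarith

theorem setIntegral_test (φ : 𝓓(Ω, ℝ)) : ∫ x in Ω, φ x = ∫ x, φ x :=
  setIntegral_eq_integral_of_forall_compl_eq_zero fun _ hx =>
    image_eq_zero_of_notMem_tsupport fun h => hx (φ.tsupport_subset h)

theorem ae_eq_zero_of_testPairing {F : ℝ → ℝ}
    (hF : ∀ x ∈ Ω, ∀ y ∈ Ω, IntervalIntegrable F volume x y)
    (h : ∀ φ : 𝓓(Ω, ℝ), ∫ x in Ω, F x * φ x = 0) : ∀ᵐ x, x ∈ Ω → F x = 0 :=
  Ω.isOpen.ae_eq_zero_of_integral_contDiff_smul_eq_zero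
    (locallyIntegrableOn_of_intervalIntegrable Ω.isOpen hF) fun g hg hgc hgs => by
      have h2 := h ⟨g, hg, hgc, hgs⟩
      rw [← h2, ← setIntegral_eq_integral_of_forall_compl_eq_zero (s := Ω)]
      · exact integral_congr_ae (ae_of_all _ fun x => mul_comm _ _)
      · intro x hx
        rw [image_eq_zero_of_notMem_tsupport fun hx' => hx (hgs hx'), zero_smul]

/-- A locally integrable function whose second distributional derivative vanishes is affine. -/
theorem exists_affine_of_forall_test [hI : (Ω : Set ℝ).OrdConnected] (hΩ : (Ω : Set ℝ).Nonempty)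
    {F : ℝ → ℝ} (hF : ∀ x ∈ Ω, ∀ y ∈ Ω, IntervalIntegrable F volume x y)
    (h : ∀ φ : 𝓓(Ω, ℝ), ∫ x in Ω, F x * testDeriv (testDeriv φ) x = 0) :
    ∃ A B : ℝ, ∀ᵐ x, x ∈ Ω → F x = A + B * x := by
  -- First application: the distributional derivative of F is the constant -C, so F + Cx has zero
  -- derivative and the same lemma applies to it.
  obtain ⟨C, hC⟩ := exists_eq_const_mul_integral hΩ ((testPairing F hF).comp testDeriv) h
  have hF' : ∀ x ∈ Ω, ∀ y ∈ Ω, IntervalIntegrable (fun x => F x + C * x) volume x y :=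
    fun x hx y hy => (hF x hx y hy).add (Continuous.intervalIntegrable (by fun_prop) _ _)
  have hid : ∀ x ∈ Ω, ∀ y ∈ Ω, IntervalIntegrable (fun x => C * x) volume x y :=
    fun x _ y _ => Continuous.intervalIntegrable (by fun_prop) _ _
  obtain ⟨D, hD⟩ := exists_eq_const_mul_integral hΩ (testPairing _ hF') fun φ => by
    have h1 : ∫ x in Ω, F x * testDeriv φ x = C * ∫ x, φ x := hC φ
    have h2 : ∫ x in Ω, (C * φ x + C * x * testDeriv φ x) = 0 := by
      refine setIntegral_deriv_eq_zero φ (G := fun x => C * x * φ x) ?_ fun x hx => ?_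
      · have hl : IsPrimitiveOn (Ω : Set ℝ) (fun x => C * x) (fun _ => C) :=
          (IsPrimitiveOn.of_contDiff _ (f := fun x : ℝ => C * x) (by fun_prop)).congr_deriv_on
            fun x _ => by simp
        exact hl.mul (isPrimitiveOn_test φ)
      · rw [image_eq_zero_of_notMem_tsupport hx, image_eq_zero_of_notMem_tsupport
          fun h => hx (tsupport_testDeriv_subset φ h)]
        simp
    rw [integral_add ((integrable_test φ).const_mul C).integrableOn
      (integrableOn_mul_test hid _), integral_const_mul, setIntegral_test] at h2
    have h3 : ∫ x in Ω, (F x + C * x) * testDeriv φ x =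
        (∫ x in Ω, F x * testDeriv φ x) + ∫ x in Ω, C * x * testDeriv φ x := by
      rw [← integral_add (integrableOn_mul_test hF _) (integrableOn_mul_test hid _)]
      exact integral_congr_ae (ae_of_all _ fun x => add_mul _ _ _)
    change ∫ x in Ω, (F x + C * x) * testDeriv φ x = 0
    rw [h3, h1, h2]
  have hconst : ∀ x ∈ Ω, ∀ y ∈ Ω, IntervalIntegrable (fun _ : ℝ => D) volume x y :=
    fun x _ y _ => Continuous.intervalIntegrable (by fun_prop) _ _
  have h4 := ae_eq_zero_of_testPairing (F := fun x => F x + C * x - D)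
    (fun x hx y hy => (hF' x hx y hy).sub (hconst x hx y hy)) fun φ => by
      have h5 : ∫ x in Ω, (F x + C * x) * φ x = D * ∫ x, φ x := hD φ
      simp only [sub_mul]
      rw [integral_sub (integrableOn_mul_test hF' φ) (integrableOn_mul_test hconst φ), h5,
        integral_const_mul, setIntegral_test, sub_self]
  refine ⟨D, -C, ?_⟩
  filter_upwards [h4] with x hx hxΩ
  linarith [hx hxΩ]

/-- A weak solution of `(α h)'' - (α β h)' = q h`, where `α' = α β`, is almost everywhere equal to
a solution of the Sturm–Liouville system. -/
theorem exists_sturmSolution_of_weak [hI : (Ω : Set ℝ).OrdConnected] (hΩ : (Ω : Set ℝ).Nonempty)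
    {α β q h : ℝ → ℝ} (hα : IsPrimitiveOn Ω α (fun x => α x * β x)) (hα0 : ∀ x ∈ Ω, 0 < α x)
    (h1 : ∀ x ∈ Ω, ∀ y ∈ Ω, IntervalIntegrable (fun t => α t * h t) volume x y)
    (h2 : ∀ x ∈ Ω, ∀ y ∈ Ω, IntervalIntegrable (fun t => α t * β t * h t) volume x y)
    (h3 : ∀ x ∈ Ω, ∀ y ∈ Ω, IntervalIntegrable (fun t => q t * h t) volume x y)
    (hw : ∀ φ : 𝓓(Ω, ℝ), ∫ x in Ω, (q x * h x * φ x - α x * β x * h x * testDeriv φ x -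
      α x * h x * testDeriv (testDeriv φ) x) = 0) :
    ∃ u v, IsSturmSolution Ω (fun x => 1 / α x) q (fun _ => 0) u v ∧
      ∀ᵐ x, x ∈ Ω → h x = u x := by
  obtain ⟨c, hc⟩ := id hΩ
  -- K' = αβh and N'' = H' = qh, so the weak equation says that αh - K - N has vanishing second
  -- distributional derivative and is therefore affine. This gives an absolutely continuous version
  -- M of αh.
  set K : ℝ → ℝ := fun x => ∫ t in c..x, α t * β t * h t with hK
  set H : ℝ → ℝ := fun x => ∫ t in c..x, q t * h t with hH
  set N : ℝ → ℝ := fun x => ∫ t in c..x, H t with hN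
  have hKp : IsPrimitiveOn Ω K (fun t => α t * β t * h t) :=
    IsPrimitiveOn.of_integral Ω.isOpen hc h2 fun x _ => by simp [hK]
  have hHp : IsPrimitiveOn Ω H (fun t => q t * h t) :=
    IsPrimitiveOn.of_integral Ω.isOpen hc h3 fun x _ => by simp [hH]
  have hHc := hHp.continuousOn Ω.isOpen
  have hNp : IsPrimitiveOn Ω N H :=
    IsPrimitiveOn.of_integral Ω.isOpen hc (fun x hx y hy =>
      (hHc.mono (hI.uIcc_subset hx hy)).intervalIntegrable) fun x _ => by simp [hN]
  have hint : ∀ {f : ℝ → ℝ}, ContinuousOn f Ω → ∀ x ∈ Ω, ∀ y ∈ Ω, IntervalIntegrable f volume x y :=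
    fun hf x hx y hy => (hf.mono (hI.uIcc_subset hx hy)).intervalIntegrable
  have hKN := (hKp.add hNp).continuousOn Ω.isOpen
  obtain ⟨A, B, hAB⟩ := exists_affine_of_forall_test hΩ (F := fun x => α x * h x - (K x + N x))
    (fun x hx y hy => (h1 x hx y hy).sub (hint hKN x hx y hy)) fun φ => by
      have e1 : ∫ x in Ω, (α x * β x * h x * testDeriv φ x - q x * h x * φ x +
          (K x + N x) * testDeriv (testDeriv φ) x) = 0 := by
        refine setIntegral_deriv_eq_zero φ
          (G := fun x => (K x + N x) * testDeriv φ x - H x * φ x) ?_ fun x hx => ?_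
        · exact (((hKp.add hNp).mul (isPrimitiveOn_test (testDeriv φ))).sub
            (hHp.mul (isPrimitiveOn_test φ))).congr_deriv_on fun x _ => by ring
        · have hx1 : x ∉ tsupport (testDeriv φ) := fun h => hx (tsupport_testDeriv_subset φ h)
          have hx2 : x ∉ tsupport (testDeriv (testDeriv φ)) :=
            fun h => hx1 (tsupport_testDeriv_subset _ h)
          rw [image_eq_zero_of_notMem_tsupport hx, image_eq_zero_of_notMem_tsupport hx1,
            image_eq_zero_of_notMem_tsupport hx2]
          simp
      have i1 := integrableOn_mul_test h2 (testDeriv φ)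
      have i2 := integrableOn_mul_test h3 φ
      have i3 := integrableOn_mul_test (hint hKN) (testDeriv (testDeriv φ))
      have i4 := integrableOn_mul_test h1 (testDeriv (testDeriv φ))
      have e2 := hw φ
      have i21 : IntegrableOn (fun x => q x * h x * φ x - α x * β x * h x * testDeriv φ x) Ω :=
        i2.sub i1
      have i12 : IntegrableOn (fun x => α x * β x * h x * testDeriv φ x - q x * h x * φ x) Ω :=
        i1.sub i2
      rw [integral_sub i21 i4, integral_sub i2 i1] at e2
      rw [integral_add i12 i3, integral_sub i1 i2] at e1
      simp only [sub_mul]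
      rw [integral_sub i4 i3]
      linarith
  set M : ℝ → ℝ := fun x => A + B * x + (K x + N x) with hM
  have hMh : ∀ᵐ x, x ∈ Ω → α x * h x = M x := by
    filter_upwards [hAB] with x hx hxΩ
    have := hx hxΩ
    simp only [hM]
    linarith
  have hMp : IsPrimitiveOn Ω M (fun x => B + (α x * β x * h x + H x)) := by
    have hl : IsPrimitiveOn (Ω : Set ℝ) (fun x => A + B * x) (fun _ => B) :=
      (IsPrimitiveOn.of_contDiff _ (f := fun x : ℝ => A + B * x) (by fun_prop)).congr_deriv_on
        fun x _ => by simp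
    exact hl.add (hKp.add hNp)
  have hαi : IsPrimitiveOn Ω (fun x => (α x)⁻¹) (fun x => -(β x * (α x)⁻¹)) := by
    refine (hα.comp (g := fun t => t⁻¹) (U := Ioi 0) isOpen_Ioi hα0
      ((contDiffOn_inv ℝ).mono fun t ht => ne_of_gt ht)).congr_deriv_on fun x hx => ?_
    rw [deriv_inv]
    have := (hα0 x hx).ne'
    field_simp
  have hmain : ∀ᵐ x, x ∈ Ω → h x = M x * (α x)⁻¹ := by
    filter_upwards [hMh] with x hx hxΩ
    rw [← hx hxΩ]
    have := (hα0 x hxΩ).ne'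
    field_simp
  -- As M' = B + αβh + H and αh = M almost everywhere, the β-terms cancel in α(M/α)' and leave v = B
  -- + H.
  refine ⟨fun x => M x * (α x)⁻¹, fun x => B + H x, ⟨(hMp.mul hαi).congr_deriv ?_,
    ((IsPrimitiveOn.const _ B).add hHp).congr_deriv ?_⟩, hmain⟩
  · filter_upwards [hMh] with x hx hxΩ
    rw [← hx hxΩ]
    have := (hα0 x hxΩ).ne'
    field_simp
    ring
  · filter_upwards [hmain] with x hx hxΩ
    rw [← hx hxΩ]
    ring

end Weak

/-! ### The Sturm–Liouville data of the one-dimensional operator -/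

section Feller

variable {x₀ y₀ : EReal} {a b V : ℝ → ℝ} {c lam : ℝ}

instance ordConnected_openInterval (x₀ y₀ : EReal) :
    (openInterval x₀ y₀ : Set ℝ).OrdConnected :=
  ⟨fun _ hx _ hy _ hz => ⟨hx.1.trans_le (EReal.coe_le_coe_iff.2 hz.1),
    (EReal.coe_le_coe_iff.2 hz.2).trans_lt hy.2⟩⟩

theorem LocLp.memLp_uIoc {p : ℝ≥0∞} {f : ℝ → ℝ} (hf : LocLp p x₀ y₀ f) {x y : ℝ}
    (hx : x ∈ openInterval x₀ y₀) (hy : y ∈ openInterval x₀ y₀) :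
    MemLp f p (volume.restrict (uIoc x y)) :=
  (hf _ _ ((ordConnected_openInterval x₀ y₀).uIcc_subset hx hy)).mono_measure
    (Measure.restrict_mono uIoc_subset_uIcc le_rfl)

theorem LocLp.intervalIntegrable {f : ℝ → ℝ} (hf : LocLp 1 x₀ y₀ f) {x y : ℝ}
    (hx : x ∈ openInterval x₀ y₀) (hy : y ∈ openInterval x₀ y₀) :
    IntervalIntegrable f volume x y :=
  intervalIntegrable_iff.2 (memLp_one_iff_integrable.1 (hf.memLp_uIoc hx hy))

theorem LocLp.mul_intervalIntegrable {f g : ℝ → ℝ} (hf : LocLp ∞ x₀ y₀ f) {x y : ℝ}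
    (hx : x ∈ openInterval x₀ y₀) (hy : y ∈ openInterval x₀ y₀)
    (hg : IntervalIntegrable g volume x y) :
    IntervalIntegrable (fun t => f t * g t) volume x y :=
  intervalIntegrable_iff.2 (hg.def'.mul_of_top_right (hf.memLp_uIoc hx hy))

theorem fellerScale_pos (a b : ℝ → ℝ) (c x : ℝ) : 0 < fellerScale a b c x := Real.exp_pos _

namespace Admissible

theorem ae_a_pos (h : Admissible x₀ y₀ a b V) : ∀ᵐ x, x ∈ openInterval x₀ y₀ → 0 < a x :=
  (ae_restrict_iff' (openInterval x₀ y₀).isOpen.measurableSet).1 h.a_pos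

theorem ae_V_nonneg (h : Admissible x₀ y₀ a b V) : ∀ᵐ x, x ∈ openInterval x₀ y₀ → 0 ≤ V x :=
  (ae_restrict_iff' (openInterval x₀ y₀).isOpen.measurableSet).1 h.V_nonneg

theorem isPrimitiveOn_fellerScale (h : Admissible x₀ y₀ a b V) (hc : c ∈ openInterval x₀ y₀) :
    IsPrimitiveOn (openInterval x₀ y₀) (fellerScale a b c)
      (fun x => fellerScale a b c x * (b x / a x)) := by
  have h1 : IsPrimitiveOn (openInterval x₀ y₀) (fun x => ∫ t in c..x, b t / a t)
      (fun t => b t / a t) :=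
    IsPrimitiveOn.of_integral (openInterval x₀ y₀).isOpen hc
      (fun x hx y hy => h.b_div_a_loc.intervalIntegrable hx hy) fun x _ => by simp
  refine (h1.comp (g := Real.exp) isOpen_univ (fun _ _ => mem_univ _)
    Real.contDiff_exp.contDiffOn).congr_deriv_on fun x _ => ?_
  rw [Real.deriv_exp]
  rfl

theorem continuousOn_fellerScale (h : Admissible x₀ y₀ a b V) (hc : c ∈ openInterval x₀ y₀) :
    ContinuousOn (fellerScale a b c) (openInterval x₀ y₀) :=
  (h.isPrimitiveOn_fellerScale hc).continuousOn (openInterval x₀ y₀).isOpen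

theorem isWeight (h : Admissible x₀ y₀ a b V) (hc : c ∈ openInterval x₀ y₀) :
    IsWeight (openInterval x₀ y₀) (fellerSpeed a b c) where
  isOpen := (openInterval x₀ y₀).isOpen
  ordConnected := ordConnected_openInterval x₀ y₀
  pos := by
    filter_upwards [h.ae_a_pos] with x hx hxI
    have := hx hxI
    exact mul_pos (one_div_pos.2 this) (Real.exp_pos _)
  intervalIntegrable x hx y hy :=
    (h.inv_a_loc.intervalIntegrable hx hy).mul_continuousOn ((h.continuousOn_fellerScale hc).mono
      ((ordConnected_openInterval x₀ y₀).uIcc_subset hx hy))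

theorem isWeightedSturmLiouville (h : Admissible x₀ y₀ a b V) (hc : c ∈ openInterval x₀ y₀)
    (hlam : 0 < lam) :
    IsWeightedSturmLiouville (openInterval x₀ y₀) (fun x => 1 / fellerScale a b c x)
      (fun x => fellerSpeed a b c x * (lam + V x)) (fellerSpeed a b c) lam where
  sturm :=
    { isOpen := (openInterval x₀ y₀).isOpen
      ordConnected := ordConnected_openInterval x₀ y₀
      continuousOn := continuousOn_const.div (h.continuousOn_fellerScale hc)
        fun x _ => (fellerScale_pos a b c x).ne'
      p_pos := fun x _ => one_div_pos.2 (fellerScale_pos a b c x)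
      intervalIntegrable := fun x hx y hy => by
        have h1 := (h.isWeight hc).intervalIntegrable x hx y hy
        refine ((h1.const_mul lam).add (h.V_loc.mul_intervalIntegrable hx hy h1)).congr
          fun t _ => ?_
        ring
      q_pos := by
        filter_upwards [(h.isWeight hc).pos, h.ae_V_nonneg] with x h1 h2 hx
        exact mul_pos (h1 hx) (add_pos_of_pos_of_nonneg hlam (h2 hx)) }
  weight := h.isWeight hc
  lam_pos := hlam
  le := by
    filter_upwards [(h.isWeight hc).pos, h.ae_V_nonneg] with x h1 h2 hx
    have := mul_nonneg (h1 hx).le (h2 hx)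
    linarith

theorem ae_fellerSpeed_mul (h : Admissible x₀ y₀ a b V) :
    ∀ᵐ x, x ∈ openInterval x₀ y₀ → fellerSpeed a b c x * a x = fellerScale a b c x ∧
      fellerSpeed a b c x * b x = fellerScale a b c x * (b x / a x) := by
  filter_upwards [h.ae_a_pos] with x hx hxI
  have := (hx hxI).ne'
  rw [fellerSpeed, ← fellerScale]
  constructor <;> field_simp

/-- Divergence form: ρa = α and ρb = α', so ψ = αφ' satisfies ψ' = ρ(aφ'' + bφ'). -/
theorem isTestOperator (h : Admissible x₀ y₀ a b V) (hc : c ∈ openInterval x₀ y₀) :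
    IsTestOperator (openInterval x₀ y₀) (fun x => 1 / fellerScale a b c x)
      (fun x => fellerSpeed a b c x * (lam + V x)) (fellerSpeed a b c) lam
      (fun φ x => a x * deriv (deriv φ) x + b x * deriv φ x - V x * φ x) where
  memLp φ := h.memLp_operator φ (speedMeasure_absolutelyContinuous x₀ y₀ a b c)
  eq_zero φ x hx := by
    have h1 : x ∉ tsupport (testDeriv φ) := fun h => hx (tsupport_testDeriv_subset φ h)
    have h2 : x ∉ tsupport (testDeriv (testDeriv φ)) :=
      fun h => h1 (tsupport_testDeriv_subset _ h)
    have e1 : deriv φ x = 0 := image_eq_zero_of_notMem_tsupport h1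
    have e2 : deriv (deriv φ) x = 0 := image_eq_zero_of_notMem_tsupport h2
    rw [e1, e2, image_eq_zero_of_notMem_tsupport hx]
    ring
  exists_sol φ := by
    refine ⟨fun x => fellerScale a b c x * testDeriv φ x,
      ⟨(isPrimitiveOn_test φ).congr_deriv_on fun x _ => ?_,
        ((h.isPrimitiveOn_fellerScale hc).mul (isPrimitiveOn_test (testDeriv φ))).congr_deriv ?_⟩,
      fun x hx => ?_⟩
    · have := (fellerScale_pos a b c x).ne'
      field_simp
    · filter_upwards [h.ae_fellerSpeed_mul] with x hx hxI
      obtain ⟨e1, e2⟩ := hx hxI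
      change fellerScale a b c x * (b x / a x) * deriv φ x +
        fellerScale a b c x * deriv (deriv φ) x = _
      rw [← e2, ← e1]
      ring
    · change fellerScale a b c x * testDeriv φ x = 0
      rw [image_eq_zero_of_notMem_tsupport fun h => hx (tsupport_testDeriv_subset φ h), mul_zero]

theorem denseRange_testInclusion (h : Admissible x₀ y₀ a b V) (hc : c ∈ openInterval x₀ y₀) :
    DenseRange (testInclusion x₀ y₀ (speedMeasure x₀ y₀ a b c)) := by
  have hρ := h.isWeight hc
  refine denseRange_of_forall_functional _ fun ℓ hℓ => ?_
  obtain ⟨k, hk⟩ := LInftyC.exists_eq_toDual (m := weightMeasure (openInterval x₀ y₀)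
    (fellerSpeed a b c)) ℓ
  have h1 : k =ᵐ[weightMeasure (openInterval x₀ y₀) (fellerSpeed a b c)] 0 :=
    hρ.ae_eq_zero_of_forall_test
      (fun x hx y hy => hρ.intervalIntegrable_of_integrable (integrable_coeFn_one k) hx hy)
      fun φ => by
        have h2 := (hk _).symm.trans (hℓ φ)
        rw [← h2]
        refine Eq.trans ?_ (LInftyC.toDual_mk (IsWeight.memLp_top_testFunction φ _) k).symm
        exact integral_congr_ae (ae_of_all _ fun x => mul_comm _ _)
  have h2 : k = 0 := by
    rw [Lp.eq_zero_iff_ae_eq_zero]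
    exact h1
  ext f
  refine (hk f).trans ?_
  rw [h2, map_zero]
  rfl

theorem isPreGenerator (h : Admissible x₀ y₀ a b V) (hc : c ∈ openInterval x₀ y₀) :
    IsPreGenerator (testInclusion x₀ y₀ (speedMeasure x₀ y₀ a b c)) (schrodingerOperator h c) := by
  refine ⟨h.denseRange_testInclusion hc, ?_⟩
  -- The spectral parameter is arbitrary for generation; 1 is used.
  have hS := h.isWeightedSturmLiouville hc one_pos
  obtain ⟨W, h₁, v₁, h₂, v₂, hP, -⟩ := hS.sturm.exists_decayingPair hc
  have hA := h.isTestOperator (lam := 1) hc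
  obtain ⟨S, hS'⟩ := (hS.isMDissipative hP hA ⟨c, hc⟩).exists_c0Semigroup
    LInftyC.isUniformInducing_dualEquiv
  exact ⟨S, fun φ => hS' _ _ fun x y hxy => hS.toDual_eq hA φ hxy⟩

/-- An integrable solution of the homogeneous equation prevents uniqueness. -/
theorem not_isUniquePreGenerator (h : Admissible x₀ y₀ a b V) (hc : c ∈ openInterval x₀ y₀)
    (hlam : 0 < lam) {u v : ℝ → ℝ}
    (hu : IsSturmSolution (openInterval x₀ y₀) (fun x => 1 / fellerScale a b c x)
      (fun x => fellerSpeed a b c x * (lam + V x)) (fun _ => 0) u v)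
    (hui : Integrable u (weightMeasure (openInterval x₀ y₀) (fellerSpeed a b c)))
    (hu0 : ∀ x ∈ openInterval x₀ y₀, 0 < u x) :
    ¬ IsUniquePreGenerator (testInclusion x₀ y₀ (speedMeasure x₀ y₀ a b c))
      (schrodingerOperator h c) := by
  rintro ⟨-, S, -, huniq⟩
  have hS := h.isWeightedSturmLiouville hc hlam
  obtain ⟨W, h₁, v₁, h₂, v₂, hP, -⟩ := hS.sturm.exists_decayingPair hc
  have hA := h.isTestOperator (lam := lam) hc
  have hk0 : (memLp_one_iff_integrable.2 hui).toLp u ≠ 0 := by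
    intro he
    have h1 := (memLp_one_iff_integrable.2 hui).coeFn_toLp
    rw [he] at h1
    have h2 : ∀ᵐ x, x ∈ (openInterval x₀ y₀ : Set ℝ) → (0 : ℝ) = u x :=
      hS.weight.ae_iff.1 ((Lp.coeFn_zero ℝ 1 _).symm.trans h1)
    have h3 : volume (openInterval x₀ y₀ : Set ℝ) = 0 :=
      measure_mono_null (fun t ht => fun he' => (hu0 t ht).ne (he' ht)) h2
    exact ((openInterval x₀ y₀).isOpen.measure_pos volume ⟨c, hc⟩).ne' h3
  obtain ⟨S₁, S₂, hne, hgen⟩ := (hS.isMDissipative hP hA ⟨c, hc⟩).exists_two_c0Semigroups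
    LInftyC.isUniformInducing_dualEquiv hlam hk0
  have hg : ∀ φ, S₁.HasGenerator (testInclusion x₀ y₀ (speedMeasure x₀ y₀ a b c) φ)
      (schrodingerOperator h c φ) ∧ S₂.HasGenerator
      (testInclusion x₀ y₀ (speedMeasure x₀ y₀ a b c) φ) (schrodingerOperator h c φ) := fun φ => by
    refine hgen _ _ (fun x y hxy => hS.toDual_eq hA φ hxy) ?_
    have h1 := hS.integral_mul_solution hA hu φ
    rw [← h1]
    exact LInftyC.toDual_mk_toLp (((IsWeight.memLp_top_testFunction φ _).const_mul lam).sub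
      (hA.memLp φ)) (memLp_one_iff_integrable.2 hui)
  exact hne ((huniq S₁ fun φ => (hg φ).1).trans (huniq S₂ fun φ => (hg φ).2).symm)

/-- If for all large `μ` the homogeneous equation has no nonzero integrable solution, then the
operator is unique. -/
theorem isUniquePreGenerator (h : Admissible x₀ y₀ a b V) (hc : c ∈ openInterval x₀ y₀)
    (H : ∀ μ, lam ≤ μ → ∀ u v, IsSturmSolution (openInterval x₀ y₀)
      (fun x => 1 / fellerScale a b c x) (fun x => fellerSpeed a b c x * (μ + V x)) (fun _ => 0)
      u v → Integrable u (weightMeasure (openInterval x₀ y₀) (fellerSpeed a b c)) →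
      ∀ x ∈ openInterval x₀ y₀, u x = 0) :
    IsUniquePreGenerator (testInclusion x₀ y₀ (speedMeasure x₀ y₀ a b c))
      (schrodingerOperator h c) := by
  obtain ⟨hd, S, hS⟩ := h.isPreGenerator hc
  refine ⟨⟨hd, S, hS⟩, S, hS, fun S' hS' => ?_⟩
  have hρ := h.isWeight hc
  have : T2Space (LInftyC (speedMeasure x₀ y₀ a b c)) :=
    t2Space_of_isUniformInducing (LInftyC.isUniformInducing_dualEquiv
      (m := weightMeasure (openInterval x₀ y₀) (fellerSpeed a b c)))
  refine C0Semigroup.eq_of_generatorExtends (lam := lam) (fun μ hμ ℓ hℓ => ?_) hS' hS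
  obtain ⟨k, hk⟩ := LInftyC.exists_eq_toDual (m := weightMeasure (openInterval x₀ y₀)
    (fellerSpeed a b c)) ℓ
  have hki := integrable_coeFn_one k
  have hkl := fun x hx y hy => hρ.intervalIntegrable_of_integrable hki (x := x) (y := y) hx hy
  have hA := h.isTestOperator (lam := μ) hc
  have hae := h.ae_fellerSpeed_mul (c := c)
  have hcongr : ∀ {f g : ℝ → ℝ}, (∀ᵐ x, x ∈ openInterval x₀ y₀ → f x = g x) →
      ∀ x ∈ openInterval x₀ y₀, ∀ y ∈ openInterval x₀ y₀,
      IntervalIntegrable f volume x y → IntervalIntegrable g volume x y :=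
    fun hfg x hx y hy hf => hf.congr_ae ((ae_restrict_iff' measurableSet_uIoc).2
      (hfg.mono fun t ht h' => ht ((uIoc_subset_uIcc.trans
        ((ordConnected_openInterval x₀ y₀).uIcc_subset hx hy)) h')))
  -- A functional vanishing on the range of μ - A is an integrable weak solution k. The local bounds
  -- on a, b, V make αk, α(b/a)k and qk locally integrable, as the regularity result requires.
  obtain ⟨u, v, hu, hku⟩ := exists_sturmSolution_of_weak (Ω := openInterval x₀ y₀) ⟨c, hc⟩
    (β := fun x => b x / a x) (q := fun x => fellerSpeed a b c x * (μ + V x)) (h := k)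
    (h.isPrimitiveOn_fellerScale hc) (fun x _ => fellerScale_pos a b c x)
    (fun x hx y hy => hcongr (hae.mono fun t ht htI => by
      rw [← (ht htI).1]; ring) x hx y hy (h.a_loc.mul_intervalIntegrable hx hy (hkl x hx y hy)))
    (fun x hx y hy => hcongr (hae.mono fun t ht htI => by
      rw [← (ht htI).2]; ring) x hx y hy (h.b_loc.mul_intervalIntegrable hx hy (hkl x hx y hy)))
    (fun x hx y hy => (((hkl x hx y hy).const_mul μ).add
      (h.V_loc.mul_intervalIntegrable hx hy (hkl x hx y hy))).congr fun t _ => by ring)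
    fun φ => by
      have h1 := (hk _).symm.trans (hℓ φ)
      have h2 := (LInftyC.toDual_mk (((IsWeight.memLp_top_testFunction φ _).const_mul μ).sub
        (hA.memLp φ)) k).symm.trans h1
      rw [hρ.integral_eq] at h2
      rw [← h2]
      refine integral_congr_ae ((ae_restrict_iff'
        (openInterval x₀ y₀).isOpen.measurableSet).2 ?_)
      filter_upwards [hae] with x hx hxI
      obtain ⟨e1, e2⟩ := hx hxI
      rw [← e2, ← e1]
      change _ = fellerSpeed a b c x * ((μ * φ x - (a x * deriv (deriv φ) x + b x * deriv φ x -
        V x * φ x)) * k x)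
      change _ - _ * deriv φ x - _ * deriv (deriv φ) x = _
      ring
  have h3 : k =ᵐ[weightMeasure (openInterval x₀ y₀) (fellerSpeed a b c)] u := hρ.ae_iff.2 hku
  have h4 := H μ hμ u v hu (hki.congr h3)
  have h5 : k = 0 := by
    rw [Lp.eq_zero_iff_ae_eq_zero]
    refine hρ.ae_iff.2 ?_
    filter_upwards [hku] with x hx hxI
    rw [hx hxI, h4 x hxI]
    rfl
  ext f
  refine (hk f).trans ?_
  rw [h5, map_zero]
  rfl

end Admissible

end Feller

/-! ### The uniqueness criterion -/

section Criterion

/-- Needed to pass from λ to all larger parameters: divergence of the integrals is inherited when q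
grows. -/
theorem sturmIter_mono {I : Set ℝ} [hI : I.OrdConnected] {p q q' : ℝ → ℝ} {c : ℝ} (hc : c ∈ I)
    (h : ∀ᵐ x, x ∈ I → q x ≤ q' x) (n : ℕ) :
    ∀ y ∈ I, sturmIter p q c n y ≤ sturmIter p q' c n y := by
  have hsub : ∀ {y}, y ∈ I → uIoc c y ⊆ I := fun hy =>
    uIoc_subset_uIcc.trans (hI.uIcc_subset hc hy)
  induction n with
  | zero => exact fun _ _ => le_refl (1 : ℝ≥0∞)
  | succ n ih =>
    intro y hy
    refine setLIntegral_mono_ae' measurableSet_uIoc (ae_of_all _ fun r hr => ?_)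
    refine mul_le_mul_right (setLIntegral_mono_ae' measurableSet_uIoc ?_) _
    filter_upwards [h] with t ht htr
    have htI := hsub (hsub hy hr) htr
    exact mul_le_mul' (ENNReal.ofReal_le_ofReal (ht htI)) (ih t htI)

theorem sturmSum_mono {I : Set ℝ} [hI : I.OrdConnected] {p q q' : ℝ → ℝ} {c : ℝ} (hc : c ∈ I)
    (h : ∀ᵐ x, x ∈ I → q x ≤ q' x) {y : ℝ} (hy : y ∈ I) :
    sturmSum p q c y ≤ sturmSum p q' c y :=
  ENNReal.tsum_le_tsum fun n => sturmIter_mono hc h n y hy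

namespace IsWeightedSturmLiouville

variable {I : Set ℝ} {p q ρ : ℝ → ℝ} {lam W c : ℝ} {h₁ v₁ h₂ v₂ u v : ℝ → ℝ}

theorem integrableOn_iff_lintegral_ne_top (hS : IsWeightedSturmLiouville I p q ρ lam)
    {s : Set ℝ} (hs : MeasurableSet s) (hsI : s ⊆ I) {h : ℝ → ℝ} (hh : ContinuousOn h I)
    (h0 : ∀ x ∈ I, 0 < h x) {U : ℝ → ℝ≥0∞} {K : ℝ}
    (hK : ∀ x ∈ s, U x ≤ ENNReal.ofReal (K * h x) ∧
      ENNReal.ofReal (h x) ≤ ENNReal.ofReal K * U x) :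
    IntegrableOn (fun x => ρ x * h x) s ↔ ∫⁻ x in s, ENNReal.ofReal (ρ x) * U x ≠ ⊤ := by
  have hae : ∀ᵐ x ∂volume.restrict s, ‖ρ x * h x‖ₑ = ENNReal.ofReal (ρ x) * ENNReal.ofReal (h x) :=
    (ae_restrict_iff' hs).2 <| hS.weight.pos.mono fun x hx hxs => by
      have h1 := hx (hsI hxs)
      rw [Real.enorm_of_nonneg (mul_pos h1 (h0 x (hsI hxs))).le, ENNReal.ofReal_mul h1.le]
  have h1 : IntegrableOn (fun x => ρ x * h x) s ↔
      ∫⁻ x in s, ENNReal.ofReal (ρ x) * ENNReal.ofReal (h x) ≠ ⊤ := by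
    rw [← lintegral_congr_ae hae, ← lt_top_iff_ne_top]
    exact and_iff_right ((hS.aestronglyMeasurable_mul hh).mono_measure
      (Measure.restrict_mono hsI le_rfl))
  rw [h1]
  constructor
  · refine fun h => ne_top_of_le_ne_top (ENNReal.mul_ne_top (ENNReal.ofReal_ne_top (r := K)) h) ?_
    rw [← lintegral_const_mul' _ _ ENNReal.ofReal_ne_top]
    refine setLIntegral_mono' hs fun x hx => ?_
    refine (mul_le_mul_right (hK x hx).1 _).trans ?_
    rw [ENNReal.ofReal_mul' (h0 x (hsI hx)).le, mul_left_comm]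
  · refine fun h => ne_top_of_le_ne_top (ENNReal.mul_ne_top (ENNReal.ofReal_ne_top (r := K)) h) ?_
    rw [← lintegral_const_mul' _ _ ENNReal.ofReal_ne_top]
    refine setLIntegral_mono' hs fun x hx => ?_
    refine (mul_le_mul_right (hK x hx).2 _).trans ?_
    rw [mul_left_comm]

/-- The two integrals of the sum of the Picard iterates decide whether the homogeneous equation has
an integrable solution. -/
theorem eq_zero_of_integrable (hS : IsWeightedSturmLiouville I p q ρ lam) (hc : c ∈ I)
    (hr : ∫⁻ x in I ∩ Ioi c, ENNReal.ofReal (ρ x) * sturmSum p q c x = ⊤)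
    (hl : ∫⁻ x in I ∩ Iic c, ENNReal.ofReal (ρ x) * sturmSum p q c x = ⊤)
    (hu : IsSturmSolution I p q (fun _ => 0) u v) (hui : Integrable u (weightMeasure I ρ)) :
    ∀ x ∈ I, u x = 0 := by
  have := hS.sturm.ordConnected
  have hm := hS.sturm.isOpen.measurableSet
  obtain ⟨W, h₁, v₁, h₂, v₂, hP, K, -, hKr, hKl⟩ := hS.sturm.exists_decayingPair hc
  obtain ⟨C₁, C₂, hC⟩ := hP.exists_eq_combination hu
  rw [hS.weight.integrable_iff] at hui
  -- At the right end u and h₁ are integrable, so a nonzero C₂ would make h₂ integrable there. Being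
  -- comparable with the Picard sum, h₂ would contradict the divergence.
  have e2 : C₂ = 0 := by
    by_contra hne
    refine (hS.integrableOn_iff_lintegral_ne_top (hm.inter measurableSet_Ioi) inter_subset_left
      (hP.sol₂.fst.continuousOn hS.sturm.isOpen) hP.pos₂
      fun x hx => hKr x hx.1 hx.2.le).1 ?_ hr
    refine IntegrableOn.congr_fun (((hui.mono_set inter_subset_left).sub
      ((hS.integrableOn_right hP hc).const_mul C₁)).const_mul C₂⁻¹) (fun x hx => ?_)
      (hm.inter measurableSet_Ioi)
    simp only [Pi.sub_apply]
    rw [hC x hx.1]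
    field_simp
    ring
  have e1 : C₁ = 0 := by
    by_contra hne
    refine (hS.integrableOn_iff_lintegral_ne_top (hm.inter measurableSet_Iic) inter_subset_left
      (hP.sol₁.fst.continuousOn hS.sturm.isOpen) hP.pos₁
      fun x hx => hKl x hx.1 hx.2).1 ?_ hl
    refine IntegrableOn.congr_fun (((hui.mono_set inter_subset_left).sub
      ((hS.integrableOn_left hP hc).const_mul C₂)).const_mul C₁⁻¹) (fun x hx => ?_)
      (hm.inter measurableSet_Iic)
    simp only [Pi.sub_apply]
    rw [hC x hx.1]
    field_simp
    ring
  intro x hx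
  rw [hC x hx, e1, e2]
  ring

/-- Each of h₁ and h₂ is automatically integrable at one end; finiteness of the integral at its
other end makes it integrable on all of I. -/
theorem exists_integrable_solution (hS : IsWeightedSturmLiouville I p q ρ lam) (hc : c ∈ I)
    (h : ¬ (∫⁻ x in I ∩ Ioi c, ENNReal.ofReal (ρ x) * sturmSum p q c x = ⊤ ∧
      ∫⁻ x in I ∩ Iic c, ENNReal.ofReal (ρ x) * sturmSum p q c x = ⊤)) :
    ∃ u v, IsSturmSolution I p q (fun _ => 0) u v ∧ Integrable u (weightMeasure I ρ) ∧
      ∀ x ∈ I, 0 < u x := by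
  have hm := hS.sturm.isOpen.measurableSet
  obtain ⟨W, h₁, v₁, h₂, v₂, hP, K, -, hKr, hKl⟩ := hS.sturm.exists_decayingPair hc
  have hunion : I ∩ Iic c ∪ I ∩ Ioi c = I := by rw [← inter_union_distrib_left, Iic_union_Ioi,
    inter_univ]
  by_cases hr : ∫⁻ x in I ∩ Ioi c, ENNReal.ofReal (ρ x) * sturmSum p q c x = ⊤
  · have hl := fun hl => h ⟨hr, hl⟩
    refine ⟨h₁, v₁, hP.sol₁, hS.weight.integrable_iff.2 ?_, hP.pos₁⟩
    rw [← hunion]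
    exact ((hS.integrableOn_iff_lintegral_ne_top (hm.inter measurableSet_Iic) inter_subset_left
      (hP.sol₁.fst.continuousOn hS.sturm.isOpen) hP.pos₁
      fun x hx => hKl x hx.1 hx.2).2 hl).union (hS.integrableOn_right hP hc)
  · refine ⟨h₂, v₂, hP.sol₂, hS.weight.integrable_iff.2 ?_, hP.pos₂⟩
    rw [← hunion]
    exact (hS.integrableOn_left hP hc).union
      ((hS.integrableOn_iff_lintegral_ne_top (hm.inter measurableSet_Ioi) inter_subset_left
      (hP.sol₂.fst.continuousOn hS.sturm.isOpen) hP.pos₂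
      fun x hx => hKr x hx.1 hx.2.le).2 hr)

end IsWeightedSturmLiouville

variable {x₀ y₀ : EReal} {a b V : ℝ → ℝ} {c lam : ℝ}

/-- A positive integrable solution at λ destroys uniqueness. Conversely, divergence at λ persists
for every μ ≥ λ by monotonicity, and large μ are all that the Laplace transform argument uses. -/
theorem Admissible.isUniquePreGenerator_iff (h : Admissible x₀ y₀ a b V)
    (hc : c ∈ openInterval x₀ y₀) (hlam : 0 < lam) :
    IsUniquePreGenerator (testInclusion x₀ y₀ (speedMeasure x₀ y₀ a b c))
      (schrodingerOperator h c) ↔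
    ∫⁻ x in openInterval x₀ y₀ ∩ Ioi c, ENNReal.ofReal (fellerSpeed a b c x) *
      sturmSum (fun x => 1 / fellerScale a b c x)
        (fun x => fellerSpeed a b c x * (lam + V x)) c x = ⊤ ∧
    ∫⁻ x in openInterval x₀ y₀ ∩ Iic c, ENNReal.ofReal (fellerSpeed a b c x) *
      sturmSum (fun x => 1 / fellerScale a b c x)
        (fun x => fellerSpeed a b c x * (lam + V x)) c x = ⊤ := by
  constructor
  · intro hun
    by_contra hne
    obtain ⟨u, v, hu, hui, hu0⟩ :=
      (h.isWeightedSturmLiouville hc hlam).exists_integrable_solution hc hne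
    exact h.not_isUniquePreGenerator hc hlam hu hui hu0 hun
  · rintro ⟨hr, hl⟩
    refine h.isUniquePreGenerator hc (lam := lam) fun μ hμ u v hu hui => ?_
    have hm := (openInterval x₀ y₀).isOpen.measurableSet
    have hle : ∀ᵐ x, x ∈ (openInterval x₀ y₀ : Set ℝ) →
        fellerSpeed a b c x * (lam + V x) ≤ fellerSpeed a b c x * (μ + V x) := by
      filter_upwards [(h.isWeight hc).pos] with x hx hxI
      have := hx hxI
      gcongr
    refine (h.isWeightedSturmLiouville hc (hlam.trans_le hμ)).eq_zero_of_integrable hc ?_ ?_ hu hui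
    · refine top_unique (hr.symm.le.trans (setLIntegral_mono' (hm.inter measurableSet_Ioi)
        fun x hx => ?_))
      exact mul_le_mul_right (sturmSum_mono hc hle hx.1) _
    · refine top_unique (hl.symm.le.trans (setLIntegral_mono' (hm.inter measurableSet_Iic)
        fun x hx => ?_))
      exact mul_le_mul_right (sturmSum_mono hc hle hx.1) _

theorem phiIter_eq_sturmIter (a b V : ℝ → ℝ) (lam c : ℝ) (n : ℕ) : ∀ y, c ≤ y →
    phiIter a b V lam c n y = sturmIter (fun x => 1 / fellerScale a b c x)
      (fun x => fellerSpeed a b c x * (lam + V x)) c n y := by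
  induction n with
  | zero => exact fun _ _ => rfl
  | succ n ih =>
    intro y hy
    rw [phiIter, sturmIter, uIoc_of_le hy]
    refine setLIntegral_congr_fun measurableSet_Ioc fun r hr => ?_
    rw [uIoc_of_le hr.1.le]
    congr 1
    refine setLIntegral_congr_fun measurableSet_Ioc fun t ht => ?_
    rw [ih t ht.1.le]

theorem psiIter_eq_sturmIter (a b V : ℝ → ℝ) (lam c : ℝ) (n : ℕ) : ∀ y, y ≤ c →
    psiIter a b V lam c n y = sturmIter (fun x => 1 / fellerScale a b c x)
      (fun x => fellerSpeed a b c x * (lam + V x)) c n y := by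
  induction n with
  | zero => exact fun _ _ => rfl
  | succ n ih =>
    intro y hy
    rw [psiIter, sturmIter, uIoc_of_ge hy]
    refine setLIntegral_congr_fun measurableSet_Ioc fun r hr => ?_
    rw [uIoc_of_ge hr.2]
    congr 1
    refine setLIntegral_congr_fun measurableSet_Ioc fun t ht => ?_
    rw [ih t ht.2]

theorem setLIntegral_right_eq (hc : c ∈ openInterval x₀ y₀) {f g : ℝ → ℝ≥0∞}
    (h : ∀ y, c ≤ y → f y = g y) :
    ∫⁻ y in {y : ℝ | c < y ∧ (y : EReal) < y₀}, f y = ∫⁻ y in openInterval x₀ y₀ ∩ Ioi c, g y := by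
  have h1 : {y : ℝ | c < y ∧ (y : EReal) < y₀} = (openInterval x₀ y₀ : Set ℝ) ∩ Ioi c := by
    ext y
    exact ⟨fun hy => ⟨⟨hc.1.trans (EReal.coe_lt_coe_iff.2 hy.1), hy.2⟩, hy.1⟩,
      fun hy => ⟨hy.2, hy.1.2⟩⟩
  rw [h1]
  exact setLIntegral_congr_fun ((openInterval x₀ y₀).isOpen.measurableSet.inter measurableSet_Ioi)
    fun y hy => h y hy.2.le

theorem setLIntegral_left_eq (hc : c ∈ openInterval x₀ y₀) {f g : ℝ → ℝ≥0∞}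
    (h : ∀ y, y ≤ c → f y = g y) :
    ∫⁻ y in {x : ℝ | x₀ < (x : EReal) ∧ x < c}, f y = ∫⁻ y in openInterval x₀ y₀ ∩ Iic c, g y := by
  have h1 : {x : ℝ | x₀ < (x : EReal) ∧ x < c} = (openInterval x₀ y₀ : Set ℝ) ∩ Iio c := by
    ext y
    exact ⟨fun hy => ⟨⟨hy.1, (EReal.coe_lt_coe_iff.2 hy.2).trans hc.2⟩, hy.2⟩,
      fun hy => ⟨hy.1.1, hy.2⟩⟩
  have h2 : (openInterval x₀ y₀ ∩ Iio c : Set ℝ) =ᵐ[volume] (openInterval x₀ y₀ ∩ Iic c : Set ℝ) :=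
    ae_eq_set_inter (EventuallyEq.refl _ _) Iio_ae_eq_Iic
  rw [h1, setLIntegral_congr h2]
  exact setLIntegral_congr_fun ((openInterval x₀ y₀).isOpen.measurableSet.inter measurableSet_Iic)
    fun y hy => h y hy.2

end Criterion

/-! ### Feller's entrance condition -/

section Entrance

variable {I : Set ℝ} {p q : ℝ → ℝ} {c : ℝ}

theorem uIoc_subset_uIoc_of_mem {c x y : ℝ} (h : x ∈ uIoc c y) : uIoc c x ⊆ uIoc c y := by
  rcases le_total c y with hy | hy
  · rw [uIoc_of_le hy] at h ⊢
    rw [uIoc_of_le h.1.le]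
    exact Ioc_subset_Ioc_right h.2
  · rw [uIoc_of_ge hy] at h ⊢
    rw [uIoc_of_ge h.2]
    exact Ioc_subset_Ioc_left h.1.le

theorem setLIntegral_uIoc_pos {f : ℝ → ℝ≥0∞} {x y : ℝ}
    (hf : AEMeasurable f (volume.restrict (uIoc x y))) (h : ∀ᵐ t, t ∈ uIoc x y → 0 < f t)
    (hxy : x ≠ y) : 0 < ∫⁻ t in uIoc x y, f t := by
  rw [pos_iff_ne_zero, Ne, lintegral_eq_zero_iff' hf]
  intro h0
  have h1 : ∀ᵐ t ∂volume.restrict (uIoc x y), False := by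
    filter_upwards [h0, (ae_restrict_iff' measurableSet_uIoc).2 h] with t h2 h3 using h3.ne' h2
  have h2 : volume (uIoc x y) = 0 := by simpa using h1
  rw [uIoc, Real.volume_Ioc, ENNReal.ofReal_eq_zero, sub_nonpos] at h2
  exact hxy (by
    have := min_le_left x y
    have := min_le_right x y
    have := le_max_left x y
    have := le_max_right x y
    linarith [le_antisymm (show x ≤ y by linarith) (by linarith)])

namespace IsSturmLiouville

/-- Absorption of the tail in the integral equation for the sum of the Picard iterates. -/
theorem lintegral_mul_sturmSum_ne_top (hS : IsSturmLiouville I p q) (hc : c ∈ I) {s : ℕ → ℝ}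
    (hsI : ∀ n, s n ∈ I) (hs : Monotone fun n => uIoc c (s n))
    (h1 : ∫⁻ t in ⋃ n, uIoc c (s n), ENNReal.ofReal (q t) ≠ ⊤)
    (h2 : ∫⁻ t in ⋃ n, uIoc c (s n), ENNReal.ofReal (q t) *
      ∫⁻ r in uIoc c t, ENNReal.ofReal (p r) ≠ ⊤) :
    ∫⁻ t in ⋃ n, uIoc c (s n), ENNReal.ofReal (q t) * sturmSum p q c t ≠ ⊤ := by
  set D := ⋃ n, uIoc c (s n) with hD
  set Q : ℝ → ℝ≥0∞ := fun t => ENNReal.ofReal (q t) with hQ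
  set P : ℝ → ℝ≥0∞ := fun t => ∫⁻ r in uIoc c t, ENNReal.ofReal (p r) with hP
  set M : ℝ → ℝ≥0∞ := fun y => ∫⁻ t in uIoc c y, Q t * sturmSum p q c t with hM
  set E := ∫⁻ t in D, Q t * P t with hE
  have hDn : ∀ n, uIoc c (s n) ⊆ D := subset_iUnion fun n => uIoc c (s n)
  have hMI : ∀ n, M (s n) ≠ ⊤ := by
    intro n
    obtain ⟨C, hC⟩ := hS.exists_sturmSum_le hc (hsI n)
    refine ne_top_of_le_ne_top (ENNReal.mul_ne_top (hS.lintegral_q_lt_top hc (hsI n)).ne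
      (ENNReal.ofReal_ne_top (r := C))) ?_
    rw [← lintegral_mul_const' _ _ ENNReal.ofReal_ne_top]
    exact setLIntegral_mono' measurableSet_uIoc fun t ht =>
      mul_le_mul_right (hC t (uIoc_subset_uIcc ht)) _
  have hU : ∀ n, ∀ t ∈ uIoc c (s n), sturmSum p q c t ≤ 1 + P t * M t := by
    intro n t ht
    rw [hS.sturmSum_eq hc (hS.uIoc_subset hc (hsI n) ht)]
    gcongr
    have hMt : M t ≠ ⊤ :=
      ne_top_of_le_ne_top (hMI n) (lintegral_mono_set (uIoc_subset_uIoc_of_mem ht))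
    rw [hP, ← lintegral_mul_const' _ _ hMt]
    exact setLIntegral_mono' measurableSet_uIoc fun r hr =>
      mul_le_mul_right (lintegral_mono_set (uIoc_subset_uIoc_of_mem hr)) _
  have hsup : ∀ f : ℝ → ℝ≥0∞, ∫⁻ t in D, f t = ⨆ n, ∫⁻ t in uIoc c (s n), f t := fun f =>
    setLIntegral_iUnion_of_directed f hs.directed_le
  -- N is chosen so that the tail of ∫ Q P is at most 1/2. The contribution of that tail to M(sₙ) is
  -- then at most half of M(sₙ), which is finite for each n and can be subtracted, leaving a bound
  -- independent of n.
  obtain ⟨N, hN⟩ : ∃ N, E ≤ (∫⁻ t in uIoc c (s N), Q t * P t) + 2⁻¹ := by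
    by_cases hE0 : E = 0
    · exact ⟨0, by simp [hE0]⟩
    have hlt : E - 2⁻¹ < ⨆ n, ∫⁻ t in uIoc c (s n), Q t * P t := by
      rw [← hsup]
      exact ENNReal.sub_lt_self h2 hE0 (by simp)
    obtain ⟨N, hN⟩ := lt_iSup_iff.1 hlt
    exact ⟨N, tsub_le_iff_right.1 hN.le⟩
  have htail : ∫⁻ t in D \ uIoc c (s N), Q t * P t ≤ 2⁻¹ := by
    have h3 : E = (∫⁻ t in uIoc c (s N), Q t * P t) + ∫⁻ t in D \ uIoc c (s N), Q t * P t := by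
      rw [hE, ← lintegral_inter_add_sdiff (fun t => Q t * P t) D measurableSet_uIoc,
        inter_eq_right.2 (hDn N)]
    rw [h3] at hN
    exact (ENNReal.add_le_add_iff_left
      (ne_top_of_le_ne_top h2 (lintegral_mono_set (hDn N)))).1 hN
  have hmain : ∀ n, N ≤ n → M (s n) ≤ 2 * ((∫⁻ t in D, Q t) + E * M (s N)) := by
    intro n hn
    have hQm := hS.aemeasurable_q hc (hsI n)
    have h3 : M (s n) ≤ ((∫⁻ t in D, Q t) + E * M (s N)) + 2⁻¹ * M (s n) := by
      calc M (s n) ≤ ∫⁻ t in uIoc c (s n), (Q t + Q t * P t * M t) := by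
            refine setLIntegral_mono' measurableSet_uIoc fun t ht => ?_
            refine (mul_le_mul_right (hU n t ht) _).trans ?_
            rw [mul_add, mul_one, mul_assoc]
        _ = (∫⁻ t in uIoc c (s n), Q t) + ∫⁻ t in uIoc c (s n), Q t * P t * M t :=
            lintegral_add_left' hQm _
        _ ≤ (∫⁻ t in D, Q t) + (E * M (s N) + 2⁻¹ * M (s n)) := by
            gcongr
            · exact hDn n
            · rw [← lintegral_inter_add_sdiff (fun t => Q t * P t * M t) _
                (measurableSet_uIoc (a := c) (b := s N)), inter_eq_right.2 (hs hn)]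
              gcongr
              · refine (setLIntegral_mono' measurableSet_uIoc fun t ht => ?_).trans
                  ((lintegral_mul_const' (M (s N)) (fun t => Q t * P t) (hMI N)).le.trans
                    (mul_le_mul_left (lintegral_mono_set (hDn N)) _))
                exact mul_le_mul_right (lintegral_mono_set (uIoc_subset_uIoc_of_mem ht)) _
              · refine (setLIntegral_mono' (measurableSet_uIoc.diff measurableSet_uIoc)
                  fun t ht => ?_).trans
                  ((lintegral_mul_const' (M (s n)) (fun t => Q t * P t) (hMI n)).le.trans
                    (mul_le_mul_left ((lintegral_mono_set (sdiff_subset_sdiff_left (hDn n))).trans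
                      htail) _))
                exact mul_le_mul_right (lintegral_mono_set (uIoc_subset_uIoc_of_mem ht.1)) _
        _ = _ := (add_assoc _ _ _).symm
    have h4 : M (s n) = 2⁻¹ * M (s n) + 2⁻¹ * M (s n) := by
      rw [← add_mul, ENNReal.inv_two_add_inv_two, one_mul]
    have h5 : 2⁻¹ * M (s n) ≤ (∫⁻ t in D, Q t) + E * M (s N) := by
      exact (ENNReal.add_le_add_iff_right (ENNReal.mul_ne_top (by simp) (hMI n))).1
        (h4.symm.le.trans h3)
    calc M (s n) = 2 * (2⁻¹ * M (s n)) := by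
          rw [← mul_assoc, ENNReal.mul_inv_cancel two_ne_zero ENNReal.ofNat_ne_top, one_mul]
      _ ≤ _ := mul_le_mul_right h5 _
  refine ne_top_of_le_ne_top (b := 2 * ((∫⁻ t in D, Q t) + E * M (s N))) ?_ ?_
  · exact ENNReal.mul_ne_top (by simp) (ENNReal.add_ne_top.2 ⟨h1, ENNReal.mul_ne_top h2 (hMI N)⟩)
  · rw [hsup]
    refine iSup_le fun n => ?_
    exact (lintegral_mono_set (hs (le_max_left n N))).trans (hmain _ (le_max_right n N))

/-- The finiteness of the first iterate gives the finiteness of the sum. -/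
theorem lintegral_mul_sturmSum_ne_top_iff (hS : IsSturmLiouville I p q) (hc : c ∈ I) {s : ℕ → ℝ}
    (hsI : ∀ n, s n ∈ I) (hs : Monotone fun n => uIoc c (s n)) (hs0 : s 0 ≠ c) :
    ∫⁻ t in ⋃ n, uIoc c (s n), ENNReal.ofReal (q t) * sturmSum p q c t ≠ ⊤ ↔
    ∫⁻ t in ⋃ n, uIoc c (s n), ENNReal.ofReal (q t) * sturmIter p q c 1 t ≠ ⊤ := by
  set D := ⋃ n, uIoc c (s n) with hD
  set Q : ℝ → ℝ≥0∞ := fun t => ENNReal.ofReal (q t) with hQ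
  set P : ℝ → ℝ≥0∞ := fun t => ∫⁻ r in uIoc c t, ENNReal.ofReal (p r) with hP
  set N : ℝ → ℝ≥0∞ := sturmIter p q c 1 with hN
  set R : ℝ → ℝ≥0∞ := fun r => ∫⁻ t in uIoc c r, Q t with hR
  have hNe : ∀ y, N y = ∫⁻ r in uIoc c y, ENNReal.ofReal (p r) * R r := fun y => by
    simp only [hN, hR, hQ, sturmIter, mul_one]
  constructor
  · refine fun h => ne_top_of_le_ne_top h (lintegral_mono fun t => mul_le_mul_right ?_ _)
    exact ENNReal.le_tsum 1
  intro h
  have hs0' : c ≠ s 0 := hs0.symm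
  have hDn : ∀ n, uIoc c (s n) ⊆ D := subset_iUnion fun n => uIoc c (s n)
  have hDm : MeasurableSet D := MeasurableSet.iUnion fun n => measurableSet_uIoc
  -- All sₙ lie on the same side of c as s₀, so a point of D outside the first interval is farther
  -- from c than s₀.
  have hcase : ∀ t ∈ D, t ∉ uIoc c (s 0) → uIoc c (s 0) ⊆ uIoc c t := by
    intro t ht ht0
    obtain ⟨n, hn⟩ := mem_iUnion.1 ht
    rcases lt_or_gt_of_ne hs0' with h0 | h0
    · have h3 : s 0 ∈ uIoc c (s n) := hs (Nat.zero_le n) (by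
        beta_reduce
        rw [uIoc_of_le h0.le]
        exact ⟨h0, le_rfl⟩)
      have hcn : c < s n := by
        by_contra hcn
        rw [uIoc_of_ge (not_lt.1 hcn)] at h3
        exact absurd h3.2 (not_le.2 h0)
      rw [uIoc_of_le hcn.le] at hn
      rw [uIoc_of_le h0.le] at ht0 ⊢
      rw [uIoc_of_le hn.1.le]
      exact Ioc_subset_Ioc_right (le_of_not_ge fun h' => ht0 ⟨hn.1, h'⟩)
    · have h3 : c ∈ uIoc c (s n) := hs (Nat.zero_le n) (by
        beta_reduce
        rw [uIoc_of_ge h0.le]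
        exact ⟨h0, le_rfl⟩)
      have hcn : s n < c := by
        by_contra hcn
        rw [uIoc_of_le (not_lt.1 hcn)] at h3
        exact absurd h3.1 (lt_irrefl _)
      rw [uIoc_of_ge hcn.le] at hn
      rw [uIoc_of_ge h0.le] at ht0 ⊢
      rw [uIoc_of_ge hn.2]
      exact Ioc_subset_Ioc_left (le_of_not_gt fun h' => ht0 ⟨h', hn.2⟩)
  have hRpos : ∀ r ∈ I, c ≠ r → 0 < R r := fun r hr hcr =>
    setLIntegral_uIoc_pos (hS.aemeasurable_q hc hr) (hS.q_pos.mono fun t ht htr =>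
      ENNReal.ofReal_pos.2 (ht (hS.uIoc_subset hc hr htr))) hcr
  have hRtop : R (s 0) ≠ ⊤ := (hS.lintegral_q_lt_top hc (hsI 0)).ne
  have hNpos : 0 < N (s 0) := by
    rw [hNe]
    refine setLIntegral_uIoc_pos ((hS.aemeasurable_p hc (hsI 0)).mul
      (measurable_setLIntegral_uIoc Q c).aemeasurable) ?_ hs0'
    have hne : ∀ᵐ t : ℝ, t ≠ c := by simp [ae_iff, measure_singleton]
    filter_upwards [hne] with t htc ht
    have htI := hS.uIoc_subset hc (hsI 0) ht
    exact ENNReal.mul_pos (ENNReal.ofReal_pos.2 (hS.p_pos t htI)).ne' (hRpos t htI htc.symm).ne'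
  have hN1 : N (s 0) ≠ ⊤ := by
    obtain ⟨C, hC⟩ := hS.exists_sturmSum_le hc (hsI 0)
    exact ne_top_of_le_ne_top ENNReal.ofReal_ne_top
      ((ENNReal.le_tsum 1).trans (hC (s 0) right_mem_uIcc))
  have hP0 : P (s 0) ≠ ⊤ :=
    ((hS.continuousOn.mono (hS.ordConnected.uIcc_subset hc (hsI 0))).intervalIntegrable
      (μ := volume)).def'.lintegral_lt_top.ne
  -- Beyond s₀ the first iterate is at least its value N(s₀) > 0, so the mass of q there is at most
  -- N(s₀)⁻¹ ∫ Q N.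
  have hQD : ∫⁻ t in D, Q t ≠ ⊤ := by
    rw [← lintegral_inter_add_sdiff Q D (measurableSet_uIoc (a := c) (b := s 0)),
      inter_eq_right.2 (hDn 0)]
    refine ENNReal.add_ne_top.2 ⟨hRtop, ?_⟩
    refine ne_top_of_le_ne_top (ENNReal.mul_ne_top h (ENNReal.inv_ne_top.2 hNpos.ne')) ?_
    rw [← lintegral_mul_const' _ _ (ENNReal.inv_ne_top.2 hNpos.ne')]
    refine (setLIntegral_mono' (hDm.diff measurableSet_uIoc) fun t ht => ?_).trans
      (lintegral_mono_set sdiff_subset)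
    have h3 : N (s 0) ≤ N t := by
      rw [hNe, hNe]
      exact lintegral_mono_set (hcase t ht.1 ht.2)
    calc Q t = Q t * N (s 0) * (N (s 0))⁻¹ := by
          rw [mul_assoc, ENNReal.mul_inv_cancel hNpos.ne' hN1, mul_one]
      _ ≤ Q t * N t * (N (s 0))⁻¹ := by gcongr
  refine hS.lintegral_mul_sturmSum_ne_top hc hsI hs hQD ?_
  have hQm : AEMeasurable Q (volume.restrict D) :=
    aemeasurable_iUnion_iff.2 fun n => hS.aemeasurable_q hc (hsI n)
  have hR0 := (hRpos _ (hsI 0) hs0').ne'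
  -- Beyond s₀ the inner integral R is at least R(s₀) > 0, so p ≤ pR/R(s₀) there. This bounds ∫ Q P
  -- by finite multiples of ∫ Q and ∫ Q N.
  have hPle : ∀ t ∈ D, P t ≤ P (s 0) + N t * (R (s 0))⁻¹ := by
    intro t ht
    by_cases ht0 : t ∈ uIoc c (s 0)
    · exact (lintegral_mono_set (uIoc_subset_uIoc_of_mem ht0)).trans le_self_add
    have h3 := hcase t ht ht0
    change ∫⁻ r in uIoc c t, ENNReal.ofReal (p r) ≤ _
    rw [← lintegral_inter_add_sdiff _ (uIoc c t) (measurableSet_uIoc (a := c) (b := s 0)),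
      inter_eq_right.2 h3]
    refine add_le_add_right ?_ _
    rw [hNe, ← lintegral_mul_const' _ _ (ENNReal.inv_ne_top.2 hR0)]
    refine (setLIntegral_mono' (measurableSet_uIoc.diff measurableSet_uIoc) fun r hr => ?_).trans
      (lintegral_mono_set sdiff_subset)
    obtain ⟨n, hn⟩ := mem_iUnion.1 ht
    have h4 : R (s 0) ≤ R r := lintegral_mono_set
      (hcase r (hDn n (uIoc_subset_uIoc_of_mem hn hr.1)) hr.2)
    calc ENNReal.ofReal (p r) = ENNReal.ofReal (p r) * R (s 0) * (R (s 0))⁻¹ := by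
          rw [mul_assoc, ENNReal.mul_inv_cancel hR0 hRtop, mul_one]
      _ ≤ ENNReal.ofReal (p r) * R r * (R (s 0))⁻¹ := by gcongr
  refine ne_top_of_le_ne_top (b := (∫⁻ t in D, Q t) * P (s 0) +
    (∫⁻ t in D, Q t * N t) * (R (s 0))⁻¹) (ENNReal.add_ne_top.2 ⟨ENNReal.mul_ne_top hQD hP0,
    ENNReal.mul_ne_top h (ENNReal.inv_ne_top.2 hR0)⟩) ?_
  rw [← lintegral_mul_const' _ _ hP0, ← lintegral_mul_const' _ _ (ENNReal.inv_ne_top.2 hR0),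
    ← lintegral_add_left' (hQm.mul_const _)]
  refine setLIntegral_mono' hDm fun t ht => ?_
  refine (mul_le_mul_right (hPle t ht) _).trans ?_
  rw [mul_add, mul_assoc]

end IsSturmLiouville

end Entrance

/-! ### The iterated integrals at the two end points -/

section Endpoints

theorem IsOpen.exists_iUnion_uIoc_right {I : Set ℝ} (ho : IsOpen I) [hI : I.OrdConnected] {c : ℝ}
    (hc : c ∈ I) : ∃ s : ℕ → ℝ, (∀ n, s n ∈ I) ∧ (Monotone fun n => uIoc c (s n)) ∧ s 0 ≠ c ∧
      I ∩ Ioi c = ⋃ n, uIoc c (s n) := by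
  obtain ⟨r, s, -, hs, hrs, hex⟩ := ho.exists_exhaustion ⟨c, hc⟩
  -- The exhaustion is started at index k so that every right end point lies strictly beyond c.
  obtain ⟨k, -, hk⟩ := hex c hc
  have hks : ∀ n, c < s (n + k) := fun n => hk.trans_le (hs (Nat.le_add_left k n))
  refine ⟨fun n => s (n + k), fun n => (hrs _).2, fun m n hmn => ?_, (hks 0).ne', ?_⟩
  · simp only [uIoc_of_le (hks _).le]
    exact Ioc_subset_Ioc_right (hs (by omega))
  · simp only [uIoc_of_le (hks _).le]
    ext x
    refine ⟨fun hx => ?_, fun hx => ?_⟩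
    · obtain ⟨n, -, hn⟩ := hex x hx.1
      exact mem_iUnion.2 ⟨n, hx.2, hn.le.trans (hs (Nat.le_add_right n k))⟩
    · obtain ⟨n, hn⟩ := mem_iUnion.1 hx
      exact ⟨hI.out hc (hrs _).2 (Ioc_subset_Icc_self hn), hn.1⟩

theorem IsOpen.exists_iUnion_uIoc_left {I : Set ℝ} (ho : IsOpen I) [hI : I.OrdConnected] {c : ℝ}
    (hc : c ∈ I) : ∃ s : ℕ → ℝ, (∀ n, s n ∈ I) ∧ (Monotone fun n => uIoc c (s n)) ∧ s 0 ≠ c ∧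
      I ∩ Iic c = ⋃ n, uIoc c (s n) := by
  obtain ⟨r, s, hr, -, hrs, hex⟩ := ho.exists_exhaustion ⟨c, hc⟩
  obtain ⟨k, hk, -⟩ := hex c hc
  have hks : ∀ n, r (n + k) < c := fun n => (hr (Nat.le_add_left k n)).trans_lt hk
  refine ⟨fun n => r (n + k), fun n => (hrs _).1, fun m n hmn => ?_, (hks 0).ne, ?_⟩
  · simp only [uIoc_of_ge (hks _).le]
    exact Ioc_subset_Ioc_left (hr (by omega))
  · simp only [uIoc_of_ge (hks _).le]
    ext x
    refine ⟨fun hx => ?_, fun hx => ?_⟩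
    · obtain ⟨n, hn, -⟩ := hex x hx.1
      exact mem_iUnion.2 ⟨n, (hr (Nat.le_add_right n k)).trans_lt hn, hx.2⟩
    · obtain ⟨n, hn⟩ := mem_iUnion.1 hx
      exact ⟨hI.out (hrs _).1 hc (Ioc_subset_Icc_self hn), hn.2⟩

variable {x₀ y₀ : EReal} {a b V : ℝ → ℝ} {c lam : ℝ}

/-- When V = 0, q = λρ, so integrating against q or ρ differs by the factor λ and the first iterate
is λ times Feller's double integral. Positive finite factors do not affect divergence. -/
theorem Admissible.lintegral_sturmSum_eq_top_iff (h : Admissible x₀ y₀ a b V)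
    (hc : c ∈ openInterval x₀ y₀) (hlam : 0 < lam)
    (hV : ∀ᵐ x ∂(volume.restrict (openInterval x₀ y₀ : Set ℝ)), V x = 0) {s : ℕ → ℝ}
    (hsI : ∀ n, s n ∈ openInterval x₀ y₀) (hs : Monotone fun n => uIoc c (s n)) (hs0 : s 0 ≠ c) :
    ∫⁻ x in ⋃ n, uIoc c (s n), ENNReal.ofReal (fellerSpeed a b c x) *
      sturmSum (fun x => 1 / fellerScale a b c x)
        (fun x => fellerSpeed a b c x * (lam + V x)) c x = ⊤ ↔
    ∫⁻ x in ⋃ n, uIoc c (s n), ENNReal.ofReal (fellerSpeed a b c x) *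
      ∫⁻ r in uIoc c x, ENNReal.ofReal (1 / fellerScale a b c r) *
        ∫⁻ t in uIoc c r, ENNReal.ofReal (fellerSpeed a b c t) = ⊤ := by
  set D := ⋃ n, uIoc c (s n)
  have hS := (h.isWeightedSturmLiouville hc hlam).sturm
  have hDm : MeasurableSet D := MeasurableSet.iUnion fun n => measurableSet_uIoc
  have hDI : D ⊆ openInterval x₀ y₀ := iUnion_subset fun n => hS.uIoc_subset hc (hsI n)
  have hq : ∀ᵐ x, x ∈ openInterval x₀ y₀ →
      ENNReal.ofReal (fellerSpeed a b c x * (lam + V x)) =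
        ENNReal.ofReal lam * ENNReal.ofReal (fellerSpeed a b c x) := by
    filter_upwards [(ae_restrict_iff' (openInterval x₀ y₀).isOpen.measurableSet).1 hV] with x hx hxI
    rw [hx hxI, add_zero, mul_comm, ENNReal.ofReal_mul hlam.le]
  have hl0 : ENNReal.ofReal lam ≠ 0 := (ENNReal.ofReal_pos.2 hlam).ne'
  have hmul : ∀ {A B : ℝ≥0∞}, A = ENNReal.ofReal lam * B → (A = ⊤ ↔ B = ⊤) := by
    rintro A B rfl
    simp [ENNReal.mul_eq_top, hl0]
  have hDq : ∀ U : ℝ → ℝ≥0∞, ∫⁻ x in D, ENNReal.ofReal (fellerSpeed a b c x * (lam + V x)) * U x =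
      ENNReal.ofReal lam * ∫⁻ x in D, ENNReal.ofReal (fellerSpeed a b c x) * U x := fun U => by
    rw [← lintegral_const_mul' _ _ ENNReal.ofReal_ne_top]
    refine lintegral_congr_ae ((ae_restrict_iff' hDm).2 (hq.mono fun x hx hxD => ?_))
    simp only [hx (hDI hxD), mul_assoc]
  have h1 := not_iff_not.1 (hS.lintegral_mul_sturmSum_ne_top_iff hc hsI hs hs0)
  rw [hmul (hDq _), hmul (hDq _)] at h1
  rw [h1]
  refine hmul ?_
  rw [← lintegral_const_mul' _ _ ENNReal.ofReal_ne_top]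
  refine setLIntegral_congr_fun hDm fun x hx => ?_
  simp only [sturmIter, mul_one]
  refine (congrArg (ENNReal.ofReal (fellerSpeed a b c x) * ·) (Eq.trans ?_
    (lintegral_const_mul' _ _ ENNReal.ofReal_ne_top))).trans (mul_left_comm _ _ _)
  refine setLIntegral_congr_fun measurableSet_uIoc fun r hr => ?_
  refine (congrArg (ENNReal.ofReal (1 / fellerScale a b c r) * ·) (Eq.trans ?_
    (lintegral_const_mul' _ _ ENNReal.ofReal_ne_top))).trans (mul_left_comm _ _ _)
  exact lintegral_congr_ae ((ae_restrict_iff' measurableSet_uIoc).2 (hq.mono fun t ht htr =>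
    ht (hS.uIoc_subset hc (hS.uIoc_subset hc (hDI hx) hr) htr)))

end Endpoints

end

/-! ### The main theorem -/

theorem mainTheorem2 (x₀ y₀ : EReal) (a b V : ℝ → ℝ) (h : Admissible x₀ y₀ a b V)
    (c : ℝ) (hc : c ∈ openInterval x₀ y₀) (lam : ℝ) (hlam : 0 < lam) :
    IsPreGenerator (testInclusion x₀ y₀ (speedMeasure x₀ y₀ a b c)) (schrodingerOperator h c) ∧
    (IsUniquePreGenerator (testInclusion x₀ y₀ (speedMeasure x₀ y₀ a b c))
        (schrodingerOperator h c) ↔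
      (∫⁻ y in {y : ℝ | c < y ∧ (y : EReal) < y₀},
          ENNReal.ofReal (fellerSpeed a b c y) * ∑' n : ℕ, phiIter a b V lam c n y) = ⊤ ∧
      (∫⁻ x in {x : ℝ | x₀ < (x : EReal) ∧ x < c},
          ENNReal.ofReal (fellerSpeed a b c x) * ∑' n : ℕ, psiIter a b V lam c n x) = ⊤) ∧
    ((∀ᵐ x ∂(volume.restrict (openInterval x₀ y₀ : Set ℝ)), V x = 0) →
      (IsUniquePreGenerator (testInclusion x₀ y₀ (speedMeasure x₀ y₀ a b c))
          (schrodingerOperator h c) ↔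
        (∫⁻ y in {y : ℝ | c < y ∧ (y : EReal) < y₀}, ENNReal.ofReal (fellerSpeed a b c y) *
            ∫⁻ r in Ioc c y, ENNReal.ofReal (1 / fellerScale a b c r) *
              ∫⁻ t in Ioc c r, ENNReal.ofReal (fellerSpeed a b c t)) = ⊤ ∧
        (∫⁻ x in {x : ℝ | x₀ < (x : EReal) ∧ x < c}, ENNReal.ofReal (fellerSpeed a b c x) *
            ∫⁻ r in Ioc x c, ENNReal.ofReal (1 / fellerScale a b c r) *
              ∫⁻ t in Ioc r c, ENNReal.ofReal (fellerSpeed a b c t)) = ⊤)) := by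
  have hphi : (∫⁻ y in {y : ℝ | c < y ∧ (y : EReal) < y₀},
      ENNReal.ofReal (fellerSpeed a b c y) * ∑' n : ℕ, phiIter a b V lam c n y) = _ :=
    setLIntegral_right_eq hc (g := fun y => ENNReal.ofReal (fellerSpeed a b c y) *
      sturmSum (fun x => 1 / fellerScale a b c x)
        (fun x => fellerSpeed a b c x * (lam + V x)) c y) fun y hy => by
      simp only [phiIter_eq_sturmIter a b V lam c _ y hy, sturmSum]
  have hpsi : (∫⁻ x in {x : ℝ | x₀ < (x : EReal) ∧ x < c},
      ENNReal.ofReal (fellerSpeed a b c x) * ∑' n : ℕ, psiIter a b V lam c n x) = _ :=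
    setLIntegral_left_eq hc (g := fun y => ENNReal.ofReal (fellerSpeed a b c y) *
      sturmSum (fun x => 1 / fellerScale a b c x)
        (fun x => fellerSpeed a b c x * (lam + V x)) c y) fun y hy => by
      simp only [psiIter_eq_sturmIter a b V lam c _ y hy, sturmSum]
  refine ⟨h.isPreGenerator hc, ?_, fun hV => ?_⟩
  · rw [hphi, hpsi]
    exact h.isUniquePreGenerator_iff hc hlam
  · have hS := (h.isWeightedSturmLiouville hc hlam).sturm
    rw [h.isUniquePreGenerator_iff hc hlam]
    refine and_congr ?_ ?_
    · rw [setLIntegral_right_eq hc (g := fun y => ENNReal.ofReal (fellerSpeed a b c y) *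
        ∫⁻ r in uIoc c y, ENNReal.ofReal (1 / fellerScale a b c r) *
          ∫⁻ t in uIoc c r, ENNReal.ofReal (fellerSpeed a b c t)) fun y hy => by
        rw [uIoc_of_le hy]
        congr 1
        refine setLIntegral_congr_fun measurableSet_Ioc fun r hr => ?_
        rw [uIoc_of_le hr.1.le]]
      obtain ⟨s, hsI, hs, hs0, hD⟩ := hS.isOpen.exists_iUnion_uIoc_right hc
      rw [hD]
      exact h.lintegral_sturmSum_eq_top_iff hc hlam hV hsI hs hs0
    · rw [setLIntegral_left_eq hc (g := fun y => ENNReal.ofReal (fellerSpeed a b c y) *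
        ∫⁻ r in uIoc c y, ENNReal.ofReal (1 / fellerScale a b c r) *
          ∫⁻ t in uIoc c r, ENNReal.ofReal (fellerSpeed a b c t)) fun y hy => by
        rw [uIoc_of_ge hy]
        congr 1
        refine setLIntegral_congr_fun measurableSet_Ioc fun r hr => ?_
        rw [uIoc_of_ge hr.2]]
      obtain ⟨s, hsI, hs, hs0, hD⟩ := hS.isOpen.exists_iUnion_uIoc_left hc
      rw [hD]
      exact h.lintegral_sturmSum_eq_top_iff hc hlam hV hsI hs hs0
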